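/- Let $p$ be a prime and let $k$ be an arbitrary field of characteristic $p$. Let $Y$ be a smooth proper integral curve over $k$, let $y \in Y(k)$ be a $k$-rational point, and put $Y' = Y \setminus \{y\}$. Choose an isomorphism of $k$-algebras $\widehat{\mathcal{O}_{Y,y}} \cong k[[t]]$. It induces a morphism $\operatorname{Spec} k((t)) \to Y'$ (the inclusion of the formal punctured neighbourhood of $y$) and a ring homomorphism $\mathcal{O}(Y') \hookrightarrow k((t))$ through which we regard $\mathcal{O}(Y')$ as a subring of $k((t))$. For a scheme $S$ and a (not necessarily abelian) group $\Gamma$ let $H^1(S,\Gamma) = \check{H}^1_{\mathrm{et}}(S, \underline{\Gamma})$ be the Čech cohomology set of the constant sheaf of groups $\underline{\Gamma}$ in the étale topology of $S$, which classifies principal $\Gamma$-bundles on $S$ up to isomorphism, and let $$\Psi_{Y,y,\Gamma} \colon H^1(Y',\Gamma) \to H^1(\operatorname{Spec} k((t)),\Gamma)$$ be the map given by pullback along $\operatorname{Spec} k((t)) \to Y'$. For a ring $R$ of characteristic $p$ let $\wp \colon R \to R$, $\wp(f) = f^p - f$, be the Artin--Schreier map. Let $G$ be a nontrivial finite $p$-group.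 Then the following are equivalent: (i) The equality $\wp(k((t))) \cap \mathcal{O}(Y') = \wp(\mathcal{O}(Y'))$ holds in $k((t))$. (ii) The map $\Psi_{Y,y,G}$ is injective. (iii) The map $\Psi_{Y,y,\mathbb{Z}/p\mathbb{Z}}$ is injective. -/

import Mathlib

open CategoryTheory CategoryTheory.Limits AlgebraicGeometry
open CategoryTheory.PresheafOfGroups
open scoped PowerSeries LaurentSeries

universe w u

namespace LocalGlobal

noncomputable section

/-! ### Čech cohomology of constant sheaves of groups in the étale topology -/

/-- The constant étale sheaf of groups attached to `G`: its sections over a scheme `T` are the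
locally constant functions `T → G`. -/
def constSheaf (G : Type w) [Group G] : Scheme.{u}ᵒᵖ ⥤ GrpCat.{max u w} where
  obj T := GrpCat.of (LocallyConstant T.unop G)
  map f := GrpCat.ofHom (LocallyConstant.comapMonoidHom f.unop.base.hom)
  map_id _ := rfl
  map_comp _ _ := rfl

/-- The constant sheaf attached to `G` on schemes over `S`. -/
abbrev constSheafOver (S : Scheme.{u}) (G : Type w) [Group G] : (Over S)ᵒᵖ ⥤ GrpCat.{max u w} :=
  (Over.forget S).op ⋙ constSheaf.{w, u} G

/-- Étale coverings of `S`: jointly surjective families of étale morphisms to `S`. -/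
structure EtaleCover (S : Scheme.{u}) where
  /-- The index set. -/
  I₀ : Type u
  /-- The members of the covering. -/
  X : I₀ → Scheme.{u}
  /-- The structure morphisms. -/
  f (i : I₀) : X i ⟶ S
  etale (i : I₀) : Etale (f i)
  exists_eq (x : S) : ∃ (i : I₀) (z : X i), f i z = x

/-- The base change of an étale covering. -/
abbrev pullbackCover {S' S : Scheme.{u}} (f : S' ⟶ S) (𝒰 : EtaleCover S) : EtaleCover S' where
  I₀ := 𝒰.I₀
  X i := pullback f (𝒰.f i)
  f i := pullback.fst f (𝒰.f i)
  etale i := by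
    have : Etale (𝒰.f i) := 𝒰.etale i
    infer_instance
  exists_eq x := by
    obtain ⟨i, z, hz⟩ := 𝒰.exists_eq (f x)
    obtain ⟨t, ht, -⟩ := Scheme.Pullback.exists_preimage_pullback x z hz.symm
    exact ⟨i, t, ht⟩

/-- The common refinement of two étale coverings of `S` by the fibre products of their members. -/
abbrev interCover {S : Scheme.{u}} (𝒰 𝒱 : EtaleCover S) : EtaleCover S where
  I₀ := 𝒰.I₀ × 𝒱.I₀
  X i := pullback (𝒰.f i.1) (𝒱.f i.2)
  f i := pullback.fst (𝒰.f i.1) (𝒱.f i.2) ≫ 𝒰.f i.1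
  etale i := by
    have : Etale (𝒰.f i.1) := 𝒰.etale i.1
    have : Etale (𝒱.f i.2) := 𝒱.etale i.2
    infer_instance
  exists_eq x := by
    obtain ⟨i, z, hz⟩ := 𝒰.exists_eq x
    obtain ⟨j, z', hz'⟩ := 𝒱.exists_eq x
    obtain ⟨t, ht, -⟩ := Scheme.Pullback.exists_preimage_pullback z z' (hz.trans hz'.symm)
    exact ⟨(i, j), t, by rw [Scheme.Hom.comp_apply, ht, hz]⟩

/-- Čech 1-cocycles with values in `G` on an étale covering `(U i → S)`. A section over
`U i ×[S] U j` is given, in the Yoneda manner, by its values on all pairs of `S`-morphisms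
`T ⟶ U i` and `T ⟶ U j`. -/
abbrev Cocycle {S : Scheme.{u}} (G : Type w) [Group G] (𝒰 : EtaleCover S) :=
  OneCocycle (constSheafOver S G) (fun i : 𝒰.I₀ ↦ Over.mk (𝒰.f i))

/-- A morphism from a covering of `S'` to a covering of `S` lying over `f : S' ⟶ S`. For `f = 𝟙 S`
it exhibits the first covering as a refinement of the second one. -/
structure CoverMap {S' S : Scheme.{u}} (f : S' ⟶ S) (𝒱 : EtaleCover S') (𝒰 : EtaleCover S) where
  /-- The map on index sets. -/
  idx : 𝒱.I₀ → 𝒰.I₀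
  /-- The morphisms between the members of the coverings. -/
  hom (i : 𝒱.I₀) : 𝒱.X i ⟶ 𝒰.X (idx i)
  comm (i : 𝒱.I₀) : hom i ≫ 𝒰.f (idx i) = 𝒱.f i ≫ f

namespace CoverMap

variable {S'' S' S : Scheme.{u}} {g : S'' ⟶ S'} {f : S' ⟶ S}
  {𝒲 : EtaleCover S''} {𝒱 : EtaleCover S'} {𝒰 𝒱₀ : EtaleCover S}

/-- An `S'`-morphism to a member of `𝒱`, seen as an `S`-morphism to a member of `𝒰`. -/
def push (m : CoverMap f 𝒱 𝒰) {i : 𝒱.I₀} {T : Over S'} (a : T ⟶ Over.mk (𝒱.f i)) :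
    (Over.map f).obj T ⟶ Over.mk (𝒰.f (m.idx i)) :=
  Over.homMk (a.left ≫ m.hom i) (by
    have h : a.left ≫ 𝒱.f i = T.hom := Over.w a
    simp [m.comm, ← h])

/-- The composition of morphisms of coverings. -/
def comp (n : CoverMap g 𝒲 𝒱) (m : CoverMap f 𝒱 𝒰) : CoverMap (g ≫ f) 𝒲 𝒰 where
  idx i := m.idx (n.idx i)
  hom i := n.hom i ≫ m.hom (n.idx i)
  comm i := by simp [m.comm, reassoc_of% n.comm]

/-- Replacing the base morphism by an equal one. -/
def cast {f' : S' ⟶ S} (m : CoverMap f 𝒱 𝒰) (h : f = f') : CoverMap f' 𝒱 𝒰 where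
  idx := m.idx
  hom := m.hom
  comm i := by rw [m.comm, h]

/-- The projection from the pulled back covering. -/
def ofPullback (f : S' ⟶ S) (𝒰 : EtaleCover S) : CoverMap f (pullbackCover f 𝒰) 𝒰 where
  idx i := i
  hom i := pullback.snd f (𝒰.f i)
  comm _ := pullback.condition.symm

variable {G : Type w} [Group G]

/-- The pullback of a Čech 1-cocycle along a morphism of coverings. -/
def pullbackCocycle (m : CoverMap f 𝒱 𝒰) (γ : Cocycle G 𝒰) : Cocycle G 𝒱 where
  ev i j _ a b := γ.ev (m.idx i) (m.idx j) (m.push a) (m.push b)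
  ev_precomp i j T T' φ a b := by
    have h := γ.ev_precomp (m.idx i) (m.idx j) ((Over.map f).map φ) (m.push a) (m.push b)
    have ha : (Over.map f).map φ ≫ m.push a = m.push (φ ≫ a) := by
      ext; simp [push]
    have hb : (Over.map f).map φ ≫ m.push b = m.push (φ ≫ b) := by
      ext; simp [push]
    rw [ha, hb] at h
    exact h
  ev_trans i j l T a b c := γ.ev_trans _ _ _ (m.push a) (m.push b) (m.push c)

lemma pullbackCocycle_cast {f' : S' ⟶ S} (m : CoverMap f 𝒱 𝒰) (h : f = f') (γ : Cocycle G 𝒰) :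
    (m.cast h).pullbackCocycle γ = m.pullbackCocycle γ := by
  subst h
  rfl

lemma isCohomologous_pullback (m : CoverMap f 𝒱 𝒰) {γ δ : Cocycle G 𝒰}
    (h : γ.IsCohomologous δ) :
    (m.pullbackCocycle γ).IsCohomologous (m.pullbackCocycle δ) := by
  obtain ⟨α, hα⟩ := h
  refine ⟨fun i ↦ (constSheaf.{w, u} G).map (m.hom i).op (α (m.idx i)), fun i j T a b ↦ ?_⟩
  exact hα (m.idx i) (m.idx j) (m.push a) (m.push b)

lemma isCohomologous_of_maps (m m' : CoverMap f 𝒱 𝒰) (γ : Cocycle G 𝒰) :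
    (m.pullbackCocycle γ).IsCohomologous (m'.pullbackCocycle γ) := by
  refine ⟨fun i ↦ γ.ev (m'.idx i) (m.idx i) (m'.push (𝟙 _)) (m.push (𝟙 _)), fun i j T a b ↦ ?_⟩
  have key : ∀ (l : 𝒱.I₀) (c : T ⟶ Over.mk (𝒱.f l)),
      (constSheafOver S' G).map c.op
        (γ.ev (m'.idx l) (m.idx l) (m'.push (𝟙 _)) (m.push (𝟙 _))) =
      γ.ev (m'.idx l) (m.idx l) (m'.push c) (m.push c) := by
    intro l c
    have h := γ.ev_precomp (m'.idx l) (m.idx l) ((Over.map f).map c)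
      (m'.push (𝟙 _)) (m.push (𝟙 _))
    have h₁ : (Over.map f).map c ≫ m'.push (𝟙 (Over.mk (𝒱.f l))) = m'.push c := by
      ext; simp [push]
    have h₂ : (Over.map f).map c ≫ m.push (𝟙 (Over.mk (𝒱.f l))) = m.push c := by
      ext; simp [push]
    rw [h₁, h₂] at h
    exact h
  rw [key i a, key j b]
  exact (γ.ev_trans _ _ _ (m'.push a) (m.push a) (m.push b)).trans
    (γ.ev_trans _ _ _ (m'.push a) (m'.push b) (m.push b)).symm

lemma pullbackCocycle_comp (n : CoverMap g 𝒲 𝒱) (m : CoverMap f 𝒱 𝒰) (γ : Cocycle G 𝒰) :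
    (n.comp m).pullbackCocycle γ = n.pullbackCocycle (m.pullbackCocycle γ) := by
  have key : ((n.comp m).pullbackCocycle γ).toOneCochain =
      (n.pullbackCocycle (m.pullbackCocycle γ)).toOneCochain := by
    refine OneCochain.ext ?_
    funext i j T a b
    let φ : (Over.map (g ≫ f)).obj T ⟶ (Over.map f).obj ((Over.map g).obj T) :=
      Over.homMk (𝟙 T.left) (by simp)
    have h := γ.ev_precomp (m.idx (n.idx i)) (m.idx (n.idx j)) φ
      (m.push (n.push a)) (m.push (n.push b))
    have ha : φ ≫ m.push (n.push a) = (n.comp m).push a := by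
      ext; simp [push, φ, comp]
    have hb : φ ≫ m.push (n.push b) = (n.comp m).push b := by
      ext; simp [push, φ, comp]
    rw [ha, hb] at h
    refine h.symm.trans ?_
    rfl
  cases h₁ : (n.comp m).pullbackCocycle γ
  cases h₂ : n.pullbackCocycle (m.pullbackCocycle γ)
  rw [h₁, h₂] at key
  cases key
  rfl

/-- The projection from the common refinement to the first covering. -/
def interFst (𝒰 𝒱 : EtaleCover S) : CoverMap (𝟙 S) (interCover 𝒰 𝒱) 𝒰 where
  idx i := i.1
  hom i := pullback.fst (𝒰.f i.1) (𝒱.f i.2)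
  comm _ := (Category.comp_id _).symm

/-- The projection from the common refinement to the second covering. -/
def interSnd (𝒰 𝒱 : EtaleCover S) : CoverMap (𝟙 S) (interCover 𝒰 𝒱) 𝒱 where
  idx i := i.2
  hom i := pullback.snd (𝒰.f i.1) (𝒱.f i.2)
  comm _ := pullback.condition.symm.trans (Category.comp_id _).symm

/-- A refinement of coverings of `S` induces one between the base changed coverings. -/
def toPullback (m : CoverMap (𝟙 S) 𝒱₀ 𝒰) (f : S' ⟶ S) :
    CoverMap (𝟙 S') (pullbackCover f 𝒱₀) (pullbackCover f 𝒰) where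
  idx := m.idx
  hom := fun i : 𝒱₀.I₀ ↦
    pullback.lift (pullback.fst f (𝒱₀.f i)) (pullback.snd f (𝒱₀.f i) ≫ m.hom i)
      (by simp [m.comm, pullback.condition])
  comm _ := (pullback.lift_fst _ _ _).trans (Category.comp_id _).symm

end CoverMap

/-- Two Čech 1-cocycles on étale coverings of `S` are equivalent if they become cohomologous on a
common refinement of the two coverings. -/
def cechSetoid (S : Scheme.{u}) (G : Type w) [Group G] :
    Setoid (Σ 𝒰 : EtaleCover S, Cocycle G 𝒰) where
  r x y := ∃ (𝒲 : EtaleCover S) (m : CoverMap (𝟙 S) 𝒲 x.1) (n : CoverMap (𝟙 S) 𝒲 y.1),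
    (m.pullbackCocycle x.2).IsCohomologous (n.pullbackCocycle y.2)
  iseqv :=
    { refl := fun x ↦
        ⟨x.1, ⟨id, fun _ ↦ 𝟙 _, fun _ ↦ by simp⟩, ⟨id, fun _ ↦ 𝟙 _, fun _ ↦ by simp⟩,
          CoverMap.isCohomologous_of_maps _ _ _⟩
      symm := fun ⟨𝒲, m, n, h⟩ ↦
        ⟨𝒲, n, m, (OneCocycle.equivalence_isCohomologous _ _).symm h⟩
      trans := by
        rintro x y z ⟨𝒲, m, n, h⟩ ⟨𝒲', m', n', h'⟩
        have e : 𝟙 S ≫ 𝟙 S = 𝟙 S := Category.comp_id _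
        let a := CoverMap.interFst 𝒲 𝒲'
        let b := CoverMap.interSnd 𝒲 𝒲'
        refine ⟨interCover 𝒲 𝒲', (a.comp m).cast e, (b.comp n').cast e, ?_⟩
        have h₁ : (((a.comp m).cast e).pullbackCocycle x.2).IsCohomologous
            (((a.comp n).cast e).pullbackCocycle y.2) := by
          rw [CoverMap.pullbackCocycle_cast, CoverMap.pullbackCocycle_cast,
            CoverMap.pullbackCocycle_comp, CoverMap.pullbackCocycle_comp]
          exact a.isCohomologous_pullback h
        have h₃ : (((b.comp m').cast e).pullbackCocycle y.2).IsCohomologous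
            (((b.comp n').cast e).pullbackCocycle z.2) := by
          rw [CoverMap.pullbackCocycle_cast, CoverMap.pullbackCocycle_cast,
            CoverMap.pullbackCocycle_comp, CoverMap.pullbackCocycle_comp]
          exact b.isCohomologous_pullback h'
        have h₂ := CoverMap.isCohomologous_of_maps ((a.comp n).cast e) ((b.comp m').cast e) y.2
        have E := OneCocycle.equivalence_isCohomologous (constSheafOver S G)
          (fun i : (interCover 𝒲 𝒲').I₀ ↦ Over.mk ((interCover 𝒲 𝒲').f i))
        exact E.trans h₁ (E.trans h₂ h₃) }

/-- The Čech cohomology set `Ȟ¹(S, G)` of the constant sheaf of groups attached to `G` in the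
étale topology of `S`: the colimit over all étale coverings of their Čech cohomology sets. -/
def H1 (S : Scheme.{u}) (G : Type w) [Group G] : Type (max (u + 1) w) :=
  Quotient (cechSetoid S G)

/-- The pullback map `Ȟ¹(S, G) → Ȟ¹(S', G)` along a morphism `f : S' ⟶ S`. -/
def H1.pullback {S' S : Scheme.{u}} (f : S' ⟶ S) (G : Type w) [Group G] : H1 S G → H1 S' G :=
  Quotient.map (fun x ↦ ⟨pullbackCover f x.1, (CoverMap.ofPullback f x.1).pullbackCocycle x.2⟩) (by
    rintro x y ⟨𝒲, m, n, h⟩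
    refine ⟨pullbackCover f 𝒲, m.toPullback f, n.toPullback f, ?_⟩
    let q := CoverMap.ofPullback f 𝒲
    have E := OneCocycle.equivalence_isCohomologous (constSheafOver S' G)
      (fun i : (pullbackCover f 𝒲).I₀ ↦ Over.mk ((pullbackCover f 𝒲).f i))
    have e₁ : 𝟙 S' ≫ f = f := Category.id_comp f
    have e₂ : f ≫ 𝟙 S = f := Category.comp_id f
    have key : ∀ (z : Σ 𝒰 : EtaleCover S, Cocycle G 𝒰) (r : CoverMap (𝟙 S) 𝒲 z.1),
        ((r.toPullback f).pullbackCocycle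
          ((CoverMap.ofPullback f z.1).pullbackCocycle z.2)).IsCohomologous
          (q.pullbackCocycle (r.pullbackCocycle z.2)) := by
      intro z r
      rw [← CoverMap.pullbackCocycle_comp, ← CoverMap.pullbackCocycle_comp,
        ← CoverMap.pullbackCocycle_cast _ e₁, ← CoverMap.pullbackCocycle_cast _ e₂]
      exact CoverMap.isCohomologous_of_maps _ _ _
    exact E.trans (key x m) (E.trans (q.isCohomologous_pullback h) (E.symm (key y n))))

/-! ### The formal punctured neighbourhood of a rational point of a curve -/

section Curve

variable {k : Type u} [Field k] {Y : Scheme.{u}}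

/-- The underlying point of a `k`-point of `Y`. -/
def point (y : Spec (.of k) ⟶ Y) : Y := y (IsLocalRing.closedPoint k)

/-- The local ring of `Y` at the `k`-point `y`. -/
abbrev localRing (y : Spec (.of k) ⟶ Y) : Type u := Y.presheaf.stalk (point y)

/-- The completed local ring of `Y` at the `k`-point `y`. -/
abbrev completedLocalRing (y : Spec (.of k) ⟶ Y) : Type u :=
  AdicCompletion (IsLocalRing.maximalIdeal (localRing y)) (localRing y)

/-- The structure map from `k` to the local ring at `y` of the `k`-scheme `Y`. -/
def constToLocalRing (π : Y ⟶ Spec (.of k)) (y : Spec (.of k) ⟶ Y) : k →+* localRing y :=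
  ((Scheme.ΓSpecIso (.of k)).inv ≫ π.appTop ≫ Y.presheaf.germ ⊤ (point y) trivial).hom

/-- The choice of an isomorphism of `k`-algebras from the completed local ring at `y` to `k⟦t⟧`. -/
structure FormalCoordinate (π : Y ⟶ Spec (.of k)) (y : Spec (.of k) ⟶ Y) where
  /-- The isomorphism. -/
  equiv : completedLocalRing y ≃+* k⟦X⟧
  map_const (c : k) :
    equiv (algebraMap (localRing y) (completedLocalRing y) (constToLocalRing π y c)) =
      PowerSeries.C c

/-- The complement `Y'` of the `k`-point `y` of the separated `k`-scheme `Y`. -/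
def complement (π : Y ⟶ Spec (.of k)) [IsSeparated π] (y : Spec (.of k) ⟶ Y) (hy : y ≫ π = 𝟙 _) :
    Y.Opens where
  carrier := {point y}ᶜ
  is_open' := by
    have : IsClosedImmersion (y ≫ π) := hy ▸ inferInstance
    have : IsClosedImmersion y := .of_comp y π
    have h : IsClosed (Set.range y) := y.isClosedEmbedding.isClosed_range
    have h' : Set.range y = {point y} := by
      ext z
      constructor
      · rintro ⟨x, rfl⟩
        exact congrArg y (Subsingleton.elim (α := PrimeSpectrum k) x _)
      · rintro rfl
        exact ⟨_, rfl⟩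
    rw [h'] at h
    exact h.isOpen_compl

namespace FormalCoordinate

variable {π : Y ⟶ Spec (.of k)} {y : Spec (.of k) ⟶ Y}

/-- The expansion of germs of functions at `y` as Laurent series. -/
def expand (e : FormalCoordinate π y) : localRing y →+* k⸨X⸩ :=
  ((algebraMap k⟦X⟧ k⸨X⸩).comp (e.equiv : completedLocalRing y →+* k⟦X⟧)).comp
    (algebraMap (localRing y) (completedLocalRing y))

/-- The morphism `Spec k((t)) ⟶ Y` through the spectra of `k⟦t⟧` and of the local ring at `y`. -/
def toCurve (e : FormalCoordinate π y) : Spec (.of k⸨X⸩) ⟶ Y :=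
  Spec.map (CommRingCat.ofHom e.expand) ≫ Y.fromSpecStalk (point y)

lemma exists_expand_ne_zero (e : FormalCoordinate π y) :
    ∃ a ∈ IsLocalRing.maximalIdeal (localRing y), e.expand a ≠ 0 := by
  by_contra! H
  set m := IsLocalRing.maximalIdeal (localRing y) with hm
  have h0 : ∀ a ∈ m, algebraMap (localRing y) (completedLocalRing y) a = 0 := by
    intro a ha
    have h1 := H a ha
    have h2 : Function.Injective (algebraMap k⟦X⟧ k⸨X⸩) := IsFractionRing.injective _ _
    exact e.equiv.injective ((h2 (h1.trans (map_zero _).symm)).trans (map_zero _).symm)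
  have hpow : ∀ n, m ≤ m ^ n := by
    intro n a ha
    have h1 := congrArg (AdicCompletion.evalₐ m n) (h0 a ha)
    rw [map_zero, AlgHom.commutes] at h1
    exact Ideal.Quotient.eq_zero_iff_mem.mp h1
  have hsurj : Function.Surjective (algebraMap (localRing y) (completedLocalRing y)) := by
    intro z
    obtain ⟨x, rfl⟩ := AdicCompletion.mk_surjective m (localRing y) z
    refine ⟨x 1, AdicCompletion.ext_evalₐ fun n ↦ ?_⟩
    rw [AlgHom.commutes, AdicCompletion.evalₐ_mk]
    refine Ideal.Quotient.eq.mpr ?_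
    rcases Nat.eq_zero_or_pos n with rfl | hn
    · simp
    · have h1 : x.val 1 - x.val n ∈ (m ^ 1 • ⊤ : Ideal (localRing y)) :=
        SModEq.sub_mem.mp (x.property hn)
      exact hpow n (by simpa using h1)
  obtain ⟨r, hr⟩ := hsurj (e.equiv.symm PowerSeries.X)
  have hr' : e.equiv (algebraMap (localRing y) (completedLocalRing y) r) = PowerSeries.X := by
    rw [hr, RingEquiv.apply_symm_apply]
  by_cases hrm : r ∈ m
  · rw [h0 r hrm, map_zero] at hr'
    exact PowerSeries.X_ne_zero hr'.symm
  · have hu : IsUnit r := by simpa [hm] using hrm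
    have := (hu.map (algebraMap (localRing y) (completedLocalRing y))).map e.equiv
    rw [hr'] at this
    exact PowerSeries.X_prime.not_isUnit this

lemma range_toCurve [IsSeparated π] (e : FormalCoordinate π y) (hy : y ≫ π = 𝟙 _) :
    Set.range e.toCurve ⊆ Set.range (complement π y hy).ι := by
  rw [Scheme.Opens.range_ι]
  rintro _ ⟨x, rfl⟩ (hx : e.toCurve x = point y)
  obtain ⟨a, ha, hne⟩ := e.exists_expand_ne_zero
  rw [toCurve, Scheme.Hom.comp_apply] at hx
  have h := (Y.fromSpecStalk (point y)).isEmbedding.injective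
    (hx.trans Scheme.fromSpecStalk_closedPoint.symm)
  have ha' : a ∈ (Spec.map (CommRingCat.ofHom e.expand) x).asIdeal := by
    rw [h]; exact ha
  have ha'' : e.expand a ∈ PrimeSpectrum.asIdeal x := ha'
  have : IsUnit (e.expand a) := isUnit_iff_ne_zero.mpr hne
  exact x.isPrime.ne_top (Ideal.eq_top_of_isUnit_mem _ ha'' this)

/-- The morphism `Spec k((t)) ⟶ Y'`, the inclusion of the formal punctured neighbourhood of `y`. -/
def toComplement [IsSeparated π] (e : FormalCoordinate π y) (hy : y ≫ π = 𝟙 _) :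
    Spec (.of k⸨X⸩) ⟶ (complement π y hy : Scheme.{u}) :=
  IsOpenImmersion.lift (complement π y hy).ι e.toCurve (e.range_toCurve hy)

/-- The restriction map `𝒪(Y') → k((t))`. -/
def restrict [IsSeparated π] (e : FormalCoordinate π y) (hy : y ≫ π = 𝟙 _) :
    Γ(complement π y hy, ⊤) →+* k⸨X⸩ :=
  ((e.toComplement hy).appTop ≫ (Scheme.ΓSpecIso (.of k⸨X⸩)).hom).hom

/-- The map `Ψ : Ȟ¹(Y', G) → Ȟ¹(Spec k((t)), G)`. -/
def Psi [IsSeparated π] (e : FormalCoordinate π y) (hy : y ≫ π = 𝟙 _) (G : Type w) [Group G] :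
    H1 (complement π y hy : Scheme.{u}) G → H1 (Spec (.of k⸨X⸩)) G :=
  H1.pullback (e.toComplement hy) G

end FormalCoordinate

end Curve

/-- The Artin–Schreier map `f ↦ f ^ p - f`. -/
def artinSchreier (p : ℕ) {R : Type*} [CommRing R] (f : R) : R := f ^ p - f

end

end LocalGlobal

/-! On an affine scheme `S` of characteristic `p` the étale sequence `0 → ℤ/p → 𝒪 → 𝒪 → 0` given by
`℘` and the vanishing of `H¹(S, 𝒪)` identify `H¹(S, ℤ/p)` with `𝒪(S)/℘(𝒪(S))`. Hence, once `Y'` is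
known to be affine, injectivity of `Ψ` for `ℤ/p` says that a function on `Y'` of the form `℘(h)`
over `k((t))` is already of this form over `Y'`. Since `𝒪(Y') → k((t))` is injective, this is (i).
See `injective_pullback_iff_artinSchreier`, `isAffine_complement`,
`FormalCoordinate.restrict_injective`.

Affineness of `Y'` is obtained without Riemann–Roch. A rational function `x` with a pole is
transcendental over `k`, and its domain of regularity is finite over the affine line: it is proper
by the valuative criterion and has finite fibres (`isFinite_toAffineLine`). The domains of `x` and
`x⁻¹` cover `Y`, and the Čech group `H¹(𝒪)` of this covering is finite-dimensional
(`exists_finite_sup`). Linear dependence of polynomials in a function with a pole at `y` then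
produces a function `a` that is regular exactly off `y` (`exists_mem_iff_ne`), so that `Y'` is the
domain of `a`, finite over the affine line.

From `ℤ/p` to `G`: torsors `γ`, `δ` are isomorphic iff `G`, twisted by `(γ, δ)` through the
two-sided action of `G × G`, has a section. For every finite `p`-group `Γ` acting on a set, a
section of a twist over a one-point scheme forces one over a refinement below
(`HasTwistedSection.exists_refinement`). The section singles out one orbit; if its stabilizer is
proper, it lies in the kernel of some `χ : Γ → ℤ/p`, the pushforward along `χ` is trivial above,
hence below, and the cocycle reduces to `ker χ`, a smaller group.

From `G` to `ℤ/p`: embed `ℤ/p` in the centre of `G` and correct a trivialization by coset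
representatives (`injective_pullback_zmod_of_isPGroup`). -/

namespace LocalGlobal

/-! ### Local rings and closed points of smooth curves. -/

section StalksOfCurves

/-- The local rings of an unramified algebra over a principal ideal domain have principal maximal
ideals. -/
lemma isPrincipal_maximalIdeal_of_formallyUnramified {R S : Type*} [CommRing R] [CommRing S]
    [Algebra R S] [IsPrincipalIdealRing R] [Algebra.EssFiniteType R S]
    [Algebra.FormallyUnramified R S] (q : Ideal S) [q.IsPrime] :
    (IsLocalRing.maximalIdeal (Localization.AtPrime q)).IsPrincipal := by
  let p := q.under R
  let := Localization.AtPrime.algebraOfLiesOver p q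
  have h : Algebra.IsUnramifiedAt R q := inferInstanceAs
    (Algebra.FormallyUnramified R (Localization.AtPrime q))
  -- Unramifiedness: the prime `p` below `q` generates the maximal ideal at `q`, and `p` is
  -- principal.
  have h' := ((Algebra.isUnramifiedAt_iff_map_eq R p q).mp h).2
  rw [← h']
  infer_instance

lemma isPrincipalIdealRing_mvPolynomial (R : Type*) [CommRing R] (hR : IsField R) :
    IsPrincipalIdealRing (MvPolynomial (Fin 1) R) := by
  let := hR.toField
  let e := (MvPolynomial.uniqueAlgEquiv R (Fin 1)).symm
  exact IsPrincipalIdealRing.of_surjective (e : Polynomial R →+* MvPolynomial (Fin 1) R)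
    e.surjective

variable {k : Type u} [Field k] {Y : Scheme.{u}} (π : Y ⟶ Spec (.of k))

lemma isField_gamma_spec (U : (Spec (.of k)).Opens) (x : Spec (.of k)) (hx : x ∈ U) :
    IsField Γ(Spec (.of k), U) := by
  have : U = ⊤ := by
    ext z
    have : z = x := Subsingleton.elim (α := PrimeSpectrum k) z x
    simp [this, hx]
  subst this
  exact (Scheme.ΓSpecIso (.of k)).commRingCatIsoToRingEquiv.toMulEquiv.isField (Field.toIsField k)

/-- Near `z` the curve is étale over a polynomial ring in one variable over a field, which is a
principal ideal domain. -/
lemma isPrincipal_maximalIdeal_stalk [SmoothOfRelativeDimension 1 π] (z : Y) :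
    (IsLocalRing.maximalIdeal (Y.presheaf.stalk z)).IsPrincipal := by
  obtain ⟨U, hU, V, hV, hz, e, hf⟩ :=
    SmoothOfRelativeDimension.exists_isStandardSmoothOfRelativeDimension (n := 1) (f := π) z
  obtain ⟨g, -, hg⟩ := hf.exists_etale_mvPolynomial
  have := isPrincipalIdealRing_mvPolynomial _ (isField_gamma_spec U (π z) (e hz))
  algebraize [g]
  let q := (hV.primeIdealOf ⟨z, hz⟩).asIdeal
  have hq := isPrincipal_maximalIdeal_of_formallyUnramified
    (R := MvPolynomial (Fin 1) Γ(Spec (.of k), U)) q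
  let : Algebra Γ(Y, V) (Y.presheaf.stalk z) := Y.presheaf.algebra_section_stalk ⟨z, hz⟩
  have hl : IsLocalization.AtPrime (Y.presheaf.stalk z) q := hV.isLocalization_stalk ⟨z, hz⟩
  let ee := (IsLocalization.algEquiv q.primeCompl (Localization.AtPrime q)
    (Y.presheaf.stalk z)).toRingEquiv
  have : (IsLocalRing.maximalIdeal (Localization.AtPrime q)).map
      (ee : Localization.AtPrime q →+* Y.presheaf.stalk z) =
        IsLocalRing.maximalIdeal (Y.presheaf.stalk z) :=
    (Ideal.map_comap_of_equiv ee).trans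
      (IsLocalRing.maximalIdeal_comap (ee.symm : Y.presheaf.stalk z →+* Localization.AtPrime q))
  rw [← this]
  infer_instance

variable [IsIntegral Y]

lemma isPrincipalIdealRing_stalk [IsLocallyNoetherian Y] [SmoothOfRelativeDimension 1 π] (z : Y) :
    IsPrincipalIdealRing (Y.presheaf.stalk z) :=
  ((tfae_of_isNoetherianRing_of_isLocalRing_of_isDomain (Y.presheaf.stalk z)).out 4 0).mp
    (isPrincipal_maximalIdeal_stalk π z)

/-- If all local rings of an integral scheme are principal ideal domains, then all its points but
the generic one are closed. -/
lemma eq_of_specializes_of_ne_genericPoint [∀ z : Y, IsPrincipalIdealRing (Y.presheaf.stalk z)]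
    {z z' : Y} (h : z ⤳ z') (hz : z ≠ genericPoint Y) : z = z' := by
  have h1 : z ∈ Set.range (Y.fromSpecStalk z') := by
    rw [Scheme.range_fromSpecStalk]; exact h
  obtain ⟨q, rfl⟩ := h1
  -- The zero ideal of the stalk corresponds to the generic point; every other prime of a principal
  -- ideal domain is maximal.
  have hq : q.asIdeal ≠ ⊥ := by
    intro hq
    obtain ⟨q₀, hq₀⟩ : genericPoint Y ∈ Set.range (Y.fromSpecStalk z') := by
      rw [Scheme.range_fromSpecStalk]; exact genericPoint_specializes z'
    have h2 : q ⤳ q₀ := (PrimeSpectrum.le_iff_specializes q q₀).mp 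
      (show q.asIdeal ≤ q₀.asIdeal from hq ▸ bot_le)
    have h3 := h2.map (Y.fromSpecStalk z').continuous
    rw [hq₀] at h3
    exact hz (h3.antisymm (genericPoint_specializes _)).eq
  have : q = IsLocalRing.closedPoint (Y.presheaf.stalk z') := by
    apply PrimeSpectrum.ext
    exact IsLocalRing.eq_maximalIdeal (q.isPrime.isMaximal hq)
  rw [this, Scheme.fromSpecStalk_closedPoint]

lemma isClosed_singleton_of_ne_genericPoint
    [∀ z : Y, IsPrincipalIdealRing (Y.presheaf.stalk z)]
    {z : Y} (hz : z ≠ genericPoint Y) : IsClosed {z} := by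
  rw [← closure_eq_iff_isClosed]
  ext z'
  rw [← specializes_iff_mem_closure]
  exact ⟨fun h ↦ (eq_of_specializes_of_ne_genericPoint h hz).symm, fun h ↦ h ▸ specializes_rfl⟩

/-- Each irreducible component of `Z` is the closure of its generic point, which is not that of `Y`
and is therefore closed; so the components are single points. -/
lemma finite_of_isClosed_of_genericPoint_notMem
    [∀ z : Y, IsPrincipalIdealRing (Y.presheaf.stalk z)] [TopologicalSpace.NoetherianSpace Y]
    {Z : Set Y} (hZ : IsClosed Z) (hη : genericPoint Y ∉ Z) : Z.Finite := by
  obtain ⟨S, hS, hSfin, hirr, rfl⟩ :=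
    TopologicalSpace.NoetherianSpace.exists_finite_set_isClosed_irreducible hZ
  refine hS.sUnion fun t ht ↦ ?_
  have h1 := (hirr t ht).isGenericPoint_genericPoint_closure
  rw [(hSfin t ht).closure_eq] at h1
  have h2 : (hirr t ht).genericPoint ≠ genericPoint Y := fun h ↦
    hη ⟨t, ht, h ▸ h1.mem⟩
  rw [← h1.def, (isClosed_singleton_of_ne_genericPoint h2).closure_eq]
  exact Set.finite_singleton _

end StalksOfCurves
end LocalGlobal

namespace LocalGlobal
-- Rational functions and their domains of regularity.
section RegularFunctions

variable {Y : Scheme.{u}} [IsIntegral Y]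

/-- The local ring at `z` of an integral scheme, as a subring of the function field. -/
noncomputable def localSubring (z : Y) : Subring Y.functionField :=
  (algebraMap (Y.presheaf.stalk z) Y.functionField).range

lemma genericPoint_mem (U : Y.Opens) {z : Y} (hz : z ∈ U) : genericPoint Y ∈ U :=
  (genericPoint_specializes z).mem_open U.2 hz

lemma algebraMap_germ {U : Y.Opens} {z : Y} (hz : z ∈ U) (a : Γ(Y, U)) :
    algebraMap (Y.presheaf.stalk z) Y.functionField (Y.presheaf.germ U z hz a) =
      Y.presheaf.germ U (genericPoint Y) (genericPoint_mem U hz) a := by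
  have : Nonempty U := ⟨⟨z, hz⟩⟩
  exact Scheme.algebraMap_germ_eq_germToFunctionField Y hz a

lemma germ_genericPoint_mem_localSubring {U : Y.Opens} {z : Y} (hz : z ∈ U) (a : Γ(Y, U)) :
    Y.presheaf.germ U (genericPoint Y) (genericPoint_mem U hz) a ∈ localSubring z :=
  ⟨_, algebraMap_germ hz a⟩

lemma exists_section_of_mem_localSubring {f : Y.functionField} {z : Y} (hf : f ∈ localSubring z) :
    ∃ (U : Y.Opens) (hz : z ∈ U) (a : Γ(Y, U)),
      Y.presheaf.germ U (genericPoint Y) (genericPoint_mem U hz) a = f := by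
  obtain ⟨s, rfl⟩ := hf
  obtain ⟨U, hz, a, rfl⟩ := Y.presheaf.exists_germ_eq s
  exact ⟨U, hz, a, (algebraMap_germ hz a).symm⟩

/-- The largest open subscheme on which the rational function `f` is regular. -/
def dom (f : Y.functionField) : Y.Opens where
  carrier := {z | f ∈ localSubring z}
  is_open' := by
    rw [isOpen_iff_forall_mem_open]
    intro z hz
    obtain ⟨U, hzU, a, ha⟩ := exists_section_of_mem_localSubring hz
    exact ⟨U, fun z' hz' ↦ ha ▸ germ_genericPoint_mem_localSubring hz' a, U.2, hzU⟩

@[simp]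
lemma mem_dom {f : Y.functionField} {z : Y} : z ∈ dom f ↔ f ∈ localSubring z := Iff.rfl

lemma genericPoint_mem_dom (f : Y.functionField) : genericPoint Y ∈ dom f := by
  obtain ⟨U, hU, a, ha⟩ := Y.presheaf.exists_germ_eq f
  exact ha ▸ germ_genericPoint_mem_localSubring hU a

lemma germ_genericPoint_injective {U : Y.Opens} (h : genericPoint Y ∈ U) :
    Function.Injective (Y.presheaf.germ U (genericPoint Y) h) :=
  germ_injective_of_isIntegral _ _ _

/-- Local representatives agree on overlaps because sections of an integral scheme are determined by
their germ at the generic point. -/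
lemma exists_section_of_le_dom {f : Y.functionField} {U : Y.Opens} (h : genericPoint Y ∈ U)
    (hU : U ≤ dom f) : ∃ a : Γ(Y, U), Y.presheaf.germ U (genericPoint Y) h a = f := by
  choose V hV a ha using fun z : U ↦ exists_section_of_mem_localSubring (hU z.2)
  let W (z : U) : Y.Opens := V z ⊓ U
  have hW (z : U) : genericPoint Y ∈ W z := genericPoint_mem (W z) ⟨hV z, z.2⟩
  let b (z : U) : Γ(Y, W z) := Y.presheaf.map (homOfLE inf_le_left).op (a z)
  have hb (z : U) : Y.presheaf.germ (W z) (genericPoint Y) (hW z) (b z) = f := by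
    rw [← ha z]
    exact Y.presheaf.germ_res_apply (homOfLE inf_le_left) _ (hW z) (a z)
  obtain ⟨s, hs, -⟩ := Y.sheaf.existsUnique_gluing' W U (fun z ↦ homOfLE inf_le_right)
    (fun z hz ↦ TopologicalSpace.Opens.mem_iSup.mpr ⟨⟨z, hz⟩, hV _, hz⟩) b (by
      intro z z'
      apply germ_genericPoint_injective (U := W z ⊓ W z') ⟨hW z, hW z'⟩
      refine (Y.presheaf.germ_res_apply _ _ _ _).trans
        (.trans ?_ (Y.presheaf.germ_res_apply _ _ _ _).symm)
      rw [hb, hb])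
  refine ⟨s, ?_⟩
  rw [← hb ⟨_, h⟩, ← hs ⟨_, h⟩]
  exact (Y.presheaf.germ_res_apply _ _ _ _).symm

end RegularFunctions
end LocalGlobal

namespace LocalGlobal
-- The morphism to the affine line given by a rational function is proper.
section AffineLine

open Polynomial

variable {k : Type u} [Field k] {Y : Scheme.{u}} (π : Y ⟶ Spec (.of k))

lemma le_preimage_top {X Y : Scheme.{u}} (f : X ⟶ Y) (U : X.Opens) : U ≤ f ⁻¹ᵁ ⊤ :=
  fun _ _ ↦ trivial

lemma appLE_of_eq_comp_ι {X Y : Scheme.{u}} {U : Y.Opens} {g : X ⟶ Y} {i : X ⟶ (U : Scheme.{u})}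
    (hg : g = i ≫ U.ι) (h : ⊤ ≤ g ⁻¹ᵁ U) (a : Γ(Y, U)) :
    g.appLE U ⊤ h a = i.appTop (U.topIso.inv a) := by
  subst hg
  have h1 : U.ι.appLE U ⊤ (Scheme.Opens.ι_preimage_self U).ge = U.topIso.inv := by
    rw [Scheme.Opens.ι_appLE]; rfl
  have h2 : i.appTop = i.appLE ⊤ ⊤ (le_preimage_top i ⊤) := i.app_eq_appLE
  rw [← CommRingCat.comp_apply, ← h1, h2, Scheme.Hom.appLE_comp_appLE]

lemma appLE_mul_appLE_eq_one {X Y : Scheme.{u}} (g : X ⟶ Y) {U V : Y.Opens} {W : X.Opens}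
    (hU : W ≤ g ⁻¹ᵁ U) (hV : W ≤ g ⁻¹ᵁ V) {a : Γ(Y, U)} {b : Γ(Y, V)}
    (h : Y.presheaf.map (homOfLE (inf_le_left : U ⊓ V ≤ U)).op a *
        Y.presheaf.map (homOfLE (inf_le_right : U ⊓ V ≤ V)).op b = 1) :
    g.appLE U W hU a * g.appLE V W hV b = 1 := by
  have hUV : W ≤ g ⁻¹ᵁ (U ⊓ V) := fun x hx ↦ ⟨hU hx, hV hx⟩
  have h' := congrArg (g.appLE (U ⊓ V) W hUV) h
  rwa [map_mul, map_one, ← CommRingCat.comp_apply, ← CommRingCat.comp_apply,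
    Scheme.Hom.map_appLE, Scheme.Hom.map_appLE] at h'

/-- The structure map from `k` to the sections over `U` of the `k`-scheme `Y`. -/
noncomputable def constSection (U : Y.Opens) : k →+* Γ(Y, U) :=
  ((Scheme.ΓSpecIso (.of k)).inv ≫ π.appLE ⊤ U (le_preimage_top π U)).hom

/-- The morphism to the affine line given by a section. -/
noncomputable def toAffineLine {U : Y.Opens} (a : Γ(Y, U)) : (U : Scheme.{u}) ⟶ Spec (.of k[X]) :=
  U.toSpecΓ ≫ Spec.map (CommRingCat.ofHom (eval₂RingHom (constSection π U) a))

lemma toAffineLine_comp {U : Y.Opens} (a : Γ(Y, U)) :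
    toAffineLine π a ≫ Spec.map (CommRingCat.ofHom C) = U.ι ≫ π := by
  have h : CommRingCat.ofHom (C : k →+* k[X]) ≫
      CommRingCat.ofHom (eval₂RingHom (constSection π U) a) =
        (Scheme.ΓSpecIso (.of k)).inv ≫ π.appLE ⊤ U (le_preimage_top π U) := by
    ext c
    simp [constSection]
  rw [toAffineLine, Category.assoc, ← Spec.map_comp, h, Spec.map_comp,
    Scheme.Opens.toSpecΓ_SpecMap_appLE_assoc]
  simp

lemma toAffineLine_appTop {U : Y.Opens} (a : Γ(Y, U)) (g : k[X]) :
    (toAffineLine π a).appTop ((Scheme.ΓSpecIso (.of k[X])).inv g) =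
      U.topIso.inv (g.eval₂ (constSection π U) a) := by
  have h := Scheme.ΓSpecIso_inv_naturality
    (CommRingCat.ofHom (eval₂RingHom (constSection π U) a))
  rw [← CommRingCat.comp_apply, toAffineLine, Scheme.Hom.comp_appTop, ← Category.assoc, ← h,
    Scheme.Opens.toSpecΓ_appTop]
  have e : (Scheme.ΓSpecIso (.of Γ(Y, U))).inv ≫ (Scheme.ΓSpecIso Γ(Y, U)).hom = 𝟙 _ :=
    Iso.inv_hom_id _
  simp only [Category.assoc, reassoc_of% e]
  rfl

variable [IsIntegral Y] [IsProper π] [IsNoetherian Y]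

/-- Valuative criterion: properness of `Y` extends the map to `Spec R → Y`, and the extension avoids
the poles of `f` because `f` pulls back into `R`. -/
lemma isProper_toAffineLine (f : Y.functionField) (a : Γ(Y, dom f))
    (ha : Y.presheaf.germ (dom f) (genericPoint Y) (genericPoint_mem_dom f) a = f)
    (hf : ∀ z : Y, f ∉ localSubring z → f⁻¹ ∈ localSubring z) :
    IsProper (toAffineLine π a) := by
  have : IsSeparated (toAffineLine π a ≫ Spec.map (CommRingCat.ofHom C)) := by
    rw [toAffineLine_comp]; infer_instance
  have : LocallyOfFiniteType (toAffineLine π a ≫ Spec.map (CommRingCat.ofHom C)) := by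
    rw [toAffineLine_comp]; infer_instance
  have : IsSeparated (toAffineLine π a) := .of_comp _ (Spec.map (CommRingCat.ofHom C))
  have : LocallyOfFiniteType (toAffineLine π a) :=
    locallyOfFiniteType_of_comp _ (Spec.map (CommRingCat.ofHom C))
  have : TopologicalSpace.NoetherianSpace (dom f : Scheme.{u}) :=
    inferInstanceAs (TopologicalSpace.NoetherianSpace (dom f : Set Y))
  have : QuasiCompact (toAffineLine π a) := quasiCompact_of_noetherianSpace_source _
  suffices UniversallyClosed (toAffineLine π a) from {}
  refine .of_valuativeCriterion _ ?_
  rintro ⟨R, L, i₁, i₂, ⟨w⟩⟩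
  have hπ : ValuativeCriterion.Existence π := by
    have : UniversallyClosed π := inferInstance
    rw [UniversallyClosed.eq_valuativeCriterion] at this
    exact this.1
  obtain ⟨⟨l, hl₁, hl₂⟩⟩ := (hπ ⟨R, L, i₁ ≫ (dom f).ι, i₂ ≫ Spec.map (CommRingCat.ofHom C),
    ⟨by rw [Category.assoc, ← toAffineLine_comp π a, reassoc_of% w]⟩⟩).exists_lift
  dsimp only at hl₁ hl₂
  -- Every point of `Spec R` specializes to the closed point, so only the image of the latter
  -- matters.
  have range_le (W : Y.Opens) (hW : l (IsLocalRing.closedPoint R) ∈ W) : l ⁻¹ᵁ W = ⊤ := by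
    ext x
    have h := ((IsLocalRing.specializes_closedPoint (R := R) x).map l.continuous).mem_open W.2 hW
    simpa using h
  -- At a pole, `f⁻¹` is represented by a section `σ`. Its pullback to `R` times the coordinate
  -- function pulled back along `i₂` equals `1` over `L`, hence in `R`. So `σ` is invertible at the
  -- image of the closed point, and `f` is regular there.
  have hmem : l (IsLocalRing.closedPoint R) ∈ dom f := by
    by_contra hz
    obtain ⟨W, hzW, σ, hσ⟩ := exists_section_of_mem_localSubring (hf _ hz)
    have hf0 : f ≠ 0 := fun h ↦ hz (h ▸ zero_mem (localSubring _))
    have hη : genericPoint Y ∈ W ⊓ dom f := ⟨genericPoint_mem W hzW, genericPoint_mem_dom f⟩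
    have h1 : Y.presheaf.map (homOfLE (inf_le_left : W ⊓ dom f ≤ W)).op σ *
        Y.presheaf.map (homOfLE (inf_le_right : W ⊓ dom f ≤ dom f)).op a = 1 := by
      apply germ_genericPoint_injective hη
      rw [map_mul, map_one, Y.presheaf.germ_res_apply, Y.presheaf.germ_res_apply, hσ, ha,
        inv_mul_cancel₀ hf0]
    let q := Spec.map (CommRingCat.ofHom (algebraMap R L))
    let ξ := (Scheme.ΓSpecIso (.of k[X])).inv X
    let σR := l.appLE W ⊤ (range_le W hzW).ge σ
    have hW : ⊤ ≤ (q ≫ l) ⁻¹ᵁ W := by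
      rw [Scheme.Hom.comp_preimage, range_le W hzW]; exact le_preimage_top _ _
    have hd : ⊤ ≤ (q ≫ l) ⁻¹ᵁ (dom f) := by
      rw [hl₁]; exact fun x _ ↦ (i₁ x).2
    have h2 : q.appTop σR = (q ≫ l).appLE W ⊤ hW σ := by
      rw [← CommRingCat.comp_apply]
      congr 2
    have h3 : q.appTop (i₂.appTop ξ) = (q ≫ l).appLE (dom f) ⊤ hd a := by
      have e1 : q.appTop (i₂.appTop ξ) = (q ≫ i₂).appTop ξ := by
        rw [Scheme.Hom.comp_appTop]; rfl
      have e2 : (i₁ ≫ toAffineLine π a).appTop ξ = i₁.appTop ((dom f).topIso.inv a) := by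
        rw [Scheme.Hom.comp_appTop, CommRingCat.comp_apply, toAffineLine_appTop, eval₂_X]
      rw [e1, ← w, e2]
      exact (appLE_of_eq_comp_ι hl₁ hd a).symm
    have h4 : q.appTop (σR * i₂.appTop ξ) = 1 := by
      rw [map_mul, h2, h3, appLE_mul_appLE_eq_one _ hW hd h1]
    have h5 : σR * i₂.appTop ξ = 1 := by
      have e := Scheme.ΓSpecIso_naturality (CommRingCat.ofHom (algebraMap R L))
      apply (Scheme.ΓSpecIso (.of R)).commRingCatIsoToRingEquiv.injective
      apply IsFractionRing.injective R L
      have e' := congr($e (σR * i₂.appTop ξ))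
      rw [CommRingCat.comp_apply] at e'
      refine e'.symm.trans ?_
      change (Scheme.ΓSpecIso (.of L)).hom (q.appTop (σR * i₂.appTop ξ)) = _
      rw [h4]
      simp
    have h6 := Scheme.basicOpen_of_isUnit _ (IsUnit.of_mul_eq_one _ h5)
    rw [Scheme.basicOpen_appLE] at h6
    have h7 : l (IsLocalRing.closedPoint R) ∈ Y.basicOpen σ :=
      (h6.ge (TopologicalSpace.Opens.mem_top (IsLocalRing.closedPoint R))).2
    rw [Scheme.mem_basicOpen _ _ _ hzW] at h7
    apply hz
    refine ⟨↑h7.unit⁻¹, ?_⟩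
    have h8 := congrArg (algebraMap (Y.presheaf.stalk _) Y.functionField) h7.mul_val_inv
    rw [map_mul, map_one, algebraMap_germ, hσ] at h8
    exact (eq_inv_of_mul_eq_one_right h8).trans (inv_inv f)
  let l' : Spec (.of R) ⟶ (dom f : Scheme.{u}) := IsOpenImmersion.lift (dom f).ι l (by
    rw [Scheme.Opens.range_ι]
    rintro _ ⟨x, rfl⟩
    have : x ∈ l ⁻¹ᵁ (dom f) := by rw [range_le _ hmem]; trivial
    exact this)
  have hl' : l' ≫ (dom f).ι = l := IsOpenImmersion.lift_fac _ _ _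
  have hl'₁ : Spec.map (CommRingCat.ofHom (algebraMap R L)) ≫ l' = i₁ := by
    rw [← cancel_mono (dom f).ι, Category.assoc, hl', hl₁]
  refine ⟨⟨l', hl'₁, ?_⟩⟩
  obtain ⟨u, hu⟩ := Spec.map_surjective (l' ≫ toAffineLine π a)
  obtain ⟨v, rfl⟩ := Spec.map_surjective i₂
  rw [← hl'₁, Category.assoc, ← hu, ← Spec.map_comp, ← Spec.map_comp] at w
  have w' := Spec.map_injective w
  dsimp only
  rw [← hu]
  exact congrArg Spec.map (CommRingCat.hom_ext (RingHom.ext fun g ↦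
    IsFractionRing.injective R L congr($w' g)))

end AffineLine
end LocalGlobal

namespace LocalGlobal
-- Domains of transcendental functions are finite over the affine line.
section FiniteOverAffineLine

open Polynomial

variable {k : Type u} [Field k] {Y : Scheme.{u}} (π : Y ⟶ Spec (.of k))

lemma map_constSection {U V : Y.Opens} (i : U ≤ V) (c : k) :
    Y.presheaf.map (homOfLE i).op (constSection π V c) = constSection π U c := by
  rw [constSection, constSection, ← Scheme.Hom.appLE_map π (le_preimage_top π V) (homOfLE i).op]
  rfl

variable [IsIntegral Y]

/-- The structure map from `k` to the function field of the `k`-scheme `Y`. -/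
noncomputable def constFunctionField : k →+* Y.functionField :=
  (Y.presheaf.germ ⊤ (genericPoint Y) trivial).hom.comp (constSection π ⊤)

lemma germ_constSection {U : Y.Opens} (h : genericPoint Y ∈ U) (c : k) :
    Y.presheaf.germ U (genericPoint Y) h (constSection π U c) = constFunctionField π c := by
  rw [← map_constSection π (le_top : U ≤ ⊤), Y.presheaf.germ_res_apply]
  rfl

lemma constFunctionField_mem (z : Y) (c : k) : constFunctionField π c ∈ localSubring z :=
  germ_genericPoint_mem_localSubring (U := ⊤) trivial _

lemma mem_or_inv_mem_localSubring {z : Y} [IsPrincipalIdealRing (Y.presheaf.stalk z)]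
    (f : Y.functionField) : f ∈ localSubring z ∨ f⁻¹ ∈ localSubring z := by
  have : ValuationRing (Y.presheaf.stalk z) := inferInstance
  exact ValuationRing.isInteger_or_isInteger (Y.presheaf.stalk z) f

lemma germ_eval₂ {U : Y.Opens} (h : genericPoint Y ∈ U) (a : Γ(Y, U)) (g : k[X]) :
    Y.presheaf.germ U (genericPoint Y) h (g.eval₂ (constSection π U) a) =
      g.eval₂ (constFunctionField π) (Y.presheaf.germ U (genericPoint Y) h a) := by
  refine (hom_eval₂ g _ (Y.presheaf.germ U (genericPoint Y) h).hom a).trans ?_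
  congr 1
  ext c
  exact germ_constSection π h c

/-- A function algebraic over `k` is integral over the local ring, hence lies in it since a
principal ideal domain is integrally closed. -/
lemma eval₂_ne_zero_of_notMem_localSubring {z : Y} [IsPrincipalIdealRing (Y.presheaf.stalk z)]
    {f : Y.functionField} (hf : f ∉ localSubring z) {g : k[X]} (hg : g ≠ 0) :
    g.eval₂ (constFunctionField π) f ≠ 0 := by
  intro h
  apply hf
  let ι : k →+* Y.presheaf.stalk z :=
    (Y.presheaf.germ ⊤ z trivial).hom.comp (constSection π ⊤)
  have hι : (algebraMap (Y.presheaf.stalk z) Y.functionField).comp ι = constFunctionField π := by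
    ext c
    exact algebraMap_germ (U := ⊤) trivial _
  have : IsIntegral (Y.presheaf.stalk z) f := by
    refine ⟨(g * C g.leadingCoeff⁻¹).map ι, (monic_mul_leadingCoeff_inv hg).map _, ?_⟩
    rw [eval₂_map, hι, eval₂_mul, h, zero_mul]
  exact IsIntegrallyClosed.isIntegral_iff.mp this

/-- Passing to the reversed polynomial exchanges `f` and `f⁻¹`. -/
lemma eval₂_ne_zero_of_inv_notMem_localSubring {z : Y}
    [IsPrincipalIdealRing (Y.presheaf.stalk z)] {f : Y.functionField} (hf : f⁻¹ ∉ localSubring z)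
    {g : k[X]} (hg : g ≠ 0) : g.eval₂ (constFunctionField π) f ≠ 0 := by
  have hf0 : f ≠ 0 := by
    rintro rfl
    exact hf (by rw [inv_zero]; exact zero_mem _)
  let : Invertible f := invertibleOfNonzero hf0
  have h := eval₂_reverse_mul_pow (constFunctionField π) f g
  rw [← h, invOf_eq_inv]
  exact mul_ne_zero (eval₂_ne_zero_of_notMem_localSubring π hf (by simpa using hg))
    (pow_ne_zero _ hf0)

lemma inv_notMem_localSubring {U : Y.Opens} {z : Y} (hz : z ∈ U) {a : Γ(Y, U)}
    (ha : Y.presheaf.germ U (genericPoint Y) (genericPoint_mem U hz) a ≠ 0)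
    (h : z ∉ Y.basicOpen a) :
    (Y.presheaf.germ U (genericPoint Y) (genericPoint_mem U hz) a)⁻¹ ∉ localSubring z := by
  rintro ⟨b, hb⟩
  rw [Scheme.mem_basicOpen _ _ _ hz] at h
  apply h
  refine IsUnit.of_mul_eq_one b
    (IsFractionRing.injective (Y.presheaf.stalk z) Y.functionField ?_)
  rw [map_mul, map_one, hb, algebraMap_germ hz, mul_inv_cancel₀ ha]

variable [IsProper π] [IsNoetherian Y] [∀ z : Y, IsPrincipalIdealRing (Y.presheaf.stalk z)]

/-- Proper and quasi-finite implies finite, so only the finiteness of the fibres remains. -/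
lemma isFinite_toAffineLine (f : Y.functionField) (a : Γ(Y, dom f))
    (ha : Y.presheaf.germ (dom f) (genericPoint Y) (genericPoint_mem_dom f) a = f)
    (hf : ∀ g : k[X], g ≠ 0 → g.eval₂ (constFunctionField π) f ≠ 0) :
    IsFinite (toAffineLine π a) := by
  have : IsProper (toAffineLine π a) := isProper_toAffineLine π f a ha
    fun z hz ↦ (mem_or_inv_mem_localSubring f).resolve_left hz
  suffices LocallyQuasiFinite (toAffineLine π a) from .of_isProper_of_locallyQuasiFinite _
  refine .of_finite_preimage_singleton _ fun w ↦ ?_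
  refine Set.Finite.of_finite_image (f := (dom f).ι) ?_ (dom f).ι.injective.injOn
  -- Over the generic point of the line: any other point of the fibre would be closed, and its image
  -- under a morphism locally of finite type to a Jacobson scheme would be closed too.
  by_cases hw : w.asIdeal = ⊥
  · refine (Set.finite_singleton (genericPoint Y)).subset ?_
    rintro _ ⟨z, hz, rfl⟩
    by_contra hne
    have h1 : IsClosed {(dom f).ι z} := isClosed_singleton_of_ne_genericPoint hne
    have h2 : IsClosed {z} := by
      have := h1.preimage (dom f).ι.continuous
      rwa [← Set.image_singleton, Set.preimage_image_eq _ (dom f).ι.injective] at this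
    have : JacobsonSpace (Spec (.of k[X])) := inferInstance
    have h3 := (toAffineLine π a).closePoints_subset_preimage_closedPoints h2
    rw [Set.mem_preimage, hz] at h3
    have h4 : w.asIdeal.IsMaximal := (PrimeSpectrum.isClosed_singleton_iff_isMaximal w).mp h3
    rw [hw] at h4
    exact Polynomial.not_isField k (Ring.isField_iff_maximal_bot.mpr h4)
  -- Over any other point, a nonzero `g` in the prime makes the nonzero function `g(f)` vanish along
  -- the fibre, so the fibre lies among the finitely many poles of `g(f)⁻¹`.
  · obtain ⟨g, hg, hg0⟩ := Submodule.exists_mem_ne_zero_of_ne_bot hw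
    set h := g.eval₂ (constFunctionField π) f with hh
    have hh0 : h ≠ 0 := hf g hg0
    have hfin : ((dom h⁻¹ : Set Y)ᶜ).Finite := finite_of_isClosed_of_genericPoint_notMem
      (dom h⁻¹).2.isClosed_compl (by simpa using genericPoint_mem_dom h⁻¹)
    refine hfin.subset ?_
    rintro _ ⟨z, hz, rfl⟩
    have h1 := germ_eval₂ π (genericPoint_mem_dom f) a g
    rw [ha, ← hh] at h1
    have := inv_notMem_localSubring z.2 (a := g.eval₂ (constSection π (dom f)) a)
      (by rw [h1]; exact hh0) ?_
    · rwa [h1] at this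
    · intro h2
      have h3 : z ∈ (dom f).toSpecΓ ⁻¹ᵁ PrimeSpectrum.basicOpen
          (g.eval₂ (constSection π (dom f)) a) := by
        rw [Scheme.Opens.toSpecΓ_preimage_basicOpen]
        exact h2
      refine h3 ?_
      rw [← show toAffineLine π a z = w from hz] at hg
      exact hg

lemma isAffineOpen_dom (π : Y ⟶ Spec (.of k)) [IsProper π] {f : Y.functionField}
    (hf : ∀ g : k[X], g ≠ 0 → g.eval₂ (constFunctionField π) f ≠ 0) :
    IsAffineOpen (dom f) := by
  obtain ⟨a, ha⟩ := exists_section_of_le_dom (genericPoint_mem_dom f) le_rfl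
  have := isFinite_toAffineLine π f a ha hf
  exact isAffine_of_isAffineHom (toAffineLine π a)

lemma finite_eval₂RingHom {f : Y.functionField}
    (hf : ∀ g : k[X], g ≠ 0 → g.eval₂ (constFunctionField π) f ≠ 0)
    {a : Γ(Y, dom f)}
    (ha : Y.presheaf.germ (dom f) (genericPoint Y) (genericPoint_mem_dom f) a = f) :
    (eval₂RingHom (constSection π (dom f)) a).Finite := by
  have h := isFinite_toAffineLine π f a ha hf
  have hU := isAffineOpen_dom π hf
  have e : Spec.map (CommRingCat.ofHom (eval₂RingHom (constSection π (dom f)) a)) =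
      hU.isoSpec.inv ≫ toAffineLine π a := by
    rw [toAffineLine, ← hU.isoSpec_hom, Iso.inv_hom_id_assoc]
  refine (IsFinite.SpecMap_iff (CommRingCat.ofHom (eval₂RingHom (constSection π (dom f)) a))).mp ?_
  rw [e]
  infer_instance

end FiniteOverAffineLine
end LocalGlobal

namespace LocalGlobal
-- Existence of a function with a single pole, in terms of valuation rings.
section SinglePole

open Polynomial

variable {k K ι : Type*} [Field k] [Field K] [Algebra k K]

/-- `c` is a root of the monic polynomial over `O` obtained by normalizing `P - P(c)`, and valuation
rings are integrally closed. -/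
lemma mem_of_aeval_mem (O : ValuationSubring K) (hk : ∀ c : k, algebraMap k K c ∈ O) {c : K}
    {P : k[X]} (hP : 0 < P.natDegree) (h : aeval c P ∈ O) : c ∈ O := by
  let j : k →+* O := (algebraMap k K).codRestrict O.toSubring hk
  have hj : (algebraMap O K).comp j = algebraMap k K := rfl
  have hP0 : P ≠ 0 := by rintro rfl; simp at hP
  let Q : O[X] := (P * C P.leadingCoeff⁻¹).map j - C (j P.leadingCoeff⁻¹ * ⟨_, h⟩)
  have hmon : ((P * C P.leadingCoeff⁻¹).map j).Monic := (monic_mul_leadingCoeff_inv hP0).map _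
  have hdeg : ((P * C P.leadingCoeff⁻¹).map j).natDegree = P.natDegree := by
    rw [natDegree_map, natDegree_mul_C (by simpa using hP0)]
  have : _root_.IsIntegral O c := by
    refine ⟨Q, hmon.sub_of_left ?_, ?_⟩
    · refine degree_C_le.trans_lt ?_
      rw [← natDegree_pos_iff_degree_pos, hdeg]
      exact hP
    · rw [eval₂_sub, eval₂_map, hj, eval₂_mul, eval₂_C, eval₂_C, map_mul, sub_eq_zero, mul_comm]
      rfl
  obtain ⟨b, hb⟩ := IsIntegrallyClosed.isIntegral_iff.mp this
  exact hb ▸ b.2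

lemma aeval_mem (O : ValuationSubring K) (hk : ∀ c : k, algebraMap k K c ∈ O) {c : K}
    (hc : c ∈ O) (P : k[X]) : aeval c P ∈ O := by
  rw [aeval_eq_sum_range]
  exact sum_mem fun i _ ↦ by rw [Algebra.smul_def]; exact mul_mem (hk _) (pow_mem hc _)

/-- The rational functions which are regular at all places where `f` is. -/
def regularWhere (O : ι → ValuationSubring K) (hk : ∀ z (c : k), algebraMap k K c ∈ O z) (f : K) :
    Submodule k K where
  carrier := {a | ∀ z, f ∈ O z → a ∈ O z}
  add_mem' ha hb z hz := add_mem (ha z hz) (hb z hz)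
  zero_mem' z _ := zero_mem (O z)
  smul_mem' c a ha z hz := by rw [Algebra.smul_def]; exact mul_mem (hk z c) (ha z hz)

variable (O : ι → ValuationSubring K) (hk : ∀ z (c : k), algebraMap k K c ∈ O z)

/-- `s⁻¹ ∉ O z` says that `s` vanishes at `z`, and `harch` that the valuations are archimedean:
powers of `s` absorb any pole, uniformly on a finite set. -/
lemma exists_pow_mul_mem_of_finite (harch : ∀ z s, s⁻¹ ∉ O z → ∀ a, ∃ N : ℕ, s ^ N * a ∈ O z)
    {Z : Set ι} (hZ : Z.Finite) {s : K} (hs : ∀ z ∈ Z, s⁻¹ ∉ O z) (a : K) :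
    ∃ N : ℕ, ∀ n ≥ N, ∀ z ∈ Z, s ^ n * a ∈ O z := by
  choose! N hN using fun z (hz : z ∈ Z) ↦ harch z s (hs z hz) a
  refine ⟨hZ.toFinset.sup N, fun n hn z hz ↦ ?_⟩
  have h1 : N z ≤ n := (Finset.le_sup (hZ.mem_toFinset.mpr hz)).trans hn
  have h2 : s ∈ O z := ((O z).mem_or_inv_mem s).resolve_right (hs z hz)
  rw [← Nat.sub_add_cancel h1, pow_add, mul_assoc]
  exact mul_mem (pow_mem h2 _) (hN z hz)

/-- A finiteness property of the first cohomology of the structure sheaf of a curve, computed with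
the two open subsets where `x` and where `x⁻¹` is regular. -/
lemma exists_finite_sup (harch : ∀ z s, s⁻¹ ∉ O z → ∀ a, ∃ N : ℕ, s ^ N * a ∈ O z)
    (hpoles : ∀ f : K, {z | f ∉ O z}.Finite) {x : K} (hx : x ≠ 0) (T : Finset K)
    (hT : ∀ t ∈ T, t ∈ regularWhere O hk x)
    (hspan : regularWhere O hk x ≤ Submodule.span k {b | ∃ (n : ℕ), ∃ t ∈ T, b = x ^ n * t}) :
    ∃ F : Submodule k K, Module.Finite k F ∧ ∀ h : K, (∀ z, x ∈ O z → x⁻¹ ∈ O z → h ∈ O z) →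
      h ∈ regularWhere O hk x ⊔ regularWhere O hk x⁻¹ ⊔ F := by
  have h1 : ∀ t : K, t ∈ T → ∃ N : ℕ, ∀ n ≥ N, x⁻¹ ^ n * t ∈ regularWhere O hk x⁻¹ := by
    intro t ht
    obtain ⟨N, hN⟩ := exists_pow_mul_mem_of_finite O harch (hpoles x) (s := x⁻¹)
      (fun z hz ↦ by rwa [inv_inv]) t
    refine ⟨N, fun n hn z hz ↦ ?_⟩
    by_cases hxz : x ∈ O z
    · exact mul_mem (pow_mem hz _) (hT t ht z hxz)
    · exact hN n hn z hxz
  choose! N hN using h1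
  let M := T.sup N
  have hM : ∀ t ∈ T, ∀ n ≥ M, x⁻¹ ^ n * t ∈ regularWhere O hk x⁻¹ :=
    fun t ht n hn ↦ hN t ht n ((Finset.le_sup ht).trans hn)
  classical
  let S : Finset K := (Finset.range M ×ˢ T).image fun i ↦ x⁻¹ ^ i.1 * i.2
  refine ⟨Submodule.span k S, inferInstance, fun h hh ↦ ?_⟩
  -- Multiplication by `x ^ N'` removes the poles of `h` at the zeros of `x`, so that `h` becomes a
  -- combination of terms `x ^ (n - N') * t` with `n - N'` possibly negative.
  obtain ⟨N', hN'⟩ := exists_pow_mul_mem_of_finite O harch (hpoles x⁻¹) (s := x) (fun z hz ↦ hz) h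
  have h2 : x ^ N' * h ∈ regularWhere O hk x := by
    intro z hz
    by_cases hxz : x⁻¹ ∈ O z
    · exact mul_mem (pow_mem hz _) (hh z hz hxz)
    · exact hN' N' le_rfl z hxz
  have h3 : h = LinearMap.mulLeft k (x⁻¹ ^ N') (x ^ N' * h) := by
    rw [LinearMap.mulLeft_apply, ← mul_assoc, ← mul_pow, inv_mul_cancel₀ hx, one_pow, one_mul]
  rw [h3]
  refine Submodule.span_le.mpr ?_ (Submodule.apply_mem_span_image_of_mem_span
    (LinearMap.mulLeft k (x⁻¹ ^ N')) (hspan h2))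
  rintro _ ⟨_, ⟨n, t, ht, rfl⟩, rfl⟩
  rw [LinearMap.mulLeft_apply, ← mul_assoc]
  -- Nonnegative exponents give functions regular where `x` is, exponents at most `-M` functions
  -- regular where `x⁻¹` is, and the finitely many products in between span `F`.
  rcases le_total N' n with hn | hn
  · refine Submodule.mem_sup_left (Submodule.mem_sup_left fun z hz ↦ ?_)
    rw [← Nat.sub_add_cancel hn, pow_add, mul_comm (x ^ (n - N')), ← mul_assoc, ← mul_pow,
      inv_mul_cancel₀ hx, one_pow, one_mul]
    exact mul_mem (pow_mem hz _) (hT t ht z hz)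
  · have h4 : x⁻¹ ^ N' * x ^ n = x⁻¹ ^ (N' - n) := by
      conv_lhs => rw [← Nat.sub_add_cancel hn]
      rw [pow_add, mul_assoc, ← mul_pow, inv_mul_cancel₀ hx, one_pow, mul_one]
    rw [h4]
    rcases lt_or_ge (N' - n) M with hlt | hge
    · refine Submodule.mem_sup_right (Submodule.subset_span ?_)
      exact Finset.mem_coe.mpr (Finset.mem_image.mpr
        ⟨(N' - n, t), Finset.mem_product.mpr ⟨Finset.mem_range.mpr hlt, ht⟩, rfl⟩)
    · exact Submodule.mem_sup_left (Submodule.mem_sup_right (hM t ht _ hge))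

/-- If the functions regular where `x` is form a finite module over `k[x]` and `c` has a pole at `y`
and is otherwise regular where `x⁻¹` is, then some function has its only pole at `y`. -/
lemma exists_mem_iff_ne (harch : ∀ z s, s⁻¹ ∉ O z → ∀ a, ∃ N : ℕ, s ^ N * a ∈ O z)
    (hpoles : ∀ f : K, {z | f ∉ O z}.Finite) {x : K} (T : Finset K)
    (hT : ∀ t ∈ T, t ∈ regularWhere O hk x)
    (hspan : regularWhere O hk x ≤ Submodule.span k {b | ∃ (n : ℕ), ∃ t ∈ T, b = x ^ n * t})
    {y : ι} (hy : x ∉ O y) {g : K} (hg : g ∈ regularWhere O hk x⁻¹) (hg0 : g ≠ 0)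
    (hgy : g⁻¹ ∈ O y) (hgz : ∀ z, x ∉ O z → z ≠ y → g⁻¹ ∉ O z) :
    ∃ a : K, ∀ z, a ∈ O z ↔ z ≠ y := by
  have hx : x ≠ 0 := by rintro rfl; exact hy (zero_mem (O y))
  have hinv : ∀ z, x ∉ O z → x⁻¹ ∈ O z := fun z hz ↦ ((O z).mem_or_inv_mem x).resolve_left hz
  -- Since `g` is a unit at `y` and vanishes at the other poles of `x`, the function `g ^ N * x`
  -- keeps the pole at `y` and loses the others.
  obtain ⟨N, hN⟩ := exists_pow_mul_mem_of_finite O harch (Z := {z | x ∉ O z ∧ z ≠ y})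
    ((hpoles x).subset fun z hz ↦ hz.1) (s := g) (fun z hz ↦ hgz z hz.1 hz.2) x
  set c := g ^ N * x with hc
  have hcy : c ∉ O y := by
    intro h
    have h1 : g⁻¹ ^ N * c = x := by
      rw [hc, ← mul_assoc, ← mul_pow, inv_mul_cancel₀ hg0, one_pow, one_mul]
    exact hy (h1 ▸ mul_mem (pow_mem hgy _) h)
  have hcz : ∀ z, z ≠ y → x⁻¹ ∈ O z → c ∈ O z := by
    intro z hz hxz
    by_cases h : x ∈ O z
    · exact mul_mem (pow_mem (hg z hxz) _) h
    · exact hN N le_rfl z ⟨h, hz⟩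
  obtain ⟨F, hF, hFmem⟩ := exists_finite_sup O hk harch hpoles hx T hT hspan
  set AB := regularWhere O hk x ⊔ regularWhere O hk x⁻¹ with hAB
  -- The factor `X` ensures that a nonzero element of the kernel gives a polynomial of positive
  -- degree, as `mem_of_aeval_mem` requires.
  let Φ : k[X] →ₗ[k] K ⧸ AB :=
    AB.mkQ ∘ₗ (aeval c).toLinearMap ∘ₗ LinearMap.mulLeft k X
  have hΦ : ∀ q, Φ q ∈ F.map AB.mkQ := by
    intro q
    have h1 : aeval c (X * q) ∈ AB ⊔ F := hFmem _ fun z hz hz' ↦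
      aeval_mem (O z) (hk z) (hcz z (fun h ↦ hy (h ▸ hz)) hz') _
    obtain ⟨u, hu, v, hv, huv⟩ := Submodule.mem_sup.mp h1
    refine ⟨v, hv, ?_⟩
    change AB.mkQ v = AB.mkQ (aeval c (X * q))
    have hu' : AB.mkQ u = 0 := (Submodule.Quotient.mk_eq_zero AB).mpr hu
    rw [← huv, map_add, hu', zero_add]
  have hninj : ¬ Function.Injective Φ := by
    intro hinj
    let Φ' : k[X] →ₗ[k] F.map AB.mkQ := Φ.codRestrict _ hΦ
    have hinj' : Function.Injective Φ' := fun a b h ↦ hinj congr(($h).1)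
    have : Module.Finite k (F.map AB.mkQ) := inferInstance
    exact Polynomial.not_finite (R := k) (Module.Finite.of_injective Φ' hinj')
  rw [injective_iff_map_eq_zero] at hninj
  push Not at hninj
  obtain ⟨q, hq, hq0⟩ := hninj
  have h1 : aeval c (X * q) ∈ AB := (Submodule.Quotient.mk_eq_zero AB).mp hq
  have hdeg : 0 < (X * q : k[X]).natDegree := by
    rw [natDegree_X_mul hq0]; exact Nat.succ_pos _
  obtain ⟨a, ha, b, hb, hab⟩ := Submodule.mem_sup.mp h1
  -- Here `P(c) = a + b` with `b` regular where `x⁻¹` is, in particular at all poles of `x`. At `y`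
  -- regularity of `a` would make `P(c)`, hence `c`, regular; at the other poles of `x` both `P(c)`
  -- and `b` are regular.
  refine ⟨a, fun z ↦ ⟨?_, fun hz ↦ ?_⟩⟩
  · rintro h rfl
    exact hcy (mem_of_aeval_mem (O z) (hk z) hdeg (hab ▸ add_mem h (hb z (hinv z hy))))
  · by_cases hxz : x ∈ O z
    · exact ha z hxz
    · have h2 := hinv z hxz
      rw [eq_sub_of_add_eq hab]
      exact sub_mem (aeval_mem (O z) (hk z) (hcz z hz h2) _) (hb z h2)

end SinglePole
end LocalGlobal

namespace LocalGlobal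
-- The complement of a closed point of a proper curve is affine.
section ComplementOfPoint

open Polynomial

variable {k : Type u} [Field k] {Y : Scheme.{u}} [IsIntegral Y]
  [∀ z : Y, IsPrincipalIdealRing (Y.presheaf.stalk z)]

/-- The local ring at `z`, as a valuation subring of the function field. -/
noncomputable def localValuationSubring (z : Y) : ValuationSubring Y.functionField where
  __ := localSubring z
  mem_or_inv_mem' f := mem_or_inv_mem_localSubring f

@[simp]
lemma mem_localValuationSubring {z : Y} {f : Y.functionField} :
    f ∈ localValuationSubring z ↔ f ∈ localSubring z := Iff.rfl

/-- In the local ring every nonzero ideal is a power of the maximal ideal, so the denominator of `a`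
divides a power of `s`. -/
lemma exists_pow_mul_mem_localSubring [IsLocallyNoetherian Y] (z : Y) (s : Y.functionField)
    (hs : s⁻¹ ∉ localSubring z) (a : Y.functionField) : ∃ N : ℕ, s ^ N * a ∈ localSubring z := by
  obtain ⟨s, rfl⟩ := (mem_or_inv_mem_localSubring s).resolve_right hs
  obtain ⟨⟨b, c⟩, h⟩ := IsLocalization.surj (nonZeroDivisors (Y.presheaf.stalk z)) a
  dsimp only at h
  have hc : (c : Y.presheaf.stalk z) ≠ 0 := nonZeroDivisors.ne_zero c.2
  have hsm : s ∈ IsLocalRing.maximalIdeal (Y.presheaf.stalk z) := by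
    intro hu
    exact hs ⟨↑hu.unit⁻¹, (eq_inv_of_mul_eq_one_right
      (by rw [← map_mul, hu.mul_val_inv, map_one]))⟩
  have htfae := ((tfae_of_isNoetherianRing_of_isLocalRing_of_isDomain
    (Y.presheaf.stalk z)).out 0 6).mp (inferInstance : IsPrincipalIdealRing (Y.presheaf.stalk z))
  obtain ⟨n, hn⟩ := htfae (Ideal.span {(c : Y.presheaf.stalk z)}) (by simp [hc])
  obtain ⟨d, hd⟩ := Ideal.mem_span_singleton.mp (hn.ge (Ideal.pow_mem_pow hsm n))
  refine ⟨n, d * b, ?_⟩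
  rw [← map_pow, hd, map_mul, map_mul, ← h]
  ring

variable (π : Y ⟶ Spec (.of k)) [IsProper π] [IsNoetherian Y]

lemma finite_setOf_notMem_localSubring (f : Y.functionField) :
    {z : Y | f ∉ localSubring z}.Finite :=
  finite_of_isClosed_of_genericPoint_notMem (dom f).2.isClosed_compl
    (by simpa using genericPoint_mem_dom f)

/-- Module generators over `k[X]` from `finite_eval₂RingHom`, rewritten inside the function field as
`k`-linear generators `x ^ n * t`. -/
lemma exists_finset_span {x : Y.functionField}
    (hx : ∀ g : k[X], g ≠ 0 → g.eval₂ (constFunctionField π) x ≠ 0) :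
    letI : Algebra k Y.functionField := (constFunctionField π).toAlgebra
    ∃ T : Finset Y.functionField, (∀ t ∈ T, ∀ z, x ∈ localSubring z → t ∈ localSubring z) ∧
      ∀ a, (∀ z, x ∈ localSubring z → a ∈ localSubring z) →
        a ∈ Submodule.span k {b | ∃ (n : ℕ), ∃ t ∈ T, b = x ^ n * t} := by
  let : Algebra k Y.functionField := (constFunctionField π).toAlgebra
  obtain ⟨a, ha⟩ := exists_section_of_le_dom (genericPoint_mem_dom x) le_rfl
  have hfin := finite_eval₂RingHom π hx ha
  let : Algebra k[X] Γ(Y, dom x) := (eval₂RingHom (constSection π (dom x)) a).toAlgebra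
  have hfin' : Module.Finite k[X] Γ(Y, dom x) := hfin
  obtain ⟨T, hT⟩ := hfin'.fg_top
  classical
  let γ := Y.presheaf.germ (dom x) (genericPoint Y) (genericPoint_mem_dom x)
  refine ⟨T.image γ, ?_, fun b hb ↦ ?_⟩
  · intro t ht z hz
    obtain ⟨t, -, rfl⟩ := Finset.mem_image.mp ht
    exact germ_genericPoint_mem_localSubring (U := dom x) hz t
  · obtain ⟨b, rfl⟩ := exists_section_of_le_dom (f := b) (genericPoint_mem_dom x) hb
    have hmem : b ∈ Submodule.span k[X] (T : Set Γ(Y, dom x)) := hT ▸ Submodule.mem_top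
    set M := Submodule.span k {b | ∃ (n : ℕ), ∃ t ∈ T.image γ, b = x ^ n * t} with hM
    have hxM : ∀ u ∈ M, x * u ∈ M := by
      intro u hu
      refine Submodule.span_le.mpr ?_ (Submodule.apply_mem_span_image_of_mem_span
        (LinearMap.mulLeft k x) hu)
      rintro _ ⟨_, ⟨n, t, ht, rfl⟩, rfl⟩
      exact Submodule.subset_span ⟨n + 1, t, ht, by rw [LinearMap.mulLeft_apply]; ring⟩
    have hpM : ∀ (g : k[X]), ∀ u ∈ M, g.eval₂ (constFunctionField π) x * u ∈ M := by
      intro g u hu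
      induction g using Polynomial.induction_on' with
      | add p q hp hq => rw [eval₂_add, add_mul]; exact add_mem hp hq
      | monomial n c =>
        rw [eval₂_monomial, mul_assoc]
        refine M.smul_mem c ?_
        induction n with
        | zero => simpa using hu
        | succ n ih => rw [pow_succ', mul_assoc]; exact hxM _ ih
    clear hb
    induction hmem using Submodule.span_induction with
    | mem u hu =>
      exact Submodule.subset_span ⟨0, γ u, Finset.mem_image_of_mem _ hu, by simp [γ]⟩
    | zero => rw [map_zero]; exact zero_mem _
    | add u v _ _ hu hv => rw [map_add]; exact add_mem hu hv
    | smul r u _ hu =>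
      rw [Algebra.smul_def, map_mul]
      have h := germ_eval₂ π (genericPoint_mem_dom x) a r
      rw [ha] at h
      exact (congrArg (· * γ u) h).symm ▸ hpM r _ hu

/-- The other poles of `x` form a finite closed set. As `dom x⁻¹` is affine and contains `y`, some
function on it is invertible at `y` and not at these poles. -/
lemma exists_separating (π : Y ⟶ Spec (.of k)) [IsProper π] {x : Y.functionField} {y : Y}
    (hy : x ∉ localSubring y) :
    ∃ g : Y.functionField, (∀ z, x⁻¹ ∈ localSubring z → g ∈ localSubring z) ∧ g ≠ 0 ∧
      g⁻¹ ∈ localSubring y ∧ ∀ z, x ∉ localSubring z → z ≠ y → g⁻¹ ∉ localSubring z := by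
  have hinv (z : Y) (hz : x ∉ localSubring z) : x⁻¹ ∈ localSubring z :=
    (mem_or_inv_mem_localSubring x).resolve_left hz
  have hU : IsAffineOpen (dom x⁻¹) := isAffineOpen_dom π
    fun g hg ↦ eval₂_ne_zero_of_inv_notMem_localSubring (z := y) π (by rwa [inv_inv]) hg
  let Z : Set Y := {z | x ∉ localSubring z} \ {y}
  have hZ : IsClosed Z := by
    rw [← Set.biUnion_of_singleton Z]
    refine Set.Finite.isClosed_biUnion
      ((finite_setOf_notMem_localSubring x).subset Set.sdiff_subset) fun z hz ↦ ?_
    refine isClosed_singleton_of_ne_genericPoint ?_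
    rintro rfl
    exact hz.1 (genericPoint_mem_dom x)
  let V : Y.Opens := ⟨Zᶜ, hZ.isOpen_compl⟩
  obtain ⟨g, hgV, hyg⟩ := hU.exists_basicOpen_le (V := V) ⟨y, fun h ↦ h.2 rfl⟩ (hinv y hy)
  have hη := genericPoint_mem_dom x⁻¹
  have hyd : y ∈ dom x⁻¹ := hinv y hy
  replace hyg : IsUnit (Y.presheaf.germ (dom x⁻¹) y hyd g) :=
    (Scheme.mem_basicOpen _ _ _ hyd).mp hyg
  have h1 := hyg.map (algebraMap (Y.presheaf.stalk y) Y.functionField)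
  rw [algebraMap_germ] at h1
  refine ⟨Y.presheaf.germ _ (genericPoint Y) hη g,
    fun z hz ↦ germ_genericPoint_mem_localSubring (U := dom x⁻¹) hz g, h1.ne_zero, ?_, ?_⟩
  · refine ⟨↑hyg.unit⁻¹, eq_inv_of_mul_eq_one_right ?_⟩
    have h2 := congrArg (algebraMap (Y.presheaf.stalk y) Y.functionField) hyg.mul_val_inv
    rwa [map_mul, map_one, algebraMap_germ] at h2
  · intro z hz hzy
    exact inv_notMem_localSubring (U := dom x⁻¹) (hinv z hz) h1.ne_zero
      fun h ↦ hgV h ⟨hz, hzy⟩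

/-- On a regular proper curve, the complement of a closed point is affine. -/
lemma isAffineOpen_of_forall_mem_iff_ne (π : Y ⟶ Spec (.of k)) [IsProper π] {y : Y}
    (hy : ¬ IsField (Y.presheaf.stalk y))
    {U : Y.Opens} (hU : ∀ z, z ∈ U ↔ z ≠ y) : IsAffineOpen U := by
  let : Algebra k Y.functionField := (constFunctionField π).toAlgebra
  obtain ⟨x, hx⟩ : ∃ x : Y.functionField, x ∉ localSubring y := by
    by_contra! h
    exact hy (MulEquiv.isField (Field.toIsField Y.functionField)
      (RingEquiv.ofBijective (algebraMap _ _)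
      ⟨IsFractionRing.injective (Y.presheaf.stalk y) Y.functionField, h⟩).toMulEquiv)
  obtain ⟨T, hT, hspan⟩ := exists_finset_span π
    fun g hg ↦ eval₂_ne_zero_of_notMem_localSubring π hx hg
  obtain ⟨g, hg, hg0, hgy, hgz⟩ := exists_separating π hx
  obtain ⟨a, ha⟩ := exists_mem_iff_ne (k := k) (localValuationSubring (Y := Y))
    (constFunctionField_mem π) exists_pow_mul_mem_localSubring finite_setOf_notMem_localSubring
    T hT hspan hx hg hg0 hgy hgz
  have : U = dom a := by
    ext z
    exact (hU z).trans (ha z).symm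
  rw [this]
  exact isAffineOpen_dom π fun g hg ↦ eval₂_ne_zero_of_notMem_localSubring (z := y) π
    (fun h ↦ (ha y).mp h rfl) hg

end ComplementOfPoint

section Curve

variable {k : Type u} [Field k] {Y : Scheme.{u}} {π : Y ⟶ Spec (.of k)} {y : Spec (.of k) ⟶ Y}

lemma isAffine_complement [IsIntegral Y] [IsProper π] [SmoothOfRelativeDimension 1 π]
    (e : FormalCoordinate π y) (hy : y ≫ π = 𝟙 (Spec (.of k))) :
    IsAffine (complement π y hy : Scheme.{u}) := by
  have : IsLocallyNoetherian Y := LocallyOfFiniteType.isLocallyNoetherian π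
  have : CompactSpace Y := QuasiCompact.compactSpace_of_compactSpace π
  have : IsNoetherian Y := {}
  have := isPrincipalIdealRing_stalk π
  refine isAffineOpen_of_forall_mem_iff_ne π (y := point y) ?_ fun z ↦ Iff.rfl
  obtain ⟨a, ha, ha'⟩ := e.exists_expand_ne_zero
  intro h
  rw [(IsLocalRing.isField_iff_maximalIdeal_eq).mp h] at ha
  exact ha' (by rw [(Submodule.mem_bot _).mp ha, map_zero])

end Curve
end LocalGlobal
namespace LocalGlobal

/-! ### Pointwise description of cocycles -/

section Cocycles

variable {S' S : Scheme.{u}} {f : S' ⟶ S} {𝒰 𝒱 : EtaleCover S} {𝒲 : EtaleCover S'}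
  {G : Type w} [Group G]

/-- The value of a cocycle at a point. -/
def Cocycle.val (γ : Cocycle G 𝒰) {i j : 𝒰.I₀} {T : Over S} (a : T ⟶ Over.mk (𝒰.f i))
    (b : T ⟶ Over.mk (𝒰.f j)) (t : T.left) : G :=
  DFunLike.coe (F := LocallyConstant T.left G) (γ.ev i j a b) t

lemma Cocycle.isLocallyConstant_val (γ : Cocycle G 𝒰) {i j : 𝒰.I₀} {T : Over S}
    (a : T ⟶ Over.mk (𝒰.f i)) (b : T ⟶ Over.mk (𝒰.f j)) :
    IsLocallyConstant (fun t : T.left ↦ γ.val a b t) :=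
  LocallyConstant.isLocallyConstant (X := T.left) (Y := G) (γ.ev i j a b)

lemma Cocycle.val_trans (γ : Cocycle G 𝒰) {i j l : 𝒰.I₀} {T : Over S}
    (a : T ⟶ Over.mk (𝒰.f i)) (b : T ⟶ Over.mk (𝒰.f j)) (c : T ⟶ Over.mk (𝒰.f l)) (t : T.left) :
    γ.val a b t * γ.val b c t = γ.val a c t :=
  congrArg (fun h : LocallyConstant T.left G ↦ h t) (γ.ev_trans i j l a b c)

lemma Cocycle.val_precomp (γ : Cocycle G 𝒰) {i j : 𝒰.I₀} {T T' : Over S} (φ : T ⟶ T')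
    (a : T' ⟶ Over.mk (𝒰.f i)) (b : T' ⟶ Over.mk (𝒰.f j)) (t : T.left) :
    γ.val (φ ≫ a) (φ ≫ b) t = γ.val a b (φ.left t) :=
  (congrArg (fun h : LocallyConstant T.left G ↦ h t) (γ.ev_precomp i j φ a b)).symm

/-- A cocycle given by its values at points. -/
def Cocycle.ofVal (v : ∀ (i j : 𝒰.I₀) {T : Over S} (_ : T ⟶ Over.mk (𝒰.f i))
      (_ : T ⟶ Over.mk (𝒰.f j)) (_ : T.left), G)
    (hv : ∀ (i j : 𝒰.I₀) {T : Over S} (a : T ⟶ Over.mk (𝒰.f i)) (b : T ⟶ Over.mk (𝒰.f j)),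
      IsLocallyConstant (v i j a b))
    (hp : ∀ (i j : 𝒰.I₀) {T T' : Over S} (φ : T ⟶ T') (a : T' ⟶ Over.mk (𝒰.f i))
      (b : T' ⟶ Over.mk (𝒰.f j)) (t : T.left), v i j a b (φ.left t) = v i j (φ ≫ a) (φ ≫ b) t)
    (ht : ∀ (i j l : 𝒰.I₀) {T : Over S} (a : T ⟶ Over.mk (𝒰.f i)) (b : T ⟶ Over.mk (𝒰.f j))
      (c : T ⟶ Over.mk (𝒰.f l)) (t : T.left), v i j a b t * v j l b c t = v i l a c t) :
    Cocycle G 𝒰 where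
  ev i j T a b := (⟨v i j a b, hv i j a b⟩ : LocallyConstant T.left G)
  ev_precomp i j T T' φ a b := by
    refine LocallyConstant.ext (X := T.left) (Y := G) fun t ↦ ?_
    exact hp i j φ a b t
  ev_trans i j l T a b c := by
    refine LocallyConstant.ext (X := T.left) (Y := G) fun t ↦ ?_
    exact ht i j l a b c t

lemma Cocycle.isCohomologous_iff (γ δ : Cocycle G 𝒰) : γ.IsCohomologous δ ↔
    ∃ α : ∀ i, LocallyConstant (𝒰.X i) G, ∀ (i j : 𝒰.I₀) {T : Over S}
      (a : T ⟶ Over.mk (𝒰.f i)) (b : T ⟶ Over.mk (𝒰.f j)) (t : T.left),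
      α i (a.left t) * γ.val a b t = δ.val a b t * α j (b.left t) := by
  constructor
  · rintro ⟨α, h⟩
    exact ⟨α, fun i j T a b t ↦
      congrArg (fun h : LocallyConstant T.left G ↦ h t) (h i j a b)⟩
  · rintro ⟨α, h⟩
    refine ⟨α, fun i j T a b ↦ LocallyConstant.ext (X := T.left) (Y := G) fun t ↦ h i j a b t⟩

lemma Cocycle.ext_val {γ δ : Cocycle G 𝒰} (h : ∀ (i j : 𝒰.I₀) {T : Over S}
    (a : T ⟶ Over.mk (𝒰.f i)) (b : T ⟶ Over.mk (𝒰.f j)) (t : T.left),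
    γ.val a b t = δ.val a b t) : γ = δ := by
  have key : γ.toOneCochain = δ.toOneCochain := by
    refine OneCochain.ext ?_
    funext i j T a b
    exact LocallyConstant.ext (X := T.left) (Y := G) fun t ↦ h i j a b t
  cases γ
  cases δ
  cases key
  rfl

/-- The image of a cocycle under a homomorphism. -/
def Cocycle.map {H : Type*} [Group H] (γ : Cocycle G 𝒰) (χ : G →* H) : Cocycle H 𝒰 :=
  .ofVal (fun _ _ _ a b t ↦ χ (γ.val a b t))
    (fun _ _ _ a b ↦ (γ.isLocallyConstant_val a b).comp χ)
    (fun _ _ _ _ φ a b t ↦ by rw [γ.val_precomp])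
    (fun _ _ _ _ a b c t ↦ by rw [← map_mul, γ.val_trans])

/-- The class of a cocycle. -/
def H1.mk (𝒰 : EtaleCover S) (γ : Cocycle G 𝒰) : H1 S G :=
  Quotient.mk (cechSetoid S G) ⟨𝒰, γ⟩

lemma H1.mk_eq_mk_iff {γ : Cocycle G 𝒰} {δ : Cocycle G 𝒱} : H1.mk 𝒰 γ = H1.mk 𝒱 δ ↔
    ∃ (𝒲 : EtaleCover S) (m : CoverMap (𝟙 S) 𝒲 𝒰) (n : CoverMap (𝟙 S) 𝒲 𝒱),
      (m.pullbackCocycle γ).IsCohomologous (n.pullbackCocycle δ) :=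
  Quotient.eq (r := cechSetoid S G)

lemma Cocycle.isCohomologous_trans {γ δ ε : Cocycle G 𝒰} (h : γ.IsCohomologous δ)
    (h' : δ.IsCohomologous ε) : γ.IsCohomologous ε :=
  (OneCocycle.equivalence_isCohomologous _ _).trans h h'

lemma Cocycle.isCohomologous_symm {γ δ : Cocycle G 𝒰} (h : γ.IsCohomologous δ) :
    δ.IsCohomologous γ :=
  (OneCocycle.equivalence_isCohomologous _ _).symm h

/-- The identity of a covering. -/
def CoverMap.refl (𝒰 : EtaleCover S) : CoverMap (𝟙 S) 𝒰 𝒰 := ⟨id, fun _ ↦ 𝟙 _, fun _ ↦ by simp⟩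

lemma CoverMap.refl_pullbackCocycle (γ : Cocycle G 𝒰) :
    (CoverMap.refl 𝒰).pullbackCocycle γ = γ := by
  refine Cocycle.ext_val fun i j T a b t ↦ ?_
  let φ : T ⟶ (Over.map (𝟙 S)).obj T := Over.homMk (𝟙 _) (by simp)
  have h := γ.val_precomp φ ((CoverMap.refl 𝒰).push a) ((CoverMap.refl 𝒰).push b) t
  have ha : φ ≫ (CoverMap.refl 𝒰).push a = a := by
    ext; simp [φ, CoverMap.push, CoverMap.refl]
  have hb : φ ≫ (CoverMap.refl 𝒰).push b = b := by
    ext; simp [φ, CoverMap.push, CoverMap.refl]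
  rw [ha, hb] at h
  exact h.symm

lemma H1.mk_eq_of_isCohomologous {γ δ : Cocycle G 𝒰} (h : γ.IsCohomologous δ) :
    H1.mk 𝒰 γ = H1.mk 𝒰 δ :=
  H1.mk_eq_mk_iff.mpr ⟨𝒰, .refl 𝒰, .refl 𝒰, (CoverMap.refl 𝒰).isCohomologous_pullback h⟩

/-- The pulled back class can be computed on any covering lying over `𝒰`, not only on the base
change. -/
lemma H1.pullback_mk (m : CoverMap f 𝒲 𝒰) (γ : Cocycle G 𝒰) :
    H1.pullback f G (H1.mk 𝒰 γ) = H1.mk 𝒲 (m.pullbackCocycle γ) := by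
  let n : CoverMap (𝟙 S') 𝒲 (pullbackCover f 𝒰) :=
    ⟨m.idx, fun i ↦ pullback.lift (𝒲.f i) (m.hom i) (m.comm i).symm,
      fun i ↦ (pullback.lift_fst _ _ _).trans (Category.comp_id _).symm⟩
  refine H1.mk_eq_mk_iff.mpr ⟨𝒲, n, .refl 𝒲, ?_⟩
  rw [CoverMap.refl_pullbackCocycle, ← CoverMap.pullbackCocycle_comp,
    ← CoverMap.pullbackCocycle_cast _ (Category.id_comp f)]
  exact CoverMap.isCohomologous_of_maps _ _ _

/-- Injectivity of pullback maps in terms of cocycles on a fixed covering. -/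
lemma H1.pullback_injective_iff : Function.Injective (H1.pullback f G) ↔
    ∀ (𝒰 : EtaleCover S) (𝒲 : EtaleCover S') (m : CoverMap f 𝒲 𝒰) (γ δ : Cocycle G 𝒰),
      (m.pullbackCocycle γ).IsCohomologous (m.pullbackCocycle δ) →
      ∃ (𝒱 : EtaleCover S) (n : CoverMap (𝟙 S) 𝒱 𝒰),
        (n.pullbackCocycle γ).IsCohomologous (n.pullbackCocycle δ) := by
  constructor
  · intro H 𝒰 𝒲 m γ δ h
    obtain ⟨𝒱, n, n', hn⟩ := H1.mk_eq_mk_iff.mp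
      (H (a₁ := H1.mk 𝒰 γ) (a₂ := H1.mk 𝒰 δ) (by
        rw [H1.pullback_mk m, H1.pullback_mk m]
        exact H1.mk_eq_of_isCohomologous h))
    exact ⟨𝒱, n, Cocycle.isCohomologous_trans hn (CoverMap.isCohomologous_of_maps _ _ _)⟩
  · intro H x y hxy
    induction x using Quotient.inductionOn with | _ x
    induction y using Quotient.inductionOn with | _ y
    obtain ⟨𝒰₁, γ⟩ := x
    obtain ⟨𝒰₂, δ⟩ := y
    change H1.pullback f G (H1.mk 𝒰₁ γ) = H1.pullback f G (H1.mk 𝒰₂ δ) at hxy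
    change H1.mk 𝒰₁ γ = H1.mk 𝒰₂ δ
    let q₁ := CoverMap.interFst 𝒰₁ 𝒰₂
    let q₂ := CoverMap.interSnd 𝒰₁ 𝒰₂
    let m₁ := CoverMap.ofPullback f 𝒰₁
    let m₂ := CoverMap.ofPullback f 𝒰₂
    let m := CoverMap.ofPullback f (interCover 𝒰₁ 𝒰₂)
    rw [H1.pullback_mk m₁, H1.pullback_mk m₂] at hxy
    obtain ⟨𝒲, r₁, r₂, hr⟩ := H1.mk_eq_mk_iff.mp hxy
    let 𝒲' := interCover 𝒲 (pullbackCover f (interCover 𝒰₁ 𝒰₂))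
    let s₁ := CoverMap.interFst 𝒲 (pullbackCover f (interCover 𝒰₁ 𝒰₂))
    let s₂ := CoverMap.interSnd 𝒲 (pullbackCover f (interCover 𝒰₁ 𝒰₂))
    have e₁ : 𝟙 S' ≫ f = f := Category.id_comp f
    have e₂ : f ≫ 𝟙 S = f := Category.comp_id f
    -- Two morphisms of coverings with the same source and target pull a cocycle back to
    -- cohomologous ones, so the route through the common refinement agrees with the route through
    -- `𝒲`.
    have key : ∀ (𝒱 : EtaleCover S) (ε : Cocycle G 𝒱) (q : CoverMap (𝟙 S) (interCover 𝒰₁ 𝒰₂) 𝒱)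
        (r : CoverMap (𝟙 S') 𝒲 (pullbackCover f 𝒱)),
        (((s₂.comp m).cast e₁).pullbackCocycle (q.pullbackCocycle ε)).IsCohomologous
          (s₁.pullbackCocycle (r.pullbackCocycle
            ((CoverMap.ofPullback f 𝒱).pullbackCocycle ε))) := by
      intro 𝒱 ε q r
      rw [← CoverMap.pullbackCocycle_comp, ← CoverMap.pullbackCocycle_comp,
        ← CoverMap.pullbackCocycle_comp, ← CoverMap.pullbackCocycle_cast _ e₂,
        ← CoverMap.pullbackCocycle_cast ((s₁.comp r).comp _)
          (by simp : (𝟙 S' ≫ 𝟙 S') ≫ f = f)]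
      exact CoverMap.isCohomologous_of_maps _ _ _
    obtain ⟨𝒱, n, hn⟩ := H _ 𝒲' ((s₂.comp m).cast e₁) (q₁.pullbackCocycle γ)
      (q₂.pullbackCocycle δ) (Cocycle.isCohomologous_trans (key _ γ q₁ r₁)
        (Cocycle.isCohomologous_trans (s₁.isCohomologous_pullback hr)
          (Cocycle.isCohomologous_symm (key _ δ q₂ r₂))))
    refine H1.mk_eq_mk_iff.mpr ⟨𝒱, (n.comp q₁).cast (Category.comp_id _),
      (n.comp q₂).cast (Category.comp_id _), ?_⟩
    rw [CoverMap.pullbackCocycle_cast, CoverMap.pullbackCocycle_cast,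
      CoverMap.pullbackCocycle_comp, CoverMap.pullbackCocycle_comp]
    exact hn

end Cocycles

end LocalGlobal
namespace LocalGlobal

/-! ### Sections of twisted forms of sets with an action of a `p`-group -/

section TwistedSections

variable {S' S : Scheme.{u}} {f : S' ⟶ S} {𝒰 𝒱 : EtaleCover S} {𝒲 : EtaleCover S'}
  {G : Type w} [Group G]

/-- The twist of the `G`-set `X` by the cocycle `P` has a global section. -/
def HasTwistedSection (P : Cocycle G 𝒰) (X : Type*) [MulAction G X] : Prop :=
  ∃ σ : ∀ i, LocallyConstant (𝒰.X i) X, ∀ (i j : 𝒰.I₀) {T : Over S}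
    (a : T ⟶ Over.mk (𝒰.f i)) (b : T ⟶ Over.mk (𝒰.f j)) (t : T.left),
    P.val a b t • σ j (b.left t) = σ i (a.left t)

variable {X : Type*} [MulAction G X]

lemma LocallyConstant.exists_smul {T : Type*} [TopologicalSpace T] (α : LocallyConstant T G)
    (σ : LocallyConstant T X) : ∃ τ : LocallyConstant T X, ∀ t, τ t = α t • σ t :=
  ⟨⟨fun t ↦ α t • σ t, (α.isLocallyConstant.prodMk σ.isLocallyConstant).comp
    (fun z : G × X ↦ z.1 • z.2)⟩, fun _ ↦ rfl⟩

lemma HasTwistedSection.of_isCohomologous {P Q : Cocycle G 𝒰} (h : P.IsCohomologous Q)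
    (hP : HasTwistedSection P X) : HasTwistedSection Q X := by
  obtain ⟨α, hα⟩ := (Cocycle.isCohomologous_iff P Q).mp h
  obtain ⟨σ, hσ⟩ := hP
  choose τ hτ using fun i ↦ LocallyConstant.exists_smul (α i) (σ i)
  refine ⟨τ, fun i j T a b t ↦ ?_⟩
  rw [hτ, hτ, smul_smul, ← hα i j a b t, ← smul_smul, hσ]

lemma HasTwistedSection.pullback (m : CoverMap f 𝒲 𝒰) {P : Cocycle G 𝒰}
    (hP : HasTwistedSection P X) : HasTwistedSection (m.pullbackCocycle P) X := by
  obtain ⟨σ, hσ⟩ := hP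
  exact ⟨fun i ↦ (σ (m.idx i)).comap (m.hom i).base.hom,
    fun i j T a b t ↦ hσ _ _ (m.push a) (m.push b) t⟩

/-- Lifting a cocycle to a subgroup. -/
lemma Cocycle.exists_map_subtype_eq (P : Cocycle G 𝒰) (N : Subgroup G)
    (h : ∀ (i j : 𝒰.I₀) {T : Over S} (a : T ⟶ Over.mk (𝒰.f i)) (b : T ⟶ Over.mk (𝒰.f j))
      (t : T.left), P.val a b t ∈ N) : ∃ Q : Cocycle N 𝒰, Q.map N.subtype = P :=
  ⟨.ofVal (fun i j _ a b t ↦ ⟨P.val a b t, h i j a b t⟩)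
    (fun _ _ _ a b ↦ IsLocallyConstant.desc _ Subtype.val (P.isLocallyConstant_val a b)
      Subtype.val_injective)
    (fun _ _ _ _ φ a b t ↦ Subtype.ext (P.val_precomp φ a b t).symm)
    (fun _ _ _ _ a b c t ↦ Subtype.ext (P.val_trans a b c t)),
    Cocycle.ext_val fun _ _ _ _ _ _ ↦ rfl⟩

/-- The twist of a cocycle by a 0-cochain. -/
lemma Cocycle.exists_twist (P : Cocycle G 𝒰) (α : ∀ i, LocallyConstant (𝒰.X i) G) :
    ∃ Q : Cocycle G 𝒰, P.IsCohomologous Q ∧ ∀ (i j : 𝒰.I₀) {T : Over S}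
      (a : T ⟶ Over.mk (𝒰.f i)) (b : T ⟶ Over.mk (𝒰.f j)) (t : T.left),
      Q.val a b t = α i (a.left t) * P.val a b t * (α j (b.left t))⁻¹ := by
  let Q : Cocycle G 𝒰 := .ofVal
    (fun i j _ a b t ↦ α i (a.left t) * P.val a b t * (α j (b.left t))⁻¹)
    (fun i j _ a b ↦ (((α i).comap a.left.base.hom).isLocallyConstant.mul
      (P.isLocallyConstant_val a b)).mul ((α j).comap b.left.base.hom).isLocallyConstant.inv)
    (fun _ _ _ _ φ a b t ↦ by rw [P.val_precomp]; rfl)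
    (fun _ _ _ _ a b c t ↦ by rw [← P.val_trans a b c]; group)
  have hQ : ∀ (i j : 𝒰.I₀) {T : Over S}
      (a : T ⟶ Over.mk (𝒰.f i)) (b : T ⟶ Over.mk (𝒰.f j)) (t : T.left),
      Q.val a b t = α i (a.left t) * P.val a b t * (α j (b.left t))⁻¹ := fun _ _ _ _ _ _ ↦ rfl
  exact ⟨Q, (Cocycle.isCohomologous_iff _ _).mpr ⟨α, fun i j T a b t ↦ by simp [hQ]⟩, hQ⟩

/-- A proper subgroup of a finite `p`-group lies in the kernel of a surjection to `ℤ/p`. -/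
lemma IsPGroup.exists_surjective_le_ker {p : ℕ} [Fact p.Prime] [Finite G] (hG : IsPGroup p G)
    {H : Subgroup G} (hH : H ≠ ⊤) : ∃ χ : G →* Multiplicative (ZMod p),
      Function.Surjective χ ∧ H ≤ χ.ker := by
  have hp : p.Prime := Fact.out
  obtain ⟨n, hn⟩ := IsPGroup.iff_card.mp hG
  obtain ⟨m, hm⟩ := IsPGroup.iff_card.mp (hG.to_subgroup H)
  have hlt : m < n := by
    have h1 : Nat.card H ∣ Nat.card G := Subgroup.card_subgroup_dvd_card H
    rw [hn, hm] at h1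
    refine lt_of_le_of_ne ((Nat.pow_dvd_pow_iff_le_right hp.one_lt).mp h1) ?_
    rintro rfl
    exact hH (Subgroup.eq_top_of_card_eq _ (hm.trans hn.symm))
  -- Enlarge `H` to a subgroup of index `p`; it is normal because `p` is the smallest prime factor
  -- of the order.
  obtain ⟨N, hN, hHN⟩ := Sylow.exists_subgroup_card_pow_prime_le (p := p) (m := n - 1) (n := m)
    (by rw [hn]; exact pow_dvd_pow _ (by omega)) H hm (by omega)
  have hidx : N.index = p := by
    have := N.card_mul_index
    rw [hN, hn] at this
    have h2 : p ^ n = p ^ (n - 1) * p := by rw [← pow_succ]; congr 1; omega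
    rw [h2] at this
    exact Nat.eq_of_mul_eq_mul_left (pow_pos hp.pos _) this
  have : N.Normal := by
    refine Subgroup.normal_of_index_eq_minFac_card ?_
    rw [hidx, hn, hp.pow_minFac (by omega)]
  have hc : Nat.card (G ⧸ N) = p := hidx
  have hc' : Nat.card (Multiplicative (ZMod p)) = p := by simp
  let ε : G ⧸ N ≃* Multiplicative (ZMod p) := mulEquivOfPrimeCardEq hc hc'
  refine ⟨ε.toMonoidHom.comp (QuotientGroup.mk' N),
    ε.surjective.comp (QuotientGroup.mk'_surjective N), fun x hx ↦ ?_⟩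
  simpa using hHN hx

/-- Induction on the order of the group, with the set `X` fixed. Allowing arbitrary `Γ`-sets makes
the claim stable under passing to the subgroup `ker χ`. -/
theorem HasTwistedSection.exists_refinement {p : ℕ} [Fact p.Prime] [Subsingleton S'] [Nonempty S']
    (hf : Function.Injective (H1.pullback f (Multiplicative (ZMod p)))) {X : Type*} :
    ∀ (n : ℕ) (Γ : Type w) [Group Γ] [Finite Γ] [MulAction Γ X], IsPGroup p Γ →
      Nat.card Γ = n → ∀ (𝒰 : EtaleCover S) (𝒲 : EtaleCover S') (m : CoverMap f 𝒲 𝒰)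
      (P : Cocycle Γ 𝒰), HasTwistedSection (m.pullbackCocycle P) X →
      ∃ (𝒱 : EtaleCover S) (n : CoverMap (𝟙 S) 𝒱 𝒰),
        HasTwistedSection (n.pullbackCocycle P) X := by
  intro n
  induction n using Nat.strong_induction_on with | _ n IH
  intro Γ _ _ _ hΓ hn 𝒰 𝒲 m P hP
  obtain ⟨σ, hσ⟩ := id hP
  obtain ⟨i₀, w₀, -⟩ := 𝒲.exists_eq (Classical.arbitrary S')
  set x₀ := σ i₀ w₀ with hx₀
  -- All points of the covering lie over the single point of `S'`, so any two are the projections of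
  -- a point of the fibre product, where the cocycle relates the values of `σ`.
  have horb : ∀ i (w : 𝒲.X i), ∃ g : Γ, σ i w = g • x₀ := by
    intro i w
    obtain ⟨t, ht₁, ht₂⟩ := Scheme.Pullback.exists_preimage_pullback (f := 𝒲.f i) (g := 𝒲.f i₀)
      w w₀ (Subsingleton.elim _ _)
    let T : Over S' := Over.mk (pullback.fst (𝒲.f i) (𝒲.f i₀) ≫ 𝒲.f i)
    let a : T ⟶ Over.mk (𝒲.f i) := Over.homMk (pullback.fst (𝒲.f i) (𝒲.f i₀))
    let b : T ⟶ Over.mk (𝒲.f i₀) := Over.homMk (pullback.snd (𝒲.f i) (𝒲.f i₀))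
      pullback.condition.symm
    have h := hσ i i₀ a b t
    have h₁ : a.left t = w := ht₁
    have h₂ : b.left t = w₀ := ht₂
    rw [h₁, h₂] at h
    exact ⟨_, h.symm⟩
  by_cases hH : MulAction.stabilizer Γ x₀ = ⊤
  · refine ⟨𝒰, .refl 𝒰, fun _ ↦ LocallyConstant.const _ x₀, fun i j T a b t ↦ ?_⟩
    have : ∀ g : Γ, g • x₀ = x₀ := fun g ↦ by
      rw [← MulAction.mem_stabilizer_iff, hH]; trivial
    exact this _
  obtain ⟨χ, hχ, hker⟩ := IsPGroup.exists_surjective_le_ker hΓ hH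
  -- `r` sends `g • x₀` to `χ g`
  have hr : ∃ r : X → Multiplicative (ZMod p), ∀ g : Γ, r (g • x₀) = χ g := by
    classical
    refine ⟨fun x ↦ if h : ∃ g : Γ, g • x₀ = x then χ h.choose else 1, fun g ↦ ?_⟩
    have h : ∃ g' : Γ, g' • x₀ = g • x₀ := ⟨g, rfl⟩
    simp only [h, dite_true]
    have h2 : g⁻¹ * h.choose ∈ MulAction.stabilizer Γ x₀ := by
      rw [MulAction.mem_stabilizer_iff, mul_smul, h.choose_spec, inv_smul_smul]
    have h3 := MonoidHom.mem_ker.mp (hker h2)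
    rw [map_mul, map_inv, inv_mul_eq_one] at h3
    exact h3.symm
  obtain ⟨r, hr⟩ := hr
  -- The composite of `σ` with `r` trivializes the pushforward of `P` along `χ` over `S'`.
  have hcoh : (m.pullbackCocycle (1 : Cocycle (Multiplicative (ZMod p)) 𝒰)).IsCohomologous
      (m.pullbackCocycle (P.map χ)) := by
    refine (Cocycle.isCohomologous_iff _ _).mpr ⟨fun i ↦ (σ i).map r, fun i j T a b t ↦ ?_⟩
    change r (σ i (a.left t)) * 1 = χ ((m.pullbackCocycle P).val a b t) * r (σ j (b.left t))
    obtain ⟨g, hg⟩ := horb j (b.left t)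
    rw [← hσ i j a b t, hg, smul_smul, hr, hr, map_mul, mul_one]
  obtain ⟨𝒱, q, hq⟩ := H1.pullback_injective_iff.mp hf _ _ m _ _ hcoh
  obtain ⟨α, hα⟩ := (Cocycle.isCohomologous_iff _ _).mp (Cocycle.isCohomologous_symm hq)
  -- A set-theoretic section of `χ` lifts the trivialization to `Γ`; twisting by the lift moves the
  -- cocycle into `ker χ`.
  obtain ⟨P', hPP', hP'⟩ := (q.pullbackCocycle P).exists_twist
    (fun i ↦ (α i).map (Function.surjInv hχ))
  have hmem : ∀ (i j : 𝒱.I₀) {T : Over S} (a : T ⟶ Over.mk (𝒱.f i)) (b : T ⟶ Over.mk (𝒱.f j))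
      (t : T.left), P'.val a b t ∈ χ.ker := by
    intro i j T a b t
    have h : α i (a.left t) * χ ((q.pullbackCocycle P).val a b t) = 1 * α j (b.left t) :=
      hα i j a b t
    rw [MonoidHom.mem_ker, hP', map_mul, map_mul, map_inv, mul_inv_eq_one,
      LocallyConstant.map_apply, LocallyConstant.map_apply, Function.comp_apply,
      Function.comp_apply, Function.surjInv_eq hχ, Function.surjInv_eq hχ, h, one_mul]
  obtain ⟨Q, rfl⟩ := P'.exists_map_subtype_eq χ.ker hmem
  -- The section lives on `𝒲` and the reduced cocycle on `𝒱`; both are carried to a covering of `S'`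
  -- mapping to each of them.
  let 𝒱' := pullbackCover f 𝒱
  let s₁ := CoverMap.interFst 𝒲 𝒱'
  let s₂ := CoverMap.interSnd 𝒲 𝒱'
  let m₂ := (s₂.comp (CoverMap.ofPullback f 𝒱)).cast (Category.id_comp f)
  have hQ : HasTwistedSection (m₂.pullbackCocycle Q) X := by
    have h1 := hP.pullback s₁
    rw [← CoverMap.pullbackCocycle_comp,
      ← CoverMap.pullbackCocycle_cast _ (Category.id_comp f)] at h1
    have h2 := h1.of_isCohomologous (CoverMap.isCohomologous_of_maps _
      ((m₂.comp q).cast (Category.comp_id f)) P)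
    rw [CoverMap.pullbackCocycle_cast, CoverMap.pullbackCocycle_comp] at h2
    have h3 : HasTwistedSection (m₂.pullbackCocycle (Q.map χ.ker.subtype)) X :=
      h2.of_isCohomologous (m₂.isCohomologous_pullback hPP')
    exact h3
  have hlt : Nat.card χ.ker < n := by
    rw [← hn]
    refine lt_of_le_of_ne (Subgroup.card_le_card_group _) fun h ↦ ?_
    have htop := Subgroup.eq_top_of_card_eq _ h
    obtain ⟨g, hg⟩ := hχ (Multiplicative.ofAdd 1)
    have : χ g = 1 := by rw [← MonoidHom.mem_ker, htop]; trivial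
    rw [hg] at this
    exact one_ne_zero (α := ZMod p) this
  obtain ⟨𝒱₂, q₂, h₂⟩ := IH _ hlt χ.ker (hΓ.to_subgroup _) rfl 𝒱 _ m₂ Q hQ
  refine ⟨𝒱₂, (q₂.comp q).cast (Category.comp_id _), ?_⟩
  rw [CoverMap.pullbackCocycle_cast, CoverMap.pullbackCocycle_comp]
  have h₃ : HasTwistedSection (q₂.pullbackCocycle (Q.map χ.ker.subtype)) X := h₂
  exact h₃.of_isCohomologous (Cocycle.isCohomologous_symm (q₂.isCohomologous_pullback hPP'))

end TwistedSections

/-! ### Comparison of injectivity for `ℤ/p` and for `p`-groups. -/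

section Injectivity

variable {S' S : Scheme.{u}} {f : S' ⟶ S} {p : ℕ} [Fact p.Prime]

/-- The product of two cocycles. -/
def Cocycle.prod {G H : Type*} [Group G] [Group H] {𝒰 : EtaleCover S} (γ : Cocycle G 𝒰)
    (δ : Cocycle H 𝒰) : Cocycle (G × H) 𝒰 :=
  .ofVal (fun _ _ _ a b t ↦ (γ.val a b t, δ.val a b t))
    (fun _ _ _ a b ↦ (γ.isLocallyConstant_val a b).prodMk (δ.isLocallyConstant_val a b))
    (fun _ _ _ _ φ a b t ↦ by rw [γ.val_precomp, δ.val_precomp])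
    (fun _ _ _ _ a b c t ↦ by rw [Prod.mk_mul_mk, γ.val_trans, δ.val_trans])

/-- The action of `G × G` on `G` by left and right multiplication. -/
abbrev biMulAction (G : Type*) [Group G] : MulAction (G × G) G where
  smul g x := g.1 * x * g.2⁻¹
  one_smul x := by change 1 * x * 1⁻¹ = x; simp
  mul_smul g h x := by
    change g.1 * h.1 * x * (g.2 * h.2)⁻¹ = g.1 * (h.1 * x * h.2⁻¹) * g.2⁻¹
    group

/-- A section is a 0-cochain `σ` with `γ * σ j * δ⁻¹ = σ i`, which is a cohomology from `δ` to `γ`,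
in this order. -/
lemma hasTwistedSection_prod_iff {G : Type*} [Group G] {𝒰 : EtaleCover S} (γ δ : Cocycle G 𝒰) :
    @HasTwistedSection _ _ _ _ (γ.prod δ) G (biMulAction G) ↔ δ.IsCohomologous γ := by
  rw [Cocycle.isCohomologous_iff]
  refine exists_congr fun σ ↦ forall_congr' fun i ↦ forall_congr' fun j ↦ forall_congr' fun T ↦
    forall_congr' fun a ↦ forall_congr' fun b ↦ forall_congr' fun t ↦ ?_
  change γ.val a b t * σ j (b.left t) * (δ.val a b t)⁻¹ = _ ↔ _
  rw [mul_inv_eq_iff_eq_mul, eq_comm]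

theorem injective_pullback_of_isPGroup [Subsingleton S'] [Nonempty S']
    (hf : Function.Injective (H1.pullback f (Multiplicative (ZMod p))))
    (G : Type w) [Group G] [Finite G] (hG : IsPGroup p G) :
    Function.Injective (H1.pullback f G) := by
  refine H1.pullback_injective_iff.mpr fun 𝒰 𝒲 m γ δ h ↦ ?_
  let := biMulAction G
  have hP : HasTwistedSection (m.pullbackCocycle (δ.prod γ)) G :=
    (hasTwistedSection_prod_iff (m.pullbackCocycle δ) (m.pullbackCocycle γ)).mpr h
  have hGG : IsPGroup p (G × G) := by
    obtain ⟨n, hn⟩ := IsPGroup.iff_card.mp hG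
    exact IsPGroup.iff_card.mpr ⟨n + n, by rw [Nat.card_prod, hn, pow_add]⟩
  obtain ⟨𝒱, n, hn⟩ := HasTwistedSection.exists_refinement hf _ (G × G) hGG rfl 𝒰 𝒲 m _ hP
  exact ⟨𝒱, n, (hasTwistedSection_prod_iff (n.pullbackCocycle δ) (n.pullbackCocycle γ)).mp hn⟩

lemma IsPGroup.exists_injective_central {G : Type*} [Group G] [Finite G] [Nontrivial G]
    (hG : IsPGroup p G) : ∃ j : Multiplicative (ZMod p) →* G, Function.Injective j ∧
      ∀ c g, j c * g = g * j c := by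
  have hp : p.Prime := Fact.out
  have := hG.center_nontrivial
  obtain ⟨n, hn⟩ := IsPGroup.iff_card.mp (hG.to_subgroup (Subgroup.center G))
  have hn0 : n ≠ 0 := by
    rintro rfl
    exact (Finite.one_lt_card (α := Subgroup.center G)).ne' (by simpa using hn)
  obtain ⟨z, hz⟩ := exists_prime_orderOf_dvd_card' (G := Subgroup.center G) p
    (by rw [hn]; exact dvd_pow_self p hn0)
  have hc : Nat.card (Subgroup.zpowers z) = p := by rw [Nat.card_zpowers, hz]
  have hc' : Nat.card (Multiplicative (ZMod p)) = p := by simp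
  let ε : Multiplicative (ZMod p) ≃* Subgroup.zpowers z := mulEquivOfPrimeCardEq hc' hc
  refine ⟨(Subgroup.center G).subtype.comp ((Subgroup.zpowers z).subtype.comp ε.toMonoidHom),
    Subtype.val_injective.comp (Subtype.val_injective.comp ε.injective), fun c g ↦ ?_⟩
  exact (Subgroup.mem_center_iff.mp (ε c).1.2 g).symm

theorem injective_pullback_zmod_of_isPGroup {G : Type w} [Group G] [Finite G] [Nontrivial G]
    (hG : IsPGroup p G) (hf : Function.Injective (H1.pullback f G)) :
    Function.Injective (H1.pullback f (Multiplicative (ZMod p))) := by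
  obtain ⟨j, hj, hcen⟩ := IsPGroup.exists_injective_central hG
  refine H1.pullback_injective_iff.mpr fun 𝒰 𝒲 m γ δ h ↦ ?_
  have h' : (m.pullbackCocycle (γ.map j)).IsCohomologous (m.pullbackCocycle (δ.map j)) := by
    obtain ⟨α, hα⟩ := (Cocycle.isCohomologous_iff _ _).mp h
    refine (Cocycle.isCohomologous_iff _ _).mpr ⟨fun i ↦ (α i).map j, fun i i' T a b t ↦ ?_⟩
    have := congrArg j (hα i i' a b t)
    rwa [map_mul, map_mul] at this
  obtain ⟨𝒱, n, hn⟩ := H1.pullback_injective_iff.mp hf _ _ m _ _ h'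
  refine ⟨𝒱, n, ?_⟩
  obtain ⟨α, hα⟩ := (Cocycle.isCohomologous_iff _ _).mp hn
  -- `s` picks a representative of each coset of the central subgroup, and `ρ` is the remaining
  -- central factor: `g = s g * j (ρ g)`.
  let s : G → G := fun g ↦ Function.surjInv (QuotientGroup.mk_surjective (s := j.range)) g
  have hs : ∀ g, ∃ c, j c = (s g)⁻¹ * g := fun g ↦
    QuotientGroup.eq.mp (Function.surjInv_eq (QuotientGroup.mk_surjective (s := j.range)) g)
  choose ρ hρ using hs
  have hsj : ∀ g c, s (g * j c) = s g := fun g c ↦ by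
    have : ((g * j c : G) : G ⧸ j.range) =
        g := (QuotientGroup.eq (s := j.range).mpr ⟨c, by simp⟩).symm
    simp only [s, this]
  refine (Cocycle.isCohomologous_iff _ _).mpr ⟨fun i ↦ (α i).map ρ, fun i i' T a b t ↦ hj ?_⟩
  have h1 : α i (a.left t) * j ((n.pullbackCocycle γ).val a b t) =
    j ((n.pullbackCocycle δ).val a b t) * α i' (b.left t) := hα i i' a b t
  rw [hcen] at h1
  -- Both cocycles are central, so the coset of `α` is the same on both sides of an overlap; its
  -- representative cancels and `ρ ∘ α` is the required cochain.
  have h2 : s (α i (a.left t)) = s (α i' (b.left t)) := by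
    rw [← hsj _ ((n.pullbackCocycle γ).val a b t), h1, hsj]
  rw [map_mul, map_mul, LocallyConstant.map_apply, LocallyConstant.map_apply, Function.comp_apply,
    Function.comp_apply, hρ, hρ, hcen, h2, mul_assoc, mul_assoc, h1]

end Injectivity

end LocalGlobal
namespace LocalGlobal

/-! ### Descent along finite families of flat algebras -/

section Descent

open TensorProduct

variable {A : Type*} [CommRing A] {ι : Type*} {B : ι → Type*} [∀ i, CommRing (B i)]
  [∀ i, Algebra A (B i)] [∀ i, Module.Flat A (B i)]

/-- Faithfulness of a jointly surjective flat family. If the annihilator `I` of `m` is proper, it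
lies in a prime below some `Q`; flatness embeds `B i ⊗ A/I` into `B i ⊗ M`, so `1 ⊗ 1` vanishes, yet
it maps to `1` in `B i / Q`. -/
lemma eq_zero_of_forall_one_tmul_eq_zero
    (hB : ∀ q : PrimeSpectrum A, ∃ (i : ι) (Q : PrimeSpectrum (B i)),
      Q.comap (algebraMap A (B i)) = q)
    {M : Type*} [AddCommGroup M] [Module A M] {m : M}
    (hm : ∀ i, (1 : B i) ⊗ₜ[A] m = 0) : m = 0 := by
  set I : Ideal A := LinearMap.ker (LinearMap.toSpanSingleton A M m) with hI
  by_contra hm0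
  have hI1 : I ≠ ⊤ := by
    intro h
    have h1 : (1 : A) ∈ I := h ▸ Submodule.mem_top
    rw [hI, LinearMap.mem_ker, LinearMap.toSpanSingleton_apply, one_smul] at h1
    exact hm0 h1
  obtain ⟨q, hq, hIq⟩ := Ideal.exists_le_maximal I hI1
  obtain ⟨i, Q, hQ⟩ := hB ⟨q, hq.isPrime⟩
  let g : (A ⧸ I) →ₗ[A] M := I.liftQ (LinearMap.toSpanSingleton A M m) hI.le
  have hg : Function.Injective g := LinearMap.ker_eq_bot.mp (Submodule.ker_liftQ_eq_bot' _ _ hI)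
  have hg' := Module.Flat.lTensor_preserves_injective_linearMap (M := B i) g hg
  have h0 : (1 : B i) ⊗ₜ[A] (Submodule.Quotient.mk 1 : A ⧸ I) = 0 := by
    refine hg' ?_
    rw [map_zero, LinearMap.lTensor_tmul]
    have : g (Submodule.Quotient.mk 1) = m := by
      change (LinearMap.toSpanSingleton A M m) 1 = m
      simp
    rw [this, hm]
  let ψ : (A ⧸ I) →ₐ[A] B i ⧸ Q.asIdeal :=
    Ideal.Quotient.liftₐ I (Algebra.ofId A (B i ⧸ Q.asIdeal)) fun a ha ↦ by
      have : a ∈ Q.asIdeal.comap (algebraMap A (B i)) := by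
        have h := congrArg PrimeSpectrum.asIdeal hQ
        change Q.asIdeal.comap (algebraMap A (B i)) = q at h
        rw [h]
        exact hIq ha
      change algebraMap A (B i ⧸ Q.asIdeal) a = 0
      rw [IsScalarTower.algebraMap_apply A (B i) (B i ⧸ Q.asIdeal)]
      exact Ideal.Quotient.eq_zero_iff_mem.mpr this
  let Φ : B i ⊗[A] (A ⧸ I) →ₐ[A] B i ⧸ Q.asIdeal :=
    Algebra.TensorProduct.lift (Ideal.Quotient.mkₐ A Q.asIdeal) ψ fun _ _ ↦ Commute.all _ _
  have h1 := congrArg Φ h0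
  have h2 : Φ ((1 : B i) ⊗ₜ[A] (Submodule.Quotient.mk 1 : A ⧸ I)) = 1 := map_one Φ
  rw [h2, map_zero] at h1
  exact one_ne_zero h1

variable [Finite ι]

/-- The class of `y` in the cokernel of `A → ∏ B i` dies over each `B i`, where `1 ⊗ y = y i ⊗ 1`.
-/
lemma exists_algebraMap_eq_of_tmul_eq
    (hB : ∀ q : PrimeSpectrum A, ∃ (i : ι) (Q : PrimeSpectrum (B i)),
      Q.comap (algebraMap A (B i)) = q)
    (y : ∀ i, B i) (hy : ∀ i j, y i ⊗ₜ[A] (1 : B j) = (1 : B i) ⊗ₜ[A] y j) :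
    ∃ a : A, ∀ i, algebraMap A (B i) a = y i := by
  classical
  have := Fintype.ofFinite ι
  let R := LinearMap.range (Algebra.linearMap A (∀ i, B i))
  have h : R.mkQ y = 0 := by
    refine eq_zero_of_forall_one_tmul_eq_zero hB fun i ↦ ?_
    have h1 : (1 : B i) ⊗ₜ[A] y = y i ⊗ₜ[A] (1 : ∀ j, B j) := by
      refine (TensorProduct.piRight A A (B i) B).injective ?_
      funext j
      simpa using (hy i j).symm
    have h2 := congrArg (R.mkQ.lTensor (B i)) h1
    rw [LinearMap.lTensor_tmul, LinearMap.lTensor_tmul] at h2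
    have h3 : R.mkQ 1 = 0 :=
      (Submodule.Quotient.mk_eq_zero _).mpr ⟨1, by simp⟩
    rw [h2, h3, tmul_zero]
  obtain ⟨a, ha⟩ := (Submodule.Quotient.mk_eq_zero _).mp h
  exact ⟨a, fun i ↦ congrFun ha i⟩

/-- Vanishing of the first Čech cohomology of the structure sheaf: `hc` is the cocycle condition on
triple overlaps. -/
lemma exists_sub_eq_of_cocycle
    (hB : ∀ q : PrimeSpectrum A, ∃ (i : ι) (Q : PrimeSpectrum (B i)),
      Q.comap (algebraMap A (B i)) = q)
    (c : ∀ i j, B i ⊗[A] B j)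
    (hc : ∀ l i j, (1 : B l) ⊗ₜ[A] c i j =
      Algebra.TensorProduct.map (AlgHom.id A (B l))
        (Algebra.TensorProduct.includeRight : B j →ₐ[A] B i ⊗[A] B j) (c l j) -
      Algebra.TensorProduct.map (AlgHom.id A (B l))
        (Algebra.TensorProduct.includeLeft : B i →ₐ[A] B i ⊗[A] B j) (c l i)) :
    ∃ b : ∀ i, B i, ∀ i j, c i j = b i ⊗ₜ[A] (1 : B j) - (1 : B i) ⊗ₜ[A] b j := by
  classical
  have := Fintype.ofFinite ι
  let d : (∀ i, B i) →ₗ[A] (∀ z : ι × ι, B z.1 ⊗[A] B z.2) :=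
    LinearMap.pi fun z ↦
      (Algebra.TensorProduct.includeLeft : B z.1 →ₐ[A] B z.1 ⊗[A] B z.2).toLinearMap ∘ₗ
        LinearMap.proj z.1 -
      (Algebra.TensorProduct.includeRight : B z.2 →ₐ[A] B z.1 ⊗[A] B z.2).toLinearMap ∘ₗ
        LinearMap.proj z.2
  let R := LinearMap.range d
  have hd : ∀ l (x : B l ⊗[A] (∀ i, B i)) (i j : ι),
      TensorProduct.piRight A A (B l) _ (d.lTensor (B l) x) (i, j) =
      Algebra.TensorProduct.map (AlgHom.id A (B l))
        (Algebra.TensorProduct.includeLeft : B i →ₐ[A] B i ⊗[A] B j)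
        (TensorProduct.piRight A A (B l) B x i) -
      Algebra.TensorProduct.map (AlgHom.id A (B l))
        (Algebra.TensorProduct.includeRight : B j →ₐ[A] B i ⊗[A] B j)
        (TensorProduct.piRight A A (B l) B x j) := by
    intro l x i j
    induction x using TensorProduct.induction_on with
    | zero => simp
    | tmul x y => simp [d, tmul_sub]
    | add x y hx hy =>
      simp only [map_add, Pi.add_apply, hx, hy]
      abel
  have h : R.mkQ (fun z ↦ c z.1 z.2) = 0 := by
    refine eq_zero_of_forall_one_tmul_eq_zero hB fun l ↦ ?_
    -- Over `B l` the cocycle is the coboundary of the family `-c l i`, by the cocycle condition.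
    have h1 : (1 : B l) ⊗ₜ[A] (fun z : ι × ι ↦ c z.1 z.2) =
        d.lTensor (B l) (-(TensorProduct.piRight A A (B l) B).symm fun i ↦ c l i) := by
      refine (TensorProduct.piRight A A (B l) fun z : ι × ι ↦ B z.1 ⊗[A] B z.2).injective ?_
      funext ⟨i, j⟩
      rw [hd]
      simp only [map_neg, Pi.neg_apply, LinearEquiv.apply_symm_apply]
      rw [neg_sub_neg, ← hc l i j]
      simp
    have h2 := congrArg (R.mkQ.lTensor (B l)) h1
    rw [LinearMap.lTensor_tmul, ← LinearMap.comp_apply, ← LinearMap.lTensor_comp,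
      LinearMap.range_mkQ_comp, LinearMap.lTensor_zero, LinearMap.zero_apply] at h2
    exact h2
  obtain ⟨b, hb⟩ := (Submodule.Quotient.mk_eq_zero _).mp h
  exact ⟨b, fun i j ↦ (congrFun hb (i, j)).symm⟩

end Descent

end LocalGlobal
namespace LocalGlobal

/-! ### Fixed points of Frobenius and locally constant functions -/

section FrobeniusFixed

variable {p : ℕ} [Fact p.Prime] {R : Type*} [CommRing R]

/-- The ring homomorphism from `ZMod p` to a ring of characteristic `p`. -/
noncomputable def zmodHom (h : (p : R) = 0) : ZMod p →+* R := ZMod.castHom (ringChar.dvd h) R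

lemma zmodHom_apply (h : (p : R) = 0) (c : ZMod p) : zmodHom h c = (c.val : R) := by
  rw [← map_natCast (zmodHom h), ZMod.natCast_zmod_val]

lemma cast_val_add (h : (p : R) = 0) (c d : ZMod p) :
    ((c + d).val : R) = (c.val : R) + (d.val : R) := by
  simp only [← zmodHom_apply h, map_add]

lemma cast_val_sub (h : (p : R) = 0) (c d : ZMod p) :
    ((c - d).val : R) = (c.val : R) - (d.val : R) := by
  simp only [← zmodHom_apply h, map_sub]

lemma cast_val_pow (h : (p : R) = 0) (c : ZMod p) : (c.val : R) ^ p = c.val := by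
  rw [← zmodHom_apply h, ← map_pow, ZMod.pow_card]

/-- The condition `(p : R) = 0` replaces `CharP R p` because it also holds for the zero ring, the
sections over an empty scheme. -/
lemma add_pow_of_cast_eq_zero (h : (p : R) = 0) (x y : R) : (x + y) ^ p = x ^ p + y ^ p := by
  obtain ⟨r, hr⟩ := exists_add_pow_prime_eq (Fact.out : p.Prime) x y
  rw [hr, h]
  ring

/-- The Frobenius endomorphism of a ring of characteristic `p`. -/
def frob (h : (p : R) = 0) : R →+* R where
  toFun x := x ^ p
  map_one' := one_pow _
  map_mul' x y := mul_pow x y p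
  map_zero' := zero_pow (Fact.out : p.Prime).ne_zero
  map_add' := add_pow_of_cast_eq_zero h

lemma sub_pow_of_cast_eq_zero (h : (p : R) = 0) (x y : R) : (x - y) ^ p = x ^ p - y ^ p :=
  map_sub (frob h) x y

/-- `x` is nilpotent and equal to all of its powers `x ^ p ^ m`. -/
lemma eq_zero_of_forall_mem_prime {x : R} (hx : x ^ p = x)
    (h : ∀ t : PrimeSpectrum R, x ∈ t.asIdeal) : x = 0 := by
  have hn : IsNilpotent x := by
    rw [← mem_nilradical, nilradical_eq_sInf, Submodule.mem_sInf]
    exact fun q hq ↦ h ⟨q, hq⟩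
  obtain ⟨n, hn⟩ := hn
  have hpow : ∀ m, x ^ p ^ m = x := fun m ↦ by
    induction m with
    | zero => simp
    | succ m ih => rw [pow_succ, pow_mul, ih, hx]
  rw [← hpow n]
  exact pow_eq_zero_of_le (Nat.lt_pow_self (Fact.out : p.Prime).one_lt).le hn

/-- The fibres of `φ` are clopen; `x` is the sum of their idempotents weighted by the values. -/
lemma exists_frobeniusFixed_of_locallyConstant (hR : (p : R) = 0)
    (φ : LocallyConstant (PrimeSpectrum R) (ZMod p)) :
    ∃ x : R, x ^ p = x ∧ ∀ t : PrimeSpectrum R, x - ((φ t).val : R) ∈ t.asIdeal := by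
  have hcl : ∀ c : ZMod p, IsClopen (φ ⁻¹' {c}) := fun c ↦ φ.isLocallyConstant.isClopen_fiber c
  choose e he hbo using fun c ↦ PrimeSpectrum.exists_idempotent_basicOpen_eq_of_isClopen (hcl c)
  have hmem : ∀ (c : ZMod p) (t : PrimeSpectrum R), φ t = c ↔ e c ∉ t.asIdeal := fun c t ↦ by
    have h : t ∈ φ ⁻¹' {c} ↔ t ∈ PrimeSpectrum.basicOpen (e c) := by rw [hbo]; rfl
    exact h
  refine ⟨∑ c : ZMod p, (c.val : R) * e c, ?_, fun t ↦ ?_⟩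
  · change frob hR _ = _
    rw [map_sum]
    refine Finset.sum_congr rfl fun c _ ↦ ?_
    change ((c.val : R) * e c) ^ p = _
    rw [mul_pow, cast_val_pow hR, (he c).pow_eq (Fact.out : p.Prime).ne_zero]
  · rw [← Ideal.Quotient.eq_zero_iff_mem, map_sub, map_sum, sub_eq_zero]
    rw [Finset.sum_eq_single (φ t)]
    · have h1 : e (φ t) ∉ t.asIdeal := (hmem _ t).mp rfl
      have h2 : e (φ t) * (1 - e (φ t)) ∈ t.asIdeal := by
        rw [mul_sub, mul_one, (he _).eq, sub_self]; exact zero_mem _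
      have h3 := (t.isPrime.mem_or_mem h2).resolve_left h1
      rw [← Ideal.Quotient.eq_zero_iff_mem, map_sub, sub_eq_zero] at h3
      rw [map_mul, ← h3, map_one, mul_one]
    · intro c _ hc
      have h1 : e c ∈ t.asIdeal := by
        by_contra h
        exact hc ((hmem c t).mpr h).symm
      rw [map_mul, Ideal.Quotient.eq_zero_iff_mem.mpr h1, mul_zero]
    · simp

variable [IsLocalRing R]

/-- The product of all `x - c` is `x ^ p - x = 0`. -/
lemma exists_not_isUnit_sub (hR : (p : R) = 0) {x : R} (hx : x ^ p = x) :
    ∃ c : ZMod p, ¬ IsUnit (x - (c.val : R)) := by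
  by_contra! H
  have h1 : IsUnit (∏ c : ZMod p, (x - (c.val : R))) := by
    rw [IsUnit.prod_univ_iff]; exact H
  have h2 : ∏ c : ZMod p, (x - (c.val : R)) = x ^ p - x := by
    have hp : p.Prime := Fact.out
    have hroots := FiniteField.roots_X_pow_card_sub_X (ZMod p)
    rw [ZMod.card] at hroots
    have hprod := Polynomial.prod_multiset_X_sub_C_of_monic_of_roots_card_eq
      (p := (Polynomial.X ^ p - Polynomial.X : Polynomial (ZMod p)))
      (Polynomial.monic_X_pow_sub (by simpa using hp.one_lt))
      (by rw [hroots, FiniteField.X_pow_card_sub_X_natDegree_eq _ hp.one_lt]; simp)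
    rw [hroots] at hprod
    change ∏ c : ZMod p, (Polynomial.X - Polynomial.C c) = _ at hprod
    have h := congrArg (Polynomial.eval₂ (zmodHom hR) x) hprod
    simpa [Polynomial.eval₂_finsetProd, zmodHom_apply hR] using h
  rw [h2, hx, sub_self] at h1
  exact not_isUnit_zero h1

/-- Otherwise the unit `d - c` would be a sum of two nonunits of a local ring. -/
lemma eq_of_not_isUnit_sub (hR : (p : R) = 0) {x : R} {c d : ZMod p}
    (hc : ¬ IsUnit (x - (c.val : R))) (hd : ¬ IsUnit (x - (d.val : R))) : c = d := by
  by_contra h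
  have h1 : IsUnit (((d - c).val : R)) := by
    rw [← zmodHom_apply hR]
    exact (isUnit_iff_ne_zero.mpr (sub_ne_zero.mpr (Ne.symm h))).map (zmodHom hR)
  have h2 : ((d - c).val : R) = (x - c.val) + -(x - d.val) := by
    rw [cast_val_sub hR]; ring
  rw [h2] at h1
  rcases IsLocalRing.isUnit_or_isUnit_of_isUnit_add h1 with h | h
  · exact hc h
  · exact hd (by simpa using h.neg)

end FrobeniusFixed

/-! ### Frobenius-fixed functions as locally constant functions with values in `ℤ/p`. -/

section Values

variable {p : ℕ} {T T' : Scheme.{u}}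

/-- The function `x` takes at each point `t` the constant value `φ t` in the residue field. -/
def HasValues (x : Γ(T, ⊤)) (φ : T → ZMod p) : Prop :=
  ∀ t, t ∉ T.basicOpen (x - ((φ t).val : Γ(T, ⊤)))

lemma hasValues_iff {x : Γ(T, ⊤)} {φ : T → ZMod p} : HasValues x φ ↔
    ∀ t, ¬ IsUnit (T.presheaf.germ ⊤ t trivial x - ((φ t).val : T.presheaf.stalk t)) := by
  refine forall_congr' fun t ↦ ?_
  rw [Scheme.mem_basicOpen_top, map_sub, map_natCast]

lemma cast_stalk_eq_zero (hT : (p : Γ(T, ⊤)) = 0) (t : T) : (p : T.presheaf.stalk t) = 0 := by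
  rw [← map_natCast (T.presheaf.germ ⊤ t trivial).hom, hT, map_zero]

/-- Each fibre of the value function is the complement of a basic open set, hence closed; as there
are finitely many fibres, they are open. -/
lemma exists_hasValues [Fact p.Prime] (hT : (p : Γ(T, ⊤)) = 0) {x : Γ(T, ⊤)} (hx : x ^ p = x) :
    ∃ φ : LocallyConstant T (ZMod p), HasValues x φ := by
  have h : ∀ t : T, ∃ c : ZMod p,
      ¬ IsUnit (T.presheaf.germ ⊤ t trivial x - (c.val : T.presheaf.stalk t)) := fun t ↦
    exists_not_isUnit_sub (cast_stalk_eq_zero hT t) (by rw [← map_pow, hx])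
  choose φ hφ using h
  have hval : HasValues x φ := hasValues_iff.mpr hφ
  have key : ∀ c : ZMod p, φ ⁻¹' {c} =
      ((T.basicOpen (x - (c.val : Γ(T, ⊤))) : T.Opens) : Set T)ᶜ := by
    intro c
    ext t
    constructor
    · rintro rfl
      exact hval t
    · intro ht
      refine eq_of_not_isUnit_sub (cast_stalk_eq_zero hT t) (hφ t) ?_
      rwa [Set.mem_compl_iff, SetLike.mem_coe, Scheme.mem_basicOpen_top, map_sub, map_natCast] at ht
  refine ⟨⟨φ, (IsLocallyConstant.iff_isOpen_fiber).mpr fun c ↦ ?_⟩, hval⟩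
  have hc : φ ⁻¹' {c} = (⋃ d ∈ {d : ZMod p | d ≠ c}, φ ⁻¹' {d})ᶜ := by
    ext t
    simp only [Set.mem_preimage, Set.mem_singleton_iff, Set.mem_ofPred_eq, Set.mem_compl_iff,
      Set.mem_iUnion, exists_prop, not_exists, not_and]
    exact ⟨fun h d hd h' ↦ hd (h'.symm.trans h), fun h ↦ by_contra fun h' ↦ h _ h' rfl⟩
  change IsOpen (φ ⁻¹' {c})
  rw [hc, isOpen_compl_iff]
  refine Set.Finite.isClosed_biUnion (Set.toFinite _) fun d _ ↦ ?_
  rw [key]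
  exact (T.basicOpen _).2.isClosed_compl

lemma HasValues.unique [Fact p.Prime] (hT : (p : Γ(T, ⊤)) = 0) {x : Γ(T, ⊤)} {φ ψ : T → ZMod p}
    (hφ : HasValues x φ) (hψ : HasValues x ψ) (t : T) : φ t = ψ t :=
  eq_of_not_isUnit_sub (cast_stalk_eq_zero hT t) (hasValues_iff.mp hφ t) (hasValues_iff.mp hψ t)

lemma HasValues.add [Fact p.Prime] (hT : (p : Γ(T, ⊤)) = 0) {x y : Γ(T, ⊤)} {φ ψ : T → ZMod p}
    (hφ : HasValues x φ) (hψ : HasValues y ψ) : HasValues (x + y) (fun t ↦ φ t + ψ t) := by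
  rw [hasValues_iff] at hφ hψ ⊢
  intro t h
  rw [cast_val_add (cast_stalk_eq_zero hT t), map_add, add_sub_add_comm] at h
  rcases IsLocalRing.isUnit_or_isUnit_of_isUnit_add h with h | h
  · exact hφ t h
  · exact hψ t h

lemma HasValues.sub [Fact p.Prime] (hT : (p : Γ(T, ⊤)) = 0) {x y : Γ(T, ⊤)} {φ ψ : T → ZMod p}
    (hφ : HasValues x φ) (hψ : HasValues y ψ) : HasValues (x - y) (fun t ↦ φ t - ψ t) := by
  rw [hasValues_iff] at hφ hψ ⊢
  intro t h
  rw [cast_val_sub (cast_stalk_eq_zero hT t), map_sub, sub_sub_sub_comm, sub_eq_add_neg] at h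
  rcases IsLocalRing.isUnit_or_isUnit_of_isUnit_add h with h | h
  · exact hφ t h
  · exact hψ t (by simpa using h.neg)

lemma HasValues.comp {x : Γ(T, ⊤)} {φ : T → ZMod p} (hφ : HasValues x φ) (g : T' ⟶ T) :
    HasValues (g.appTop x) (fun t ↦ φ (g t)) := by
  intro t ht
  have h := hφ (g t)
  rw [← map_natCast g.appTop.hom, ← map_sub, ← Scheme.preimage_basicOpen_top] at ht
  exact h ht

/-- The pullback of functions along a morphism to an affine scheme. -/
noncomputable def pullFn {B : CommRingCat.{u}} (a : T ⟶ Spec B) : B →+* Γ(T, ⊤) :=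
  ((Scheme.ΓSpecIso B).inv ≫ a.appTop).hom

lemma pullFn_comp {B : CommRingCat.{u}} (g : T' ⟶ T) (a : T ⟶ Spec B) (x : B) :
    pullFn (g ≫ a) x = g.appTop (pullFn a x) := by
  simp only [pullFn, Scheme.Hom.comp_appTop]
  rfl

lemma pullFn_comp_specMap {B B' : CommRingCat.{u}} (g : T ⟶ Spec B') (φ : B ⟶ B') (x : B) :
    pullFn (g ≫ Spec.map φ) x = pullFn g (φ x) := by
  have := Scheme.ΓSpecIso_inv_naturality φ
  have h := congrArg (fun q ↦ q.hom x) this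
  simp only [CommRingCat.comp_apply] at h
  simp only [pullFn, Scheme.Hom.comp_appTop]
  exact congrArg g.appTop h.symm

lemma notMem_basicOpen_pullFn_iff {B : CommRingCat.{u}} (a : T ⟶ Spec B) (x : B) (t : T) :
    t ∉ T.basicOpen (pullFn a x) ↔ x ∈ (a t).asIdeal := by
  have h : T.basicOpen (pullFn a x) = a ⁻¹ᵁ PrimeSpectrum.basicOpen x := by
    rw [← basicOpen_eq_of_affine, Scheme.preimage_basicOpen_top]
    rfl
  rw [h]
  change ¬ (x ∉ (a t).asIdeal) ↔ _
  exact not_not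

lemma hasValues_pullFn_id_iff {B : CommRingCat.{u}} (x : B) (φ : Spec B → ZMod p) :
    HasValues (pullFn (𝟙 (Spec B)) x) φ ↔ ∀ t : Spec B, x - ((φ t).val : B) ∈ t.asIdeal := by
  refine forall_congr' fun t ↦ ?_
  rw [← map_natCast (pullFn (𝟙 (Spec B))), ← map_sub, notMem_basicOpen_pullFn_iff]
  rfl

end Values

end LocalGlobal
namespace LocalGlobal

/-! ### Finite affine étale coverings of affine schemes -/

/-- Finite étale coverings of `Spec A` by affine schemes. -/
structure AffineCover (A : CommRingCat.{u}) where
  /-- The index set. -/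
  ι : Type u
  finite : Finite ι
  /-- The rings of functions on the members of the covering. -/
  B : ι → CommRingCat.{u}
  /-- The structure homomorphisms. -/
  φ (i : ι) : A ⟶ B i
  etale (i : ι) : Etale (Spec.map (φ i))
  exists_eq (q : Spec A) : ∃ (i : ι) (Q : Spec (B i)), Spec.map (φ i) Q = q

namespace AffineCover

open TensorProduct

variable {A : CommRingCat.{u}} (𝒱 : AffineCover A)

instance : Finite 𝒱.ι := 𝒱.finite

noncomputable instance (i : 𝒱.ι) : Algebra A (𝒱.B i) := (𝒱.φ i).hom.toAlgebra

instance (i : 𝒱.ι) : Module.Flat A (𝒱.B i) := by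
  have := 𝒱.etale i
  exact Flat.SpecMap_iff.mp (inferInstance : Flat (Spec.map (𝒱.φ i)))

lemma exists_comap_eq (q : PrimeSpectrum A) : ∃ (i : 𝒱.ι) (Q : PrimeSpectrum (𝒱.B i)),
    Q.comap (algebraMap A (𝒱.B i)) = q := 𝒱.exists_eq q

/-- The underlying étale covering. -/
noncomputable abbrev toEtaleCover : EtaleCover (Spec A) where
  I₀ := 𝒱.ι
  X i := Spec (𝒱.B i)
  f i := Spec.map (𝒱.φ i)
  etale := 𝒱.etale
  exists_eq := 𝒱.exists_eq

/-- The ring of functions on the overlap of two members of the covering. -/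
noncomputable abbrev overlap (i j : 𝒱.ι) : CommRingCat.{u} := .of (𝒱.B i ⊗[A] 𝒱.B j)

/-- The first projection from the overlap. -/
noncomputable abbrev inl (i j : 𝒱.ι) : 𝒱.B i ⟶ 𝒱.overlap i j :=
  CommRingCat.ofHom Algebra.TensorProduct.includeLeftRingHom

/-- The second projection from the overlap. -/
noncomputable abbrev inr (i j : 𝒱.ι) : 𝒱.B j ⟶ 𝒱.overlap i j :=
  CommRingCat.ofHom Algebra.TensorProduct.includeRight.toRingHom

lemma isPullback (i j : 𝒱.ι) : IsPullback (Spec.map (𝒱.inl i j)) (Spec.map (𝒱.inr i j))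
    (Spec.map (𝒱.φ i)) (Spec.map (𝒱.φ j)) :=
  isPullback_SpecMap_of_isPushout _ _ _ _ (CommRingCat.isPushout_tensorProduct A (𝒱.B i) (𝒱.B j))

lemma exists_lift {i j : 𝒱.ι} {T : Over (Spec A)} (a : T ⟶ Over.mk (𝒱.toEtaleCover.f i))
    (b : T ⟶ Over.mk (𝒱.toEtaleCover.f j)) : ∃ g : T.left ⟶ Spec (𝒱.overlap i j),
      g ≫ Spec.map (𝒱.inl i j) = a.left ∧ g ≫ Spec.map (𝒱.inr i j) = b.left := by
  have h : a.left ≫ Spec.map (𝒱.φ i) = b.left ≫ Spec.map (𝒱.φ j) :=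
    (Over.w a).trans (Over.w b).symm
  exact ⟨(𝒱.isPullback i j).lift _ _ h, (𝒱.isPullback i j).lift_fst _ _ h,
    (𝒱.isPullback i j).lift_snd _ _ h⟩

end AffineCover

/-- Étale morphisms are open and `Spec A` is quasi-compact, so finitely many affine opens of the
members suffice. -/
lemma EtaleCover.exists_affine_refinement {A : CommRingCat.{u}} (𝒰 : EtaleCover (Spec A)) :
    ∃ 𝒱 : AffineCover A, Nonempty (CoverMap (𝟙 (Spec A)) 𝒱.toEtaleCover 𝒰) := by
  have hloc : ∀ x : Spec A, ∃ (i : 𝒰.I₀) (U : (𝒰.X i).Opens), IsAffineOpen U ∧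
      x ∈ 𝒰.f i '' U := by
    intro x
    obtain ⟨i, z, hz⟩ := 𝒰.exists_eq x
    obtain ⟨U, hU, hzU, -⟩ := exists_isAffineOpen_mem_and_subset (x := z) (U := ⊤) trivial
    exact ⟨i, U, hU, z, hzU, hz⟩
  choose i U hU hx using hloc
  have hopen : ∀ x, IsOpen (𝒰.f (i x) '' U x) := fun x ↦ by
    have := 𝒰.etale (i x)
    exact (𝒰.f (i x)).isOpenMap _ (U x).2
  obtain ⟨t, ht⟩ := isCompact_univ.elim_finite_subcover (fun x : Spec A ↦ 𝒰.f (i x) '' U x)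
    hopen fun x _ ↦ Set.mem_iUnion.mpr ⟨x, hx x⟩
  let 𝒱 : AffineCover A :=
    { ι := t
      finite := inferInstance
      B := fun x ↦ Γ(𝒰.X (i x), U x)
      φ := fun x ↦ Spec.preimage ((hU x).fromSpec ≫ 𝒰.f (i x))
      etale := fun x ↦ by
        have := 𝒰.etale (i x)
        rw [Spec.map_preimage]
        infer_instance
      exists_eq := fun q ↦ by
        obtain ⟨x, hxt, z, hz, hzq⟩ := Set.mem_iUnion₂.mp (ht (Set.mem_univ q))
        obtain ⟨Q, hQ⟩ : z ∈ Set.range (hU x).fromSpec := by rwa [(hU x).range_fromSpec]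
        refine ⟨⟨x, hxt⟩, Q, ?_⟩
        rw [Spec.map_preimage, Scheme.Hom.comp_apply, hQ, hzq] }
  refine ⟨𝒱, ⟨⟨fun x ↦ i x.1, fun x ↦ (hU x.1).fromSpec, fun x ↦ ?_⟩⟩⟩
  rw [Category.comp_id]
  exact (Spec.map_preimage _).symm

/-! ### Artin–Schreier algebras -/

section ArtinSchreierAlgebra

open Polynomial

variable {p : ℕ} {A : Type u} [CommRing A]

/-- The Artin–Schreier polynomial. -/
noncomputable def asPoly (p : ℕ) (a : A) : A[X] := X ^ p - X - C a

lemma asPoly_eq (a : A) : asPoly p a = X ^ p - (X + C a) := by rw [asPoly, sub_sub]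

variable [Fact p.Prime]

lemma monic_asPoly (a : A) : (asPoly p a).Monic := by
  rw [asPoly_eq]
  have h : (X + C a).degree ≤ 1 := by compute_degree
  exact monic_X_pow_sub (h.trans_lt (by exact_mod_cast (Fact.out : p.Prime).one_lt))

lemma injective_algebraMap_asPoly (a : A) :
    Function.Injective (algebraMap A (AdjoinRoot (asPoly p a))) := by
  rcases subsingleton_or_nontrivial A with h | h
  · exact Function.injective_of_subsingleton _
  rw [injective_iff_map_eq_zero]
  intro c hc
  have h1 : asPoly p a ∣ C c := by
    rw [← AdjoinRoot.mk_eq_zero]; exact hc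
  by_contra hc0
  refine (monic_asPoly (p := p) a).not_dvd_of_natDegree_lt (C_ne_zero.mpr hc0) ?_ h1
  rw [natDegree_C, asPoly_eq]
  rw [natDegree_sub_eq_left_of_natDegree_lt]
  · simpa using (Fact.out : p.Prime).pos
  · rw [natDegree_X_add_C, natDegree_X_pow]
    exact (Fact.out : p.Prime).one_lt

lemma etale_asPoly (hA : (p : A) = 0) (a : A) : Algebra.Etale A (AdjoinRoot (asPoly p a)) := by
  -- The derivative of the polynomial is `-1`, so `1` is in the required form with `-1` as cofactor,
  -- and no localization is needed.
  let P : StandardEtalePair A := ⟨asPoly p a, monic_asPoly a, 1, -1, 0, 0, by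
    simp [asPoly, derivative_X_pow, hA]⟩
  have h1 : IsUnit (AdjoinRoot.mk P.f P.g) := by
    rw [show P.g = 1 from rfl, map_one]; exact isUnit_one
  let e : AdjoinRoot (asPoly p a) ≃ₐ[A] Localization.Away (AdjoinRoot.mk P.f P.g) :=
    (IsLocalization.atUnit (AdjoinRoot P.f) (Localization.Away (AdjoinRoot.mk P.f P.g)) _
      h1).restrictScalars A
  exact .of_equiv (P.equivAwayAdjoinRoot.trans e.symm)

/-- The étale covering of `Spec A` given by an Artin–Schreier equation. -/
noncomputable def asCover {A : CommRingCat.{u}} (hA : (p : A) = 0) (a : A) : AffineCover A where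
  ι := PUnit
  finite := inferInstance
  B _ := .of (AdjoinRoot (asPoly p a))
  φ _ := CommRingCat.ofHom (algebraMap A (AdjoinRoot (asPoly p a)))
  etale _ := by
    have := etale_asPoly hA a
    rw [HasRingHomProperty.Spec_iff (P := @Etale)]
    exact RingHom.etale_algebraMap.mpr this
  exists_eq q := by
    have := (monic_asPoly (p := p) a).finite_adjoinRoot
    have hint := algebraMap_isIntegral_iff.mpr
      (inferInstance : Algebra.IsIntegral A (AdjoinRoot (asPoly p a)))
    obtain ⟨Q, hQ⟩ := hint.comap_surjective (injective_algebraMap_asPoly a) q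
    exact ⟨⟨⟩, Q, hQ⟩

end ArtinSchreierAlgebra

end LocalGlobal
namespace LocalGlobal

/-! ### Artin–Schreier theory for affine schemes -/

lemma cast_eq_zero_of_ringHom {p : ℕ} {R R' : Type*} [CommRing R] [CommRing R'] (f : R →+* R')
    (h : (p : R) = 0) : (p : R') = 0 := by
  rw [← map_natCast f, h, map_zero]

section Represents

variable {p : ℕ} {S S' : Scheme.{u}} {f : S' ⟶ S} {𝒰 : EtaleCover S}
  {𝒲 : EtaleCover S'}

/-- The cocycle `d` is the coboundary of the family of functions `θ`. -/
def Represents (d : Cocycle (Multiplicative (ZMod p)) 𝒰) (θ : ∀ i, Γ(𝒰.X i, ⊤)) : Prop :=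
  ∀ (i j : 𝒰.I₀) {T : Over S} (a : T ⟶ Over.mk (𝒰.f i)) (b : T ⟶ Over.mk (𝒰.f j)),
    HasValues (Scheme.Hom.appTop (Y := 𝒰.X i) a.left (θ i) -
      Scheme.Hom.appTop (Y := 𝒰.X j) b.left (θ j)) (fun t ↦ (d.val a b t).toAdd)

lemma cast_left_eq_zero (hS : (p : Γ(S, ⊤)) = 0) (T : Over S) : (p : Γ(T.left, ⊤)) = 0 :=
  cast_eq_zero_of_ringHom T.hom.appTop.hom hS

lemma Represents.pullback {d : Cocycle (Multiplicative (ZMod p)) 𝒰} {θ : ∀ i, Γ(𝒰.X i, ⊤)}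
    (h : Represents d θ) (m : CoverMap f 𝒲 𝒰) :
    Represents (m.pullbackCocycle d) (fun i ↦ (m.hom i).appTop (θ (m.idx i))) := by
  intro i j T a b
  have h1 := h _ _ (m.push a) (m.push b)
  have ha : (m.push a).left = a.left ≫ m.hom i := rfl
  have hb : (m.push b).left = b.left ≫ m.hom j := rfl
  rw [ha, hb, Scheme.Hom.comp_appTop, Scheme.Hom.comp_appTop] at h1
  exact h1

lemma Represents.sub_const {d : Cocycle (Multiplicative (ZMod p)) 𝒰} {θ : ∀ i, Γ(𝒰.X i, ⊤)}
    (h : Represents d θ) (s : Γ(S, ⊤)) :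
    Represents d (fun i ↦ θ i - (𝒰.f i).appTop s) := by
  intro i j T a b
  have h1 := h _ _ a b
  have ha : a.left ≫ 𝒰.f i = T.hom := Over.w a
  have hb : b.left ≫ 𝒰.f j = T.hom := Over.w b
  have ha' : Scheme.Hom.appTop (Y := 𝒰.X i) a.left ((𝒰.f i).appTop s) = T.hom.appTop s := by
    rw [← ha, Scheme.Hom.comp_appTop]; rfl
  have hb' : Scheme.Hom.appTop (Y := 𝒰.X j) b.left ((𝒰.f j).appTop s) = T.hom.appTop s := by
    rw [← hb, Scheme.Hom.comp_appTop]; rfl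
  rwa [map_sub, map_sub, ha', hb', sub_sub_sub_cancel_right]

/-- Frobenius-fixed `θ i` are themselves locally constant functions with values in `ℤ/p`, and these
trivialize `d`. -/
lemma Represents.isCohomologous_one [Fact p.Prime] (hS : (p : Γ(S, ⊤)) = 0)
    {d : Cocycle (Multiplicative (ZMod p)) 𝒰} {θ : ∀ i, Γ(𝒰.X i, ⊤)} (h : Represents d θ)
    (hθ : ∀ i, θ i ^ p = θ i) : (1 : Cocycle (Multiplicative (ZMod p)) 𝒰).IsCohomologous d := by
  choose φ hφ using fun i ↦ exists_hasValues
    (cast_eq_zero_of_ringHom (𝒰.f i).appTop.hom hS) (hθ i)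
  refine (Cocycle.isCohomologous_iff _ _).mpr
    ⟨fun i ↦ (φ i).map Multiplicative.ofAdd, fun i j T a b t ↦ ?_⟩
  have hT := cast_left_eq_zero hS T
  have h1 := (h i j a b).unique hT (((hφ i).comp a.left).sub hT ((hφ j).comp b.left)) t
  change Multiplicative.ofAdd (φ i (a.left t)) * 1 =
    d.val a b t * Multiplicative.ofAdd (φ j (b.left t))
  apply Multiplicative.toAdd.injective
  rw [toAdd_mul, toAdd_mul, h1]
  simp

/-- The connecting map of Artin–Schreier theory: local solutions of `℘(θ) = c` differ by
Frobenius-fixed functions. -/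
lemma exists_represents [Fact p.Prime] (hS : (p : Γ(S, ⊤)) = 0) (θ : ∀ i, Γ(𝒰.X i, ⊤)) (c : Γ(S, ⊤))
    (hθ : ∀ i, θ i ^ p - θ i = (𝒰.f i).appTop c) :
    ∃ d : Cocycle (Multiplicative (ZMod p)) 𝒰, Represents d θ := by
  have key : ∀ (i : 𝒰.I₀) {T : Over S} (a : T ⟶ Over.mk (𝒰.f i)),
      Scheme.Hom.appTop (Y := 𝒰.X i) a.left (θ i) ^ p -
        Scheme.Hom.appTop (Y := 𝒰.X i) a.left (θ i) = T.hom.appTop c := by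
    intro i T a
    have ha : a.left ≫ 𝒰.f i = T.hom := Over.w a
    rw [← map_pow, ← map_sub, hθ, ← ha, Scheme.Hom.comp_appTop]
    rfl
  choose φ hφ using fun (i j : 𝒰.I₀) (T : Over S) (a : T ⟶ Over.mk (𝒰.f i))
      (b : T ⟶ Over.mk (𝒰.f j)) ↦ exists_hasValues (cast_left_eq_zero hS T)
    (x := Scheme.Hom.appTop (Y := 𝒰.X i) a.left (θ i) -
      Scheme.Hom.appTop (Y := 𝒰.X j) b.left (θ j)) (by
      rw [sub_pow_of_cast_eq_zero (cast_left_eq_zero hS T), sub_eq_sub_iff_sub_eq_sub,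
        key i a, key j b])
  refine ⟨.ofVal (fun i j T a b t ↦ Multiplicative.ofAdd (φ i j T a b t))
    (fun i j T a b ↦ (φ i j T a b).isLocallyConstant.comp Multiplicative.ofAdd)
    (fun i j T T' g a b t ↦ ?_) (fun i j l T a b c t ↦ ?_), fun i j T a b ↦ hφ i j T a b⟩
  · have h1 := (hφ i j T' a b).comp g.left
    have h2 := hφ i j T (g ≫ a) (g ≫ b)
    rw [Over.comp_left, Over.comp_left, Scheme.Hom.comp_appTop, Scheme.Hom.comp_appTop] at h2
    rw [map_sub] at h1
    exact congrArg Multiplicative.ofAdd (h1.unique (cast_left_eq_zero hS T) h2 t)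
  · have h1 := (hφ i j T a b).add (cast_left_eq_zero hS T) (hφ j l T b c)
    rw [sub_add_sub_cancel] at h1
    exact congrArg Multiplicative.ofAdd (h1.unique (cast_left_eq_zero hS T) (hφ i l T a c) t)

end Represents

/-! ### Cocycles on affine coverings and global solutions of Artin–Schreier equations. -/

section AffineCover

variable {p : ℕ}

lemma eq_of_hasValues [Fact p.Prime] {R : CommRingCat.{u}} (hR : (p : R) = 0) {x y : R}
    (hx : x ^ p = x) (hy : y ^ p = y) {φ : Spec R → ZMod p} (hxφ : HasValues (pullFn (𝟙 _) x) φ)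
    (hyφ : HasValues (pullFn (𝟙 _) y) φ) : x = y := by
  rw [← sub_eq_zero]
  refine eq_zero_of_forall_mem_prime (p := p)
    (by rw [sub_pow_of_cast_eq_zero hR, hx, hy]) fun t ↦ ?_
  have h := hxφ.sub (cast_eq_zero_of_ringHom (pullFn (𝟙 _)) hR) hyφ
  rw [← map_sub] at h
  simpa using (hasValues_pullFn_id_iff _ _).mp h t

lemma exists_hasValues_pullFn_id [Fact p.Prime] {R : CommRingCat.{u}} (hR : (p : R) = 0)
    (φ : LocallyConstant (Spec R) (ZMod p)) :
    ∃ x : R, x ^ p = x ∧ HasValues (pullFn (𝟙 _) x) φ := by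
  obtain ⟨x, hx, h⟩ := exists_frobeniusFixed_of_locallyConstant hR φ
  exact ⟨x, hx, (hasValues_pullFn_id_iff _ _).mpr h⟩

lemma exists_pullFn_id_eq {R : CommRingCat.{u}} (x : Γ(Spec R, ⊤)) :
    ∃ y : R, pullFn (𝟙 _) y = x :=
  ⟨(Scheme.ΓSpecIso R).hom x, by simp [pullFn]⟩

lemma pullFn_id_injective {R : CommRingCat.{u}} :
    Function.Injective (pullFn (𝟙 (Spec R))) := by
  intro x y h
  have h' := congrArg (Scheme.ΓSpecIso R).hom h
  simpa [pullFn] using h'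

lemma pullFn_specMap {R R' : CommRingCat.{u}} (φ : R ⟶ R') (x : R) :
    pullFn (Spec.map φ) x = pullFn (𝟙 _) (φ x) := by
  rw [← pullFn_comp_specMap, Category.id_comp]

lemma appTop_specMap_pullFn_id {R R' : CommRingCat.{u}} (φ : R ⟶ R') (x : R) :
    (Spec.map φ).appTop (pullFn (𝟙 _) x) = pullFn (𝟙 _) (φ x) := by
  rw [← pullFn_comp, Category.comp_id, pullFn_specMap]

namespace AffineCover

variable {A : CommRingCat.{u}} (𝒱 : AffineCover A)

lemma exists_descent (y : ∀ i, 𝒱.B i) (h : ∀ i j, 𝒱.inl i j (y i) = 𝒱.inr i j (y j)) :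
    ∃ a : A, ∀ i, 𝒱.φ i a = y i :=
  exists_algebraMap_eq_of_tmul_eq 𝒱.exists_comap_eq y h

lemma eq_of_forall {a b : A} (h : ∀ i, 𝒱.φ i a = 𝒱.φ i b) : a = b := by
  rw [← sub_eq_zero]
  refine eq_zero_of_forall_one_tmul_eq_zero 𝒱.exists_comap_eq fun i ↦ ?_
  have h1 : a - b = (a - b) • (1 : A) := by simp
  have h2 : (a - b) • (1 : 𝒱.B i) = 0 := by
    rw [Algebra.smul_def, mul_one, map_sub, sub_eq_zero]
    exact h i
  rw [h1, TensorProduct.tmul_smul, TensorProduct.smul_tmul', h2, TensorProduct.zero_tmul]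

lemma cast_overlap_eq_zero (hA : (p : A) = 0) (i j : 𝒱.ι) : (p : 𝒱.overlap i j) = 0 :=
  cast_eq_zero_of_ringHom (𝒱.φ i ≫ 𝒱.inl i j).hom hA

/-- A function whose coboundary is a trivial cocycle differs from a global function by a locally
constant one. -/
lemma exists_artinSchreier_eq [Fact p.Prime] (hA : (p : A) = 0)
    {d : Cocycle (Multiplicative (ZMod p)) 𝒱.toEtaleCover}
    {θ : ∀ i, Γ(𝒱.toEtaleCover.X i, ⊤)} (hd : Represents d θ)
    (h1 : (1 : Cocycle (Multiplicative (ZMod p)) 𝒱.toEtaleCover).IsCohomologous d) {c : A}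
    (hθ : ∀ i, θ i ^ p - θ i = pullFn (𝒱.toEtaleCover.f i) c) : ∃ s : A, s ^ p - s = c := by
  have hB : ∀ i, (p : 𝒱.B i) = 0 := fun i ↦ cast_eq_zero_of_ringHom (𝒱.φ i).hom hA
  choose x hx using fun i ↦ exists_pullFn_id_eq (R := 𝒱.B i) (θ i)
  have hxc : ∀ i, x i ^ p - x i = 𝒱.φ i c := fun i ↦ by
    apply pullFn_id_injective
    rw [map_sub, map_pow, hx, hθ, ← pullFn_specMap]
  obtain ⟨α, hα⟩ := (Cocycle.isCohomologous_iff _ _).mp h1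
  choose y hy hyα using fun i ↦ exists_hasValues_pullFn_id (hB i)
    ((α i).map Multiplicative.toAdd)
  -- The differences of the `x` and of the `y` on an overlap are both Frobenius-fixed with the
  -- values of `d`, so `eq_of_hasValues` identifies them.
  have hoverlap : ∀ i j, 𝒱.inl i j (x i - y i) = 𝒱.inr i j (x j - y j) := by
    intro i j
    have hO := 𝒱.cast_overlap_eq_zero hA i j
    have hw : 𝒱.inl i j (𝒱.φ i c) = 𝒱.inr i j (𝒱.φ j c) := by
      have := Spec.map_injective (by simpa using (𝒱.isPullback i j).w :
        Spec.map (𝒱.φ i ≫ 𝒱.inl i j) = Spec.map (𝒱.φ j ≫ 𝒱.inr i j))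
      exact congrArg (fun q ↦ q.hom c) this
    rw [map_sub, map_sub, sub_eq_sub_iff_sub_eq_sub]
    let T : Over (Spec A) := Over.mk (Spec.map (𝒱.inl i j) ≫ Spec.map (𝒱.φ i))
    let a : T ⟶ Over.mk (𝒱.toEtaleCover.f i) := Over.homMk (Spec.map (𝒱.inl i j)) rfl
    let b : T ⟶ Over.mk (𝒱.toEtaleCover.f j) := Over.homMk (Spec.map (𝒱.inr i j))
      (𝒱.isPullback i j).w.symm
    refine eq_of_hasValues (p := p) hO (φ := fun t ↦ (d.val a b t).toAdd) ?_ ?_ ?_ ?_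
    · rw [sub_pow_of_cast_eq_zero hO, sub_eq_sub_iff_sub_eq_sub, ← map_pow, ← map_pow,
        ← map_sub, ← map_sub, hxc, hxc, hw]
    · rw [sub_pow_of_cast_eq_zero hO, ← map_pow, ← map_pow, hy, hy]
    · have h2 := hd i j a b
      rw [← hx i, ← hx j] at h2
      change HasValues ((Spec.map (𝒱.inl i j)).appTop _ - (Spec.map (𝒱.inr i j)).appTop _) _ at h2
      rwa [appTop_specMap_pullFn_id, appTop_specMap_pullFn_id, ← map_sub] at h2
    · have hT : (p : Γ(Spec (𝒱.overlap i j), ⊤)) = 0 :=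
        cast_eq_zero_of_ringHom (pullFn (𝟙 _)) hO
      have h2 := ((hyα i).comp (Spec.map (𝒱.inl i j))).sub hT
        ((hyα j).comp (Spec.map (𝒱.inr i j)))
      rw [appTop_specMap_pullFn_id, appTop_specMap_pullFn_id, ← map_sub] at h2
      convert h2 using 1
      funext t
      have h3 := congrArg Multiplicative.toAdd (hα i j a b t)
      rw [toAdd_mul, toAdd_mul] at h3
      have h4 : (α i (a.left t)).toAdd + 0 = (d.val a b t).toAdd + (α j (b.left t)).toAdd := h3
      rw [add_zero] at h4
      exact eq_sub_of_add_eq h4.symm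
  obtain ⟨s, hs⟩ := 𝒱.exists_descent _ hoverlap
  refine ⟨s, 𝒱.eq_of_forall fun i ↦ ?_⟩
  rw [map_sub, map_pow, hs, sub_pow_of_cast_eq_zero (hB i), hy, sub_sub_sub_cancel_right, hxc]

/-- The spectrum of `B i ⊗ B j` carries the universal pair of points, so a single fixed function
there encodes all values of `d`. -/
lemma exists_overlap_functions [Fact p.Prime] (hA : (p : A) = 0)
    (d : Cocycle (Multiplicative (ZMod p)) 𝒱.toEtaleCover) :
    ∃ x : ∀ i j, 𝒱.overlap i j, (∀ i j, x i j ^ p = x i j) ∧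
      ∀ (i j : 𝒱.ι) {T : Over (Spec A)} (a : T ⟶ Over.mk (𝒱.toEtaleCover.f i))
        (b : T ⟶ Over.mk (𝒱.toEtaleCover.f j)) (g : T.left ⟶ Spec (𝒱.overlap i j)),
        g ≫ Spec.map (𝒱.inl i j) = a.left → g ≫ Spec.map (𝒱.inr i j) = b.left →
        HasValues (pullFn g (x i j)) (fun t ↦ (d.val a b t).toAdd) := by
  have key : ∀ i j : 𝒱.ι, ∃ x : 𝒱.overlap i j, x ^ p = x ∧
      ∀ {T : Over (Spec A)} (a : T ⟶ Over.mk (𝒱.toEtaleCover.f i))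
        (b : T ⟶ Over.mk (𝒱.toEtaleCover.f j)) (g : T.left ⟶ Spec (𝒱.overlap i j)),
        g ≫ Spec.map (𝒱.inl i j) = a.left → g ≫ Spec.map (𝒱.inr i j) = b.left →
        HasValues (pullFn g x) (fun t ↦ (d.val a b t).toAdd) := by
    intro i j
    let T₀ : Over (Spec A) := Over.mk (Spec.map (𝒱.inl i j) ≫ Spec.map (𝒱.φ i))
    let a₀ : T₀ ⟶ Over.mk (𝒱.toEtaleCover.f i) := Over.homMk (Spec.map (𝒱.inl i j)) rfl
    let b₀ : T₀ ⟶ Over.mk (𝒱.toEtaleCover.f j) := Over.homMk (Spec.map (𝒱.inr i j))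
      (𝒱.isPullback i j).w.symm
    obtain ⟨x, hx, hv⟩ := exists_hasValues_pullFn_id (𝒱.cast_overlap_eq_zero hA i j)
      (⟨_, (d.isLocallyConstant_val a₀ b₀).comp Multiplicative.toAdd⟩ :
        LocallyConstant (Spec (𝒱.overlap i j)) (ZMod p))
    refine ⟨x, hx, fun {T} a b g ha hb ↦ ?_⟩
    have hg : g ≫ Spec.map (𝒱.inl i j) ≫ Spec.map (𝒱.φ i) = T.hom := by
      rw [reassoc_of% ha]
      exact Over.w a
    let g' : T ⟶ T₀ := Over.homMk g hg
    have ha' : g' ≫ a₀ = a := Over.OverMorphism.ext ha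
    have hb' : g' ≫ b₀ = b := Over.OverMorphism.ext hb
    have h := hv.comp g
    rw [← pullFn_comp, Category.comp_id] at h
    convert h using 1
    funext t
    rw [← ha', ← hb', d.val_precomp]
    rfl
  choose x hx hv using key
  exact ⟨x, hx, hv⟩

/-- Every cocycle on an affine covering is the coboundary of a family of functions. -/
lemma exists_represents [Fact p.Prime] (hA : (p : A) = 0)
    (d : Cocycle (Multiplicative (ZMod p)) 𝒱.toEtaleCover) :
    ∃ (θ : ∀ i, Γ(𝒱.toEtaleCover.X i, ⊤)) (c : A), Represents d θ ∧
      ∀ i, θ i ^ p - θ i = pullFn (𝒱.toEtaleCover.f i) c := by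
  obtain ⟨x, hx, hv⟩ := 𝒱.exists_overlap_functions hA d
  -- The additive cocycle condition is checked on triple overlaps by comparing values of
  -- Frobenius-fixed functions.
  obtain ⟨b, hb⟩ := exists_sub_eq_of_cocycle 𝒱.exists_comap_eq x (by
    intro l i j
    let R : CommRingCat.{u} := .of (TensorProduct A (𝒱.B l) (𝒱.overlap i j))
    let ρ : 𝒱.overlap i j ⟶ R := CommRingCat.ofHom Algebra.TensorProduct.includeRight.toRingHom
    let ρ₁ : 𝒱.overlap l j ⟶ R := CommRingCat.ofHom
      (Algebra.TensorProduct.map (AlgHom.id A (𝒱.B l)) Algebra.TensorProduct.includeRight).toRingHom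
    let ρ₂ : 𝒱.overlap l i ⟶ R := CommRingCat.ofHom
      (Algebra.TensorProduct.map (AlgHom.id A (𝒱.B l)) Algebra.TensorProduct.includeLeft).toRingHom
    have e₁ : 𝒱.inl l j ≫ ρ₁ = 𝒱.inl l i ≫ ρ₂ := by
      ext z; simp [ρ₁, ρ₂]
    have e₂ : 𝒱.inr l j ≫ ρ₁ = 𝒱.inr i j ≫ ρ := by
      ext z; simp [ρ₁, ρ]
    have e₃ : 𝒱.inr l i ≫ ρ₂ = 𝒱.inl i j ≫ ρ := by
      ext z; simp [ρ, ρ₂]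
    have w₁ : 𝒱.φ l ≫ 𝒱.inl l j = 𝒱.φ j ≫ 𝒱.inr l j :=
      Spec.map_injective (by simpa using (𝒱.isPullback l j).w)
    have w₂ : 𝒱.φ l ≫ 𝒱.inl l i = 𝒱.φ i ≫ 𝒱.inr l i :=
      Spec.map_injective (by simpa using (𝒱.isPullback l i).w)
    have hR : (p : R) = 0 := cast_eq_zero_of_ringHom ρ.hom (𝒱.cast_overlap_eq_zero hA i j)
    let T : Over (Spec A) := Over.mk (Spec.map (𝒱.φ l ≫ 𝒱.inl l j ≫ ρ₁))
    let al : T ⟶ Over.mk (𝒱.toEtaleCover.f l) := Over.homMk (Spec.map (𝒱.inl l j ≫ ρ₁)) (by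
      change Spec.map _ ≫ Spec.map (𝒱.φ l) = Spec.map _
      rw [← Spec.map_comp])
    let aj : T ⟶ Over.mk (𝒱.toEtaleCover.f j) := Over.homMk (Spec.map (𝒱.inr l j ≫ ρ₁)) (by
      change Spec.map _ ≫ Spec.map (𝒱.φ j) = Spec.map _
      rw [← Spec.map_comp, reassoc_of% w₁])
    let ai : T ⟶ Over.mk (𝒱.toEtaleCover.f i) := Over.homMk (Spec.map (𝒱.inr l i ≫ ρ₂)) (by
      change Spec.map _ ≫ Spec.map (𝒱.φ i) = Spec.map _
      rw [← Spec.map_comp, ← reassoc_of% w₂, e₁])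
    have v := hv i j ai aj (Spec.map ρ) (by rw [← Spec.map_comp, ← e₃]; rfl)
      (by rw [← Spec.map_comp, ← e₂]; rfl)
    have v₁ := hv l j al aj (Spec.map ρ₁) (by rw [← Spec.map_comp]; rfl)
      (by rw [← Spec.map_comp]; rfl)
    have v₂ := hv l i al ai (Spec.map ρ₂) (by rw [← Spec.map_comp, ← e₁]; rfl)
      (by rw [← Spec.map_comp]; rfl)
    rw [pullFn_specMap] at v v₁ v₂
    have v₁₂ := v₁.sub (cast_eq_zero_of_ringHom (pullFn (𝟙 _)) hR) v₂
    rw [← map_sub] at v₁₂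
    refine eq_of_hasValues (R := R) (p := p) hR (x := ρ (x i j)) (y := ρ₁ (x l j) - ρ₂ (x l i))
      ?_ ?_ v ?_
    · rw [← map_pow, hx]
    · rw [sub_pow_of_cast_eq_zero hR, ← map_pow, ← map_pow, hx, hx]
    · convert v₁₂ using 1
      funext t
      rw [← d.val_trans al ai aj t, toAdd_mul, add_sub_cancel_left])
  -- The coboundary of `b` is fixed by Frobenius, so `℘(b i)` agree on overlaps and descend to `c`.
  have hfix : ∀ i j, 𝒱.inl i j (b i ^ p - b i) = 𝒱.inr i j (b j ^ p - b j) := by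
    intro i j
    have h1 := hx i j
    have h2 : x i j = 𝒱.inl i j (b i) - 𝒱.inr i j (b j) := hb i j
    rw [h2, sub_pow_of_cast_eq_zero (𝒱.cast_overlap_eq_zero hA i j),
      sub_eq_sub_iff_sub_eq_sub] at h1
    rw [map_sub, map_sub, map_pow, map_pow, h1]
  obtain ⟨c, hc⟩ := 𝒱.exists_descent _ hfix
  refine ⟨fun i ↦ pullFn (𝟙 (Spec (𝒱.B i))) (b i), c, fun i j T a a' ↦ ?_, fun i ↦ ?_⟩
  · obtain ⟨g, hg, hg'⟩ := 𝒱.exists_lift a a'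
    have h := hv i j a a' g hg hg'
    have h2 : x i j = 𝒱.inl i j (b i) - 𝒱.inr i j (b j) := hb i j
    rw [h2, map_sub, ← pullFn_comp_specMap, ← pullFn_comp_specMap, hg, hg'] at h
    rw [← pullFn_comp, ← pullFn_comp, Category.comp_id, Category.comp_id]
    exact h
  · rw [← map_pow, ← map_sub, ← hc, ← pullFn_specMap]

end AffineCover

end AffineCover

end LocalGlobal
namespace LocalGlobal

/-! ### Injectivity for `ℤ/p` in terms of Artin–Schreier equations. -/

section ArtinSchreier

variable {p : ℕ}

/-- The quotient of two cocycles with values in a commutative group. -/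
def Cocycle.div {S : Scheme.{u}} {𝒰 : EtaleCover S} {C : Type w} [CommGroup C]
    (γ δ : Cocycle C 𝒰) : Cocycle C 𝒰 :=
  .ofVal (fun _ _ _ a b t ↦ γ.val a b t / δ.val a b t)
    (fun _ _ _ a b ↦ (γ.isLocallyConstant_val a b).div (δ.isLocallyConstant_val a b))
    (fun _ _ _ _ φ a b t ↦ by rw [γ.val_precomp, δ.val_precomp])
    (fun _ _ _ _ a b c t ↦ by rw [div_mul_div_comm, γ.val_trans, δ.val_trans])

lemma Cocycle.isCohomologous_iff_div {S : Scheme.{u}} {𝒰 : EtaleCover S} {C : Type w}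
    [CommGroup C] (γ δ : Cocycle C 𝒰) :
    γ.IsCohomologous δ ↔ (1 : Cocycle C 𝒰).IsCohomologous (δ.div γ) := by
  rw [Cocycle.isCohomologous_iff, Cocycle.isCohomologous_iff]
  refine exists_congr fun σ ↦ forall_congr' fun i ↦ forall_congr' fun j ↦ forall_congr' fun T ↦
    forall_congr' fun a ↦ forall_congr' fun b ↦ forall_congr' fun t ↦ ?_
  change _ ↔ σ i (a.left t) * 1 = δ.val a b t / γ.val a b t * σ j (b.left t)
  rw [mul_one, div_mul_eq_mul_div, eq_div_iff_mul_eq']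

variable {A L : CommRingCat.{u}}

lemma cast_Γ_spec_eq_zero (hA : (p : A) = 0) : (p : Γ(Spec A, ⊤)) = 0 :=
  cast_eq_zero_of_ringHom (pullFn (𝟙 _)) hA

lemma appTop_pullFn_id {T : Scheme.{u}} (g : T ⟶ Spec A) (x : A) :
    g.appTop (pullFn (𝟙 _) x) = pullFn g x := by
  rw [← pullFn_comp, Category.comp_id]

/-- The cocycle `d` is the class of the torsor `℘(r) = a`. It is trivial over `L` because `r - h` is
Frobenius-fixed, hence trivial over `A`, which makes a solution descend to `A`. -/
theorem exists_artinSchreier_eq_of_injective [Fact p.Prime] (ψ : A ⟶ L) (hA : (p : A) = 0)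
    (hψ : Function.Injective (H1.pullback (Spec.map ψ) (Multiplicative (ZMod p))))
    {a : A} {h : L} (hh : h ^ p - h = ψ a) : ∃ s : A, s ^ p - s = a := by
  have hS := cast_Γ_spec_eq_zero hA
  have hL : (p : L) = 0 := cast_eq_zero_of_ringHom ψ.hom hA
  have hS' := cast_Γ_spec_eq_zero hL
  let 𝒰 := (asCover hA a).toEtaleCover
  let B : CommRingCat.{u} := .of (AdjoinRoot (asPoly p a))
  let φ : A ⟶ B := CommRingCat.ofHom (algebraMap A (AdjoinRoot (asPoly p a)))
  let r : B := AdjoinRoot.root (asPoly p a)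
  have hr : r ^ p - r = φ a := by
    have h0 : AdjoinRoot.mk (asPoly p a) (asPoly p a) = 0 := AdjoinRoot.mk_self
    have h1 : AdjoinRoot.mk (asPoly p a) (asPoly p a) = r ^ p - r - φ a := by
      conv_lhs => enter [2]; rw [asPoly]
      rw [map_sub, map_sub, map_pow, AdjoinRoot.mk_X, AdjoinRoot.mk_C]
      rfl
    rw [h0] at h1
    exact (sub_eq_zero.mp h1.symm)
  let θ : ∀ i, Γ(𝒰.X i, ⊤) := fun _ ↦ pullFn (𝟙 (Spec B)) r
  have hθ : ∀ i, θ i ^ p - θ i = (𝒰.f i).appTop (pullFn (𝟙 _) a) := by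
    intro i
    change pullFn (𝟙 (Spec B)) r ^ p - pullFn (𝟙 (Spec B)) r = (Spec.map φ).appTop _
    rw [← map_pow, ← map_sub, hr, appTop_specMap_pullFn_id]
  obtain ⟨d, hd⟩ := exists_represents hS θ _ hθ
  let m := CoverMap.ofPullback (Spec.map ψ) 𝒰
  have hm : (1 : Cocycle (Multiplicative (ZMod p))
      (pullbackCover (Spec.map ψ) 𝒰)).IsCohomologous (m.pullbackCocycle d) := by
    refine ((hd.pullback m).sub_const (pullFn (𝟙 _) h)).isCohomologous_one hS' fun i ↦ ?_
    have hW := cast_eq_zero_of_ringHom ((pullbackCover (Spec.map ψ) 𝒰).f i).appTop.hom hS'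
    rw [sub_pow_of_cast_eq_zero hW, sub_eq_sub_iff_sub_eq_sub, ← map_pow, ← map_pow, ← map_sub,
      ← map_sub, hθ, ← map_pow, ← map_sub, hh, ← appTop_specMap_pullFn_id]
    have hc := m.comm i
    have h1 := congrArg (fun q ↦ Scheme.Hom.appTop q (pullFn (𝟙 _) a)) hc
    simp only [Scheme.Hom.comp_appTop, CommRingCat.comp_apply] at h1
    exact h1
  obtain ⟨𝒱, n, hn⟩ := H1.pullback_injective_iff.mp hψ 𝒰 _ m 1 d hm
  obtain ⟨𝒱', ⟨n'⟩⟩ := 𝒱.exists_affine_refinement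
  have hn' := n'.isCohomologous_pullback hn
  refine 𝒱'.exists_artinSchreier_eq hA ((hd.pullback n).pullback n') hn' fun i ↦ ?_
  rw [← map_pow, ← map_sub, ← map_pow, ← map_sub, hθ]
  have h1 := congrArg (fun q ↦ Scheme.Hom.appTop q (pullFn (𝟙 _) a)) (n.comm (n'.idx i))
  have h2 := congrArg (fun q ↦ Scheme.Hom.appTop q (pullFn (𝟙 _) a)) (n'.comm i)
  simp only [Category.comp_id, Scheme.Hom.comp_appTop, CommRingCat.comp_apply] at h1 h2
  rw [h1, h2, appTop_pullFn_id]

/-- By commutativity it suffices to treat one cocycle `d`, trivial over `L`. Represent it by `θ`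
with `℘(θ) = c`. Then `c` is in the image of `℘` over `L`, so `c = ℘(g)` over `A`, and the
Frobenius-fixed `θ - g` trivialize `d`. -/
theorem injective_pullback_of_artinSchreier [Fact p.Prime] (ψ : A ⟶ L) (hA : (p : A) = 0)
    (hψ : ∀ (a : A) (h : L), h ^ p - h = ψ a → ∃ s : A, s ^ p - s = a) :
    Function.Injective (H1.pullback (Spec.map ψ) (Multiplicative (ZMod p))) := by
  have hS := cast_Γ_spec_eq_zero hA
  have hL : (p : L) = 0 := cast_eq_zero_of_ringHom ψ.hom hA
  refine H1.pullback_injective_iff.mpr fun 𝒰 𝒲 m γ δ hγδ ↦ ?_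
  rw [Cocycle.isCohomologous_iff_div] at hγδ
  obtain ⟨𝒱, ⟨n⟩⟩ := 𝒰.exists_affine_refinement
  refine ⟨𝒱.toEtaleCover, n, (Cocycle.isCohomologous_iff_div _ _).mpr ?_⟩
  change OneCocycle.IsCohomologous 1 (n.pullbackCocycle (δ.div γ))
  replace hγδ : OneCocycle.IsCohomologous 1 (m.pullbackCocycle (δ.div γ)) := hγδ
  generalize δ.div γ = d at hγδ ⊢
  obtain ⟨θ, c, hd, hθ⟩ := 𝒱.exists_represents hA (n.pullbackCocycle d)
  let f := Spec.map ψ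
  let 𝒱' := pullbackCover f 𝒱.toEtaleCover
  obtain ⟨𝒲', ⟨r⟩⟩ := (interCover 𝒲 𝒱').exists_affine_refinement
  let r₁ := (r.comp (CoverMap.interFst 𝒲 𝒱')).cast (Category.comp_id _)
  let r₂ := ((r.comp (CoverMap.interSnd 𝒲 𝒱')).comp
    (CoverMap.ofPullback f 𝒱.toEtaleCover)).cast (by simp : (𝟙 _ ≫ 𝟙 _) ≫ f = f)
  have h1 : (1 : Cocycle (Multiplicative (ZMod p)) 𝒲'.toEtaleCover).IsCohomologous
      (r₂.pullbackCocycle (n.pullbackCocycle d)) := by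
    refine Cocycle.isCohomologous_trans (r₁.isCohomologous_pullback hγδ) ?_
    rw [← CoverMap.pullbackCocycle_comp, ← CoverMap.pullbackCocycle_comp,
      ← CoverMap.pullbackCocycle_cast _ (Category.id_comp f),
      ← CoverMap.pullbackCocycle_cast _ (Category.comp_id f)]
    exact CoverMap.isCohomologous_of_maps _ _ _
  obtain ⟨s, hs⟩ := 𝒲'.exists_artinSchreier_eq hL (hd.pullback r₂) h1 (c := ψ c) fun i ↦ by
    rw [← map_pow, ← map_sub, hθ, ← pullFn_comp, r₂.comm, pullFn_comp_specMap]
  obtain ⟨g, hg⟩ := hψ c s hs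
  refine (hd.sub_const (pullFn (𝟙 _) g)).isCohomologous_one hS fun i ↦ ?_
  rw [sub_pow_of_cast_eq_zero (cast_eq_zero_of_ringHom (𝒱.toEtaleCover.f i).appTop.hom hS),
    sub_eq_sub_iff_sub_eq_sub, hθ, appTop_pullFn_id, ← map_pow, ← map_sub, hg]

end ArtinSchreier

/-! ### Functoriality of `H1` and transport to arbitrary affine schemes. -/

section Transport

variable {S₁ S₂ S₃ : Scheme.{u}} {G : Type w} [Group G]

lemma H1.pullback_comp (f : S₁ ⟶ S₂) (g : S₂ ⟶ S₃) :
    H1.pullback (f ≫ g) G = H1.pullback f G ∘ H1.pullback g G := by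
  funext x
  induction x using Quotient.inductionOn with | _ x
  obtain ⟨𝒰, γ⟩ := x
  change H1.pullback (f ≫ g) G (H1.mk 𝒰 γ) = H1.pullback f G (H1.pullback g G (H1.mk 𝒰 γ))
  let m := CoverMap.ofPullback g 𝒰
  let n := CoverMap.ofPullback f (pullbackCover g 𝒰)
  rw [H1.pullback_mk (n.comp m), H1.pullback_mk m, H1.pullback_mk n,
    CoverMap.pullbackCocycle_comp]

lemma H1.pullback_id : H1.pullback (𝟙 S₁) G = id := by
  funext x
  induction x using Quotient.inductionOn with | _ x
  obtain ⟨𝒰, γ⟩ := x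
  change H1.pullback (𝟙 S₁) G (H1.mk 𝒰 γ) = H1.mk 𝒰 γ
  rw [H1.pullback_mk (CoverMap.refl 𝒰), CoverMap.refl_pullbackCocycle]

lemma H1.pullback_bijective_of_isIso (f : S₁ ⟶ S₂) [IsIso f] :
    Function.Bijective (H1.pullback f G) := by
  refine Function.bijective_iff_has_inverse.mpr ⟨H1.pullback (inv f) G, fun x ↦ ?_, fun x ↦ ?_⟩
  · rw [← Function.comp_apply (f := H1.pullback (inv f) G), ← H1.pullback_comp, IsIso.inv_hom_id,
      H1.pullback_id, id]
  · rw [← Function.comp_apply (f := H1.pullback f G), ← H1.pullback_comp, IsIso.hom_inv_id,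
      H1.pullback_id, id]

theorem injective_pullback_iff_artinSchreier {p : ℕ} [Fact p.Prime] {S : Scheme.{u}} [IsAffine S]
    {L : CommRingCat.{u}} (f : Spec L ⟶ S) (hS : (p : Γ(S, ⊤)) = 0) :
    Function.Injective (H1.pullback f (Multiplicative (ZMod p))) ↔
      ∀ (a : Γ(S, ⊤)) (h : L), h ^ p - h = (Scheme.ΓSpecIso L).hom (f.appTop a) →
        ∃ s : Γ(S, ⊤), s ^ p - s = a := by
  let ψ : Γ(S, ⊤) ⟶ L := f.appTop ≫ (Scheme.ΓSpecIso L).hom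
  have hf : f ≫ S.isoSpec.hom = Spec.map ψ := by
    simp [ψ, Scheme.isoSpec, Scheme.toSpecΓ_naturality]
  have h1 : Function.Injective (H1.pullback f (Multiplicative (ZMod p))) ↔
      Function.Injective (H1.pullback (Spec.map ψ) (Multiplicative (ZMod p))) := by
    rw [← hf, H1.pullback_comp]
    exact (Function.Injective.of_comp_iff' _ (H1.pullback_bijective_of_isIso _)).symm
  rw [h1]
  exact ⟨fun h a x hx ↦ exists_artinSchreier_eq_of_injective ψ hS h hx,
    fun h ↦ injective_pullback_of_artinSchreier ψ hS h⟩

end Transport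

end LocalGlobal
namespace LocalGlobal

/-! ### Injectivity of the restriction of functions to the formal punctured neighbourhood. -/

section Restriction

variable {k : Type u} [Field k] {Y : Scheme.{u}} {π : Y ⟶ Spec (.of k)} {y : Spec (.of k) ⟶ Y}

/-- Krull's intersection theorem: a noetherian local ring embeds in its completion. -/
lemma FormalCoordinate.expand_injective [IsLocallyNoetherian Y] (e : FormalCoordinate π y) :
    Function.Injective e.expand := by
  have h1 : Function.Injective (algebraMap k⟦X⟧ k⸨X⸩) := IsFractionRing.injective _ _
  have h2 : IsHausdorff (IsLocalRing.maximalIdeal (localRing y)) (localRing y) := inferInstance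
  exact (h1.comp e.equiv.injective).comp (AdicCompletion.of_injective _ (localRing y))

/-- Since `expand` is injective, `Spec k((t))` maps to the generic point. -/
lemma FormalCoordinate.toCurve_mem [IsLocallyNoetherian Y] [IsIntegral Y]
    (e : FormalCoordinate π y) (x : Spec (.of k⸨X⸩)) {U : Y.Opens} (hU : (U : Set Y).Nonempty) :
    e.toCurve x ∈ U := by
  have hη : genericPoint Y ∈ U :=
    ((genericPoint_spec Y).mem_open_set_iff U.2).mpr (by simpa using hU)
  have hs : genericPoint Y ⤳ point y := genericPoint_specializes _
  obtain ⟨q, hq⟩ : genericPoint Y ∈ Set.range (Y.fromSpecStalk (point y)) := by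
    rw [Scheme.range_fromSpecStalk]; exact hs
  have hle : Spec.map (CommRingCat.ofHom e.expand) x ⤳ q := by
    refine (PrimeSpectrum.le_iff_specializes _ _).mp fun a ha ↦ ?_
    have ha' : e.expand a ∈ PrimeSpectrum.asIdeal x := ha
    have h0 : PrimeSpectrum.asIdeal x = ⊥ := (eq_bot_or_eq_top _).resolve_right x.isPrime.ne_top
    rw [h0, Ideal.mem_bot] at ha'
    rw [e.expand_injective (ha'.trans (map_zero _).symm)]
    exact zero_mem _
  have h := hle.map (Y.fromSpecStalk (point y)).continuous
  rw [hq] at h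
  exact h.mem_open U.2 hη

/-- If `f ≠ 0`, its nonvanishing locus is nonempty and so contains the image of `Spec k((t))`; but
the pullback of `f` vanishes there. -/
lemma FormalCoordinate.restrict_injective [IsLocallyNoetherian Y] [IsIntegral Y] [IsSeparated π]
    (e : FormalCoordinate π y) (hy : y ≫ π = 𝟙 _) : Function.Injective (e.restrict hy) := by
  rw [injective_iff_map_eq_zero]
  intro f hf
  let Y' : Scheme.{u} := complement π y hy
  let g : Spec (.of k⸨X⸩) ⟶ Y' := e.toComplement hy
  have hg : g ≫ (complement π y hy).ι = e.toCurve := IsOpenImmersion.lift_fac _ _ _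
  let x : Spec (.of k⸨X⸩) := IsLocalRing.closedPoint k⸨X⸩
  have hne : Nonempty Y' := ⟨g x⟩
  have hint : IsIntegral Y' := isIntegral_of_isOpenImmersion (complement π y hy).ι
  have hgf : g.appTop f = 0 := by
    have h := congrArg (Scheme.ΓSpecIso (.of k⸨X⸩)).inv hf
    simpa [FormalCoordinate.restrict] using h
  by_contra hf0
  have hD : ((Y'.basicOpen f : Y'.Opens) : Set Y').Nonempty := by
    rw [← TopologicalSpace.Opens.ne_bot_iff_nonempty]
    exact fun h ↦ hf0 ((basicOpen_eq_bot_iff f).mp h)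
  have hmem : e.toCurve x ∈ (complement π y hy).ι ''ᵁ Y'.basicOpen f :=
    e.toCurve_mem x (by
      obtain ⟨z, hz⟩ := hD
      exact ⟨_, z, hz, rfl⟩)
  rw [← hg, Scheme.Hom.comp_apply] at hmem
  obtain ⟨z, hz, hzx⟩ := hmem
  have hz' : z = g x := (complement π y hy).ι.isOpenEmbedding.injective hzx
  rw [hz'] at hz
  have h3 : x ∈ g ⁻¹ᵁ Y'.basicOpen f := hz
  rw [Scheme.preimage_basicOpen_top, hgf, Scheme.basicOpen_zero] at h3
  exact h3

end Restriction

end LocalGlobal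

/-! ### The main theorem. -/

theorem theorem1p4 {p : ℕ} [Fact p.Prime] {k : Type u} [Field k] [CharP k p]
    {Y : Scheme.{u}} (π : Y ⟶ Spec (.of k))
    [IsIntegral Y] [IsProper π] [SmoothOfRelativeDimension 1 π]
    (y : Spec (.of k) ⟶ Y) (hy : y ≫ π = 𝟙 (Spec (.of k)))
    (e : LocalGlobal.FormalCoordinate π y)
    (G : Type w) [Group G] [Finite G] [Nontrivial G] (hG : IsPGroup p G) :
    List.TFAE
      [Set.range (LocalGlobal.artinSchreier p : k⸨X⸩ → k⸨X⸩) ∩ Set.range (e.restrict hy) =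
          e.restrict hy '' Set.range (LocalGlobal.artinSchreier p),
        Function.Injective (e.Psi hy G),
        Function.Injective (e.Psi hy (Multiplicative (ZMod p)))] := by
  have hnoeth : IsLocallyNoetherian Y := LocallyOfFiniteType.isLocallyNoetherian π
  have haff := LocalGlobal.isAffine_complement e hy
  have hres := e.restrict_injective hy
  have hp : (p : Γ(LocalGlobal.complement π y hy, ⊤)) = 0 := by
    refine hres ?_
    have : (p : k⸨X⸩) = 0 :=
      LocalGlobal.cast_eq_zero_of_ringHom (HahnSeries.C : k →+* k⸨X⸩) (CharP.cast_eq_zero k p)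
    rw [map_natCast, map_zero, this]
  have hsub : Subsingleton (Spec (.of k⸨X⸩) : Scheme.{u}) :=
    inferInstanceAs (Subsingleton (PrimeSpectrum k⸨X⸩))
  have hne : Nonempty (Spec (.of k⸨X⸩) : Scheme.{u}) :=
    inferInstanceAs (Nonempty (PrimeSpectrum k⸨X⸩))
  tfae_have 3 → 2 := fun h ↦ LocalGlobal.injective_pullback_of_isPGroup h G hG
  tfae_have 2 → 3 := fun h ↦ LocalGlobal.injective_pullback_zmod_of_isPGroup hG h
  tfae_have 1 ↔ 3 := by
    have key := LocalGlobal.injective_pullback_iff_artinSchreier (e.toComplement hy) hp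
    refine Iff.trans ?_ key.symm
    constructor
    -- Injectivity of the restriction map turns an equality in `k((t))` into one in `𝒪(Y')`.
    · intro H a h hh
      have hmem : e.restrict hy a ∈ e.restrict hy '' Set.range (LocalGlobal.artinSchreier p) :=
        H ▸ ⟨⟨h, hh⟩, a, rfl⟩
      obtain ⟨_, ⟨s, rfl⟩, hs⟩ := hmem
      exact ⟨s, hres hs⟩
    · intro H
      ext z
      constructor
      · rintro ⟨⟨h, hh⟩, a, rfl⟩
        obtain ⟨s, hs⟩ := H a h hh
        exact ⟨a, ⟨s, hs⟩, rfl⟩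
      · rintro ⟨_, ⟨s, rfl⟩, rfl⟩
        exact ⟨⟨e.restrict hy s, by simp [LocalGlobal.artinSchreier]⟩, _, rfl⟩
  tfae_finish
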